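/- Let $n\ge 1$, $k\ge 0$, $m\ge 1$ be integers. For a rooted labeled tree $T$ on $[n]=\{1,\dots,n\}$ and a node $x$, let $T_x=T(x)$ be the subtree rooted at $x$ and $\beta(x)=\beta(T_x)=\min T_x$; write $z\prec x$ if $z\in T_x$ (so $x\prec x$); $\deg(x)$ is the number of children of $x$. The edge from $y$ to its father $x$ is proper if $x<\beta(y)$, and improper otherwise. Let $\mathcal R^{(0)}_{n,k}$ be the set of rooted labeled trees on $[n]$ with exactly $k$ improper edges and with no proper edge on the path from $n$ to the root; a list of conditions in brackets denotes the subset of trees that satisfy them. Let $$\alpha=\max\{\beta(b): b\text{ a child of }n\},\qquad \beta^*=\min\{\beta(a): a\text{ a child of }1\}$$ (when $\deg(n)>0$, respectively $\deg(1)>0$), and, when $\deg(n)>0$, let $\lambda$ be the first node $u\ne n$ on the path from $n$ down to $\beta(n)$ such that every node of $T_n-T_u$ is greater than $u$. The minimum of an empty set of nodes is regarded as $+\infty$. Moving a subtree means cutting it off from its father and joining it to another node as a subtree. The maps described below are bijections: (a) $\mathcal R^{(0)}_{n,k}[\deg(1)=m,\,1\not\prec n,\,\alpha<\beta^*]\longleftrightarrow\mathcal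 R^{(0)}_{n,k+m}[\deg(1)=0,\,\deg(n)\ge m+1,\,1\not\prec n]$: move all subtrees of $1$ to $n$. (b) $\mathcal R^{(0)}_{n,k}[\deg(1)=m,\,\alpha>\beta^*]\longleftrightarrow\mathcal R^{(0)}_{n,k+m}[\deg(1)=0,\,\deg(n)=m,\,1\not\prec n]$: exchange the node $n$ and the subtree $T_\alpha$ (so $T_\alpha$ takes the place of $n$, the other subtrees of $n$ are joined to $\alpha$, and $n$ becomes a leaf in the former place of $T_\alpha$); then move all subtrees of $1$ to $n$. (c) $\mathcal R^{(0)}_{n,k}[\deg(1)=m,\,1\prec n,\,\deg(n)\ge 2,\,\alpha<\beta^*]\longleftrightarrow\mathcal R^{(0)}_{n,k+m}[\deg(1)=0,\,\deg(n)\ge m+1,\,1\prec n,\,\lambda>1]$: let $b_1,\dots,b_j$ be the children of $n$ with $1=\beta(b_1)<\beta(b_2)<\dots<\beta(b_j)$, and let $c$ be the first node on the path from $b_2$ down to $\beta(b_2)$ with $c<\beta(T(b_2)-T(c))$, $c<\beta^*$ and, if $j\ge3$, $c<\beta(b_3)$; move $T_{b_1}$ to $c$ and all subtrees of $1$ to $n$.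 (d) $\mathcal R^{(0)}_{n,k}[\deg(1)=m,\,1\prec n,\,\deg(n)=1]\longleftrightarrow\mathcal R^{(0)}_{n,k+m}[\deg(1)=0,\,\deg(n)=m,\,1\prec n,\,\lambda>1]$: let $b$ be the child of $n$ and let $a_1,\dots,a_m$ be the children of $1$ with $\beta(a_1)<\dots<\beta(a_m)$; move $T_{a_2},\dots,T_{a_m}$ to $n$, and in the resulting tree replace the subtree $S$ rooted at $b$ by the tree $S'$ defined as follows. Put $v=a_1$, $w=\beta(v)$, and let $b=v_1,\dots,v_t=1$ be the path from $b$ to $1$. Let $j_1<\dots<j_s=t$ be the indices $j$ with $v_j<\beta(S(v_1)-S(v_j))$ and $v_j<w$. Cut the edge $(1,v)$ and the edges $(v_{j_i},v_{j_i+1})$ for $1\le i<s$; this splits $S$ into $S_v$ and $s$ trees $R_1,\dots,R_s$, with roots $v_1,v_{j_1+1},\dots,v_{j_{s-1}+1}$. Then $S'$ is obtained from $S_v$ by joining every $R_i$ as a subtree of the node $w$. Moreover, the four sets on the left are pairwise disjoint with union $\mathcal R^{(0)}_{n,k}[\deg(1)=m]$, and the four sets on the right are pairwise disjoint with union $\mathcal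 R^{(0)}_{n,k+m}[\deg(1)=0,\,\deg(n)\ge m,\,\lambda>1]$; so (a)–(d) together refine a bijection between these two sets. -/

import Mathlib

/-- A father map on a set `V` of labels encodes a rooted labeled tree with node set `V`:
`p x` is the father of `x` when `x` is not the root, and the root is sent to itself.
It is a rooted tree when some fixed point is reached from every node by going up
(this fixed point is then unique, and the tree and the map determine each other). -/
def IsRootedTree {V : Type*} (p : V → V) : Prop :=
  ∃ r : V, p r = r ∧ ∀ x : V, ∃ j : ℕ, p^[j] x = r

/-- `z ≺ x`: the node `z` is a descendant of the node `x` (every node descends from itself). -/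
def IsDesc {V : Type*} (p : V → V) (z x : V) : Prop := ∃ j : ℕ, p^[j] z = x

/-- `u` lies on the path from `x` down to its descendant `y` (end points included). -/
def OnPath {V : Type*} (p : V → V) (x y u : V) : Prop := IsDesc p u x ∧ IsDesc p y u

/-- `u` is the first node satisfying `P` on the path that goes from `x` down to `y`. -/
def IsFirstOnPath {V : Type*} (p : V → V) (x y : V) (P : V → Prop) (u : V) : Prop :=
  OnPath p x y u ∧ P u ∧ ∀ u' : V, OnPath p x y u' → P u' → IsDesc p u' u

open Classical in
/-- Cut off the subtree rooted at each node of `S` and join it to the node `y`. -/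
noncomputable def moveSubtrees {V : Type*} (p : V → V) (S : Finset V) (y : V) : V → V :=
  fun z => if z ∈ S then y else p z

open Classical in
/-- Exchange the labels of the nodes `x` and `y`. -/
noncomputable def exchangeLabels {V : Type*} (p : V → V) (x y : V) : V → V :=
  fun z => Equiv.swap x y (p (Equiv.swap x y z))

section Tree

variable {V : Type*} [Fintype V]

open Classical in
/-- The set of nodes of the subtree `T_x`. -/
noncomputable def subtree (p : V → V) (x : V) : Finset V :=
  Finset.univ.filter (fun z => IsDesc p z x)

theorem subtree_nonempty (p : V → V) (x : V) : (subtree p x).Nonempty :=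
  ⟨x, by simp only [subtree, Finset.mem_filter, Finset.mem_univ, true_and]; exact ⟨0, rfl⟩⟩

variable [LinearOrder V] [BoundedOrder V]

open Classical in
/-- The set of children of the node `x`. -/
noncomputable def children (p : V → V) (x : V) : Finset V :=
  Finset.univ.filter (fun y => p y = x ∧ y ≠ x)

/-- The degree of `x`: its number of children. -/
noncomputable def deg (p : V → V) (x : V) : ℕ := (children p x).card

/-- `β(x)`: the smallest node of the subtree `T_x`. -/
noncomputable def beta (p : V → V) (x : V) : V := (subtree p x).min' (subtree_nonempty p x)

/-- The edge from `y` (not the root) to its father is proper: the father is smaller than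
every node of `T_y`. -/
def IsProperEdge (p : V → V) (y : V) : Prop := p y ≠ y ∧ p y < beta p y

/-- The edge from `y` (not the root) to its father is improper. -/
def IsImproperEdge (p : V → V) (y : V) : Prop := p y ≠ y ∧ ¬ p y < beta p y

open Classical in
/-- The number of improper edges. -/
noncomputable def improperCount (p : V → V) : ℕ :=
  (Finset.univ.filter (fun y => IsImproperEdge p y)).card

open Classical in
/-- The number of proper edges on the path from the largest node `⊤` to the root. -/
noncomputable def properOnTopPath (p : V → V) : ℕ :=
  (Finset.univ.filter (fun y => IsDesc p ⊤ y ∧ IsProperEdge p y)).card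

/-- `α`: the largest `β(b)` over the children `b` of the largest node `⊤`
(meaningful when `⊤` has a child). -/
noncomputable def alpha (p : V → V) : V := (children p ⊤).sup (beta p)

/-- `β*`: the smallest `β(a)` over the children `a` of the smallest node `⊥`
(meaningful when `⊥` has a child). -/
noncomputable def betaStar (p : V → V) : V := (children p ⊥).inf (beta p)

/-- `u < β(T_x - T_u)`: every node of `T_x` outside `T_u` is greater than `u`. -/
def BelowRest (p : V → V) (x u : V) : Prop := ∀ z ∈ subtree p x, z ∉ subtree p u → u < z

/-- `λ`: the lower critical node, i.e. the first node `u ≠ ⊤` on the path from `⊤` to `β(⊤)`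
with `u < β(T_⊤ - T_u)` (meaningful when `⊤` has a child). -/
noncomputable def lowerCritical (p : V → V) : V :=
  Classical.epsilon (IsFirstOnPath p ⊤ (beta p ⊤) (fun u => u ≠ ⊤ ∧ BelowRest p ⊤ u))

/-- The node of the nonempty set `C` whose subtree has the smallest minimum. -/
noncomputable def argminBeta (p : V → V) (C : Finset V) : V :=
  Classical.epsilon (fun b => b ∈ C ∧ ∀ b' ∈ C, beta p b ≤ beta p b')

/-- Move all subtrees of `⊥` to `⊤`. -/
noncomputable def mapA (p : V → V) : V → V := moveSubtrees p (children p ⊥) ⊤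

/-- Exchange the node `⊤` and the subtree `T_α`: the subtree `T_α` takes the place of the node
`⊤`, with the other subtrees of `⊤` now hanging from `α`, and `⊤` becomes a leaf at the place
where `T_α` was. (After an exchange of labels, the former subtrees of `α` hang from `⊤`; they
follow `α`.) -/
noncomputable def exchangeTop (p : V → V) : V → V :=
  moveSubtrees (exchangeLabels p ⊤ (alpha p))
    (children (exchangeLabels p ⊤ (alpha p)) ⊤) (alpha p)

/-- Exchange the node `⊤` and the subtree `T_α`, then move all subtrees of `⊥` to `⊤`. -/
noncomputable def mapB (p : V → V) : V → V :=
  moveSubtrees (exchangeTop p) (children (exchangeTop p) ⊥) ⊤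

open Classical in
/-- The children `b` of `⊤` with `⊥ ≺ b`; there is exactly one when `⊥ ≺ ⊤ ≠ ⊥`. -/
noncomputable def childrenAboveBot (p : V → V) : Finset V :=
  (children p ⊤).filter (fun b => IsDesc p ⊥ b)

open Classical in
/-- The children `b` of `⊤` with `⊥ ⊀ b`. -/
noncomputable def childrenOffBot (p : V → V) : Finset V :=
  (children p ⊤).filter (fun b => ¬ IsDesc p ⊥ b)

/-- Let `b₁, b₂, …, b_j` be the children of `⊤` in increasing order of `β`, with `⊥ ≺ b₁`.
This is `b₂`. -/
noncomputable def secondChild (p : V → V) : V := argminBeta p (childrenOffBot p)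

/-- The first node `c` on the path from `b₂` to `β(b₂)` such that `c < β(T(b₂) - T(c))`,
`c < β*`, and `c < β(b₃)` if `j ≥ 3` (equivalently `c < β(b_i)` for all `i ≥ 3`). -/
noncomputable def joinNode (p : V → V) : V :=
  Classical.epsilon (IsFirstOnPath p (secondChild p) (beta p (secondChild p)) (fun c =>
    BelowRest p (secondChild p) c ∧ c < betaStar p ∧
      ∀ b ∈ childrenOffBot p, b ≠ secondChild p → c < beta p b))

/-- Move the subtree `T_{b₁}` to the node `joinNode`, and all subtrees of `⊥` to `⊤`. -/
noncomputable def mapC (p : V → V) : V → V :=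
  moveSubtrees (moveSubtrees p (childrenAboveBot p) (joinNode p)) (children p ⊥) ⊤

/-- The nodes at which the path from `b` down to `⊥` is cut: those nodes `u` on it with
`u < β(T_b - T_u)` and `u < w`. (The nodes with the first property decrease along the path,
so from the first cut node on, the second property is automatic.) -/
def IsCutNode (p : V → V) (b w u : V) : Prop := OnPath p b ⊥ u ∧ BelowRest p b u ∧ u < w

open Classical in
/-- Let `⊥` lie in `T_b` and have a unique child `v`, and let `w = β(v)`. Replace the subtree
`S = T_b` by the tree `S'` obtained as follows. Let `b = v_1, …, v_t = ⊥` be the path from `b`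
to `⊥` and `v_{j_1}, …, v_{j_s} = ⊥` its cut nodes in this order. Cutting the edge from `⊥` to
`v`, and the edge below each of `v_{j_1}, …, v_{j_{s-1}}` on the path, splits `S` into `T_v` and
pieces `R_1, …, R_s` rooted at `v_1, v_{j_1 + 1}, …, v_{j_{s-1} + 1}`. The tree `S'` is `T_v`
with every `R_i` joined as a subtree of the node `w`. Its root `v` takes the place of `b`. -/
noncomputable def regraft (p : V → V) (b v w : V) : V → V :=
  fun z =>
    if z = v then (if p b = b then v else p b)
    else if OnPath p b ⊥ z ∧ (z = b ∨ IsCutNode p b w (p z)) then w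
    else p z

/-- The child `a₁` of `⊥` with the smallest `β`. -/
noncomputable def firstChildOfBot (p : V → V) : V := argminBeta p (children p ⊥)

/-- Move all subtrees of `⊥` except `T_{a₁}` to the node `⊤`. -/
noncomputable def keepFirst (p : V → V) : V → V :=
  moveSubtrees p ((children p ⊥).erase (firstChildOfBot p)) ⊤

/-- The unique child of `⊤`, when `⊤` has degree one. -/
noncomputable def onlyChildOfTop (p : V → V) : V :=
  Classical.epsilon (fun b => b ∈ children p ⊤)

/-- Move all subtrees of `⊥` except `T_{a₁}` to the node `⊤`; in the resulting tree replace the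
subtree `S` rooted at the (formerly unique) child of `⊤` by `S'`. -/
noncomputable def mapD (p : V → V) : V → V :=
  regraft (keepFirst p) (onlyChildOfTop p) (firstChildOfBot p) (betaStar (keepFirst p))

end Tree

/-- `R^{(i)}_{n,k}`: rooted labeled trees on `n` nodes with `k` improper edges and `i` proper
edges on the path from the largest node to the root. The label `j ∈ {1, …, n}` is the element
`j - 1` of `Fin n`; so `⊥` is the node `1` and `⊤` is the node `n`. -/
def RTrees (n k i : ℕ) [NeZero n] : Set (Fin n → Fin n) :=
  {p | IsRootedTree p ∧ improperCount p = k ∧ properOnTopPath p = i}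

/-- `R^{(0)}_{n,k}[deg(1) = m, 1 ⊀ n, α < β*]` -/
def sourceA (n k m : ℕ) [NeZero n] : Set (Fin n → Fin n) :=
  {p | p ∈ RTrees n k 0 ∧ deg p ⊥ = m ∧ ¬ IsDesc p ⊥ ⊤ ∧ alpha p < betaStar p}

/-- `R^{(0)}_{n,k+m}[deg(1) = 0, deg(n) ≥ m + 1, 1 ⊀ n]` -/
def targetA (n k m : ℕ) [NeZero n] : Set (Fin n → Fin n) :=
  {p | p ∈ RTrees n (k + m) 0 ∧ deg p ⊥ = 0 ∧ m + 1 ≤ deg p ⊤ ∧ ¬ IsDesc p ⊥ ⊤}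

/-- `R^{(0)}_{n,k}[deg(1) = m, α > β*]` -/
def sourceB (n k m : ℕ) [NeZero n] : Set (Fin n → Fin n) :=
  {p | p ∈ RTrees n k 0 ∧ deg p ⊥ = m ∧ betaStar p < alpha p}

/-- `R^{(0)}_{n,k+m}[deg(1) = 0, deg(n) = m, 1 ⊀ n]` -/
def targetB (n k m : ℕ) [NeZero n] : Set (Fin n → Fin n) :=
  {p | p ∈ RTrees n (k + m) 0 ∧ deg p ⊥ = 0 ∧ deg p ⊤ = m ∧ ¬ IsDesc p ⊥ ⊤}

/-- `R^{(0)}_{n,k}[deg(1) = m, 1 ≺ n, deg(n) ≥ 2, α < β*]` -/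
def sourceC (n k m : ℕ) [NeZero n] : Set (Fin n → Fin n) :=
  {p | p ∈ RTrees n k 0 ∧ deg p ⊥ = m ∧ IsDesc p ⊥ ⊤ ∧ 2 ≤ deg p ⊤ ∧ alpha p < betaStar p}

/-- `R^{(0)}_{n,k+m}[deg(1) = 0, deg(n) ≥ m + 1, 1 ≺ n, λ > 1]` -/
def targetC (n k m : ℕ) [NeZero n] : Set (Fin n → Fin n) :=
  {p | p ∈ RTrees n (k + m) 0 ∧ deg p ⊥ = 0 ∧ m + 1 ≤ deg p ⊤ ∧ IsDesc p ⊥ ⊤ ∧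
    ⊥ < lowerCritical p}

/-- `R^{(0)}_{n,k}[deg(1) = m, 1 ≺ n, deg(n) = 1]` -/
def sourceD (n k m : ℕ) [NeZero n] : Set (Fin n → Fin n) :=
  {p | p ∈ RTrees n k 0 ∧ deg p ⊥ = m ∧ IsDesc p ⊥ ⊤ ∧ deg p ⊤ = 1}

/-- `R^{(0)}_{n,k+m}[deg(1) = 0, deg(n) = m, 1 ≺ n, λ > 1]` -/
def targetD (n k m : ℕ) [NeZero n] : Set (Fin n → Fin n) :=
  {p | p ∈ RTrees n (k + m) 0 ∧ deg p ⊥ = 0 ∧ deg p ⊤ = m ∧ IsDesc p ⊥ ⊤ ∧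
    ⊥ < lowerCritical p}

/-! ### Descent in a rooted tree. -/

section Descent

variable {V : Type*} {p : V → V} {x y z : V}

/-! Write ⊥ and ⊤ for the smallest and the largest label. An edge with father ⊥ is always proper and
an edge with father ⊤ always improper, so hanging the m subtrees of ⊥ on ⊤ creates exactly m
improper edges provided no other edge changes its type. If α < β*, some node that stays below ⊤ is
smaller than every moved node, and no β changes at all (`beta_move`). The moved subtrees can be
recognised afterwards: they belong to the m children of ⊤ with the largest β. This is (a), and under
the name `Swingable` it is also the first half of (c) and (d).

When ⊥ ≺ ⊤, a second move is needed. Let r be the child of w that has ⊥ in its subtree. `Merge w`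
moves T_r to the highest node c ≠ w of T_w - T_r that is smaller than every node of T_⊤ - T_r - T_c.
No edge changes its type. Afterwards c is critical, i.e. smaller than all of T_⊤ - T_c, and it is
the highest critical node strictly below w. Hence the move can be undone: cut the path from c to ⊥
just below c and rejoin the piece to w. Moreover λ > ⊥ says exactly that a critical node strictly
below ⊤ exists. So (c) is `mapA` followed by `Merge ⊤`.

In (d) the node r is the only child of ⊤. After `mapA`, T_r is attached to w = β*. Then w is
critical and, being the minimum of its former subtree, admits no further `Merge w`. The regrafting
cuts below all critical nodes under w, which undoes all possible merges at w at once
(`cutCritical`). Thus (d) runs from the last to the first tree of a chain of merges. To invert it,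
take w as the lowest critical node, merge at w as long as possible, move the child of w above ⊥ back
to ⊤, and undo `mapA`.

In (b) the labels ⊤ and α are exchanged, giving a tree g, then the children of ⊤ in g return to a =
α, and then the subtrees of ⊥ go to ⊤. Undo the last step: a is now the father of the topmost proper
edge on the path from ⊤. The children that had returned to a are those off this path with all nodes
above a, because every other such child of a has a smaller β by the maximality of α. So the whole
construction can be read backwards (`ExchangedTree.eq_of_mapA_eq`, `exists_exchangedTree`). The
improper edges are compared one by one through the exchange of labels
(`ExchangedTree.isImproperEdge_mapA_iff`).

The partitions are case distinctions, resting on α ≠ β* and on α = ⊥ in case (d). -/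

theorem IsDesc.refl (p : V → V) (x : V) : IsDesc p x x := ⟨0, rfl⟩

theorem IsDesc.trans (h : IsDesc p z y) (h' : IsDesc p y x) : IsDesc p z x := by
  obtain ⟨i, rfl⟩ := h
  obtain ⟨j, rfl⟩ := h'
  exact ⟨j + i, Function.iterate_add_apply p j i z⟩

theorem isDesc_father (p : V → V) (z : V) : IsDesc p z (p z) := ⟨1, rfl⟩

theorem isDesc_iff : IsDesc p z x ↔ z = x ∨ IsDesc p (p z) x := by
  constructor
  · rintro ⟨j, hj⟩
    cases j with
    | zero => exact Or.inl hj
    | succ j => exact Or.inr ⟨j, by rw [← hj, Function.iterate_succ_apply]⟩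
  · rintro (rfl | h)
    · exact IsDesc.refl p z
    · exact (isDesc_father p z).trans h

theorem IsDesc.father (h : IsDesc p z x) (hne : z ≠ x) : IsDesc p (p z) x :=
  (isDesc_iff.1 h).resolve_left hne

/-- Nodes above a common node are comparable. -/
theorem IsDesc.total (h : IsDesc p z x) (h' : IsDesc p z y) : IsDesc p x y ∨ IsDesc p y x := by
  obtain ⟨i, rfl⟩ := h
  obtain ⟨j, rfl⟩ := h'
  rcases le_total i j with hij | hij
  · refine Or.inl ⟨j - i, ?_⟩
    rw [← Function.iterate_add_apply, Nat.sub_add_cancel hij]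
  · refine Or.inr ⟨i - j, ?_⟩
    rw [← Function.iterate_add_apply, Nat.sub_add_cancel hij]

theorem IsDesc.exists_child (h : IsDesc p z x) (hne : z ≠ x) :
    ∃ c, p c = x ∧ c ≠ x ∧ IsDesc p z c := by
  obtain ⟨j, hj⟩ := h
  induction j generalizing z with
  | zero => exact absurd hj hne
  | succ j ih =>
    rw [Function.iterate_succ_apply] at hj
    by_cases hz : p z = x
    · exact ⟨z, hz, hne, IsDesc.refl p z⟩
    · obtain ⟨c, hc, hcx, hd⟩ := ih hz hj
      exact ⟨c, hc, hcx, (isDesc_father p z).trans hd⟩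

theorem IsDesc.eq_of_fixed (h : IsDesc p x y) (hx : p x = x) : x = y := by
  obtain ⟨j, hj⟩ := h
  rwa [Function.iterate_fixed hx] at hj

/-- Two distinct nodes below each other would lie on a cycle; going round it often enough reaches
the root, so x is the root, whose only ancestor is itself. -/
theorem IsDesc.antisymm (hp : IsRootedTree p) (h : IsDesc p x y) (h' : IsDesc p y x) :
    x = y := by
  obtain ⟨r, hr, hd⟩ := hp
  by_contra hne
  obtain ⟨i, hi⟩ := h
  have hi0 : i ≠ 0 := by rintro rfl; exact hne hi
  obtain ⟨j, hj⟩ := h'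
  have hper : p^[j + i] x = x := by rw [Function.iterate_add_apply, hi, hj]
  obtain ⟨k, hk⟩ := hd x
  have hper' : ∀ l, p^[(j + i) * l] x = x := fun l => by
    rw [Function.iterate_mul]
    exact Function.iterate_fixed hper l
  have hle : k ≤ (j + i) * k := Nat.le_mul_of_pos_left _ (by omega)
  have hxr : x = r := by
    rw [← hper' k, ← Nat.sub_add_cancel hle, Function.iterate_add_apply, hk,
      Function.iterate_fixed hr]
  exact hne (IsDesc.eq_of_fixed ⟨i, hi⟩ (by rw [hxr, hr]))

theorem not_isDesc_father (hp : IsRootedTree p) (hx : p x ≠ x) : ¬ IsDesc p (p x) x :=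
  fun h => hx (h.antisymm hp (isDesc_father p x))

/-- Induction down a rooted tree. -/
theorem IsRootedTree.induction (hp : IsRootedTree p) {P : V → Prop}
    (root : ∀ r, p r = r → P r) (step : ∀ z, p z ≠ z → P (p z) → P z) (z : V) : P z := by
  obtain ⟨r, hr, hd⟩ := hp
  obtain ⟨j, hj⟩ := hd z
  induction j generalizing z with
  | zero => rw [show z = r from hj]; exact root r hr
  | succ j ih =>
    by_cases hz : p z = z
    · exact root z hz
    · exact step z hz (ih (p z) hj)

theorem IsRootedTree.isDesc_of_fixed (hp : IsRootedTree p) (hx : p x = x) (z : V) :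
    IsDesc p z x := by
  obtain ⟨r, hr, hd⟩ := hp
  rw [IsDesc.eq_of_fixed (hd x) hx]
  exact hd z

theorem IsDesc.ne_fixed (h : IsDesc p z x) (hne : z ≠ x) : p z ≠ z :=
  fun hz => hne (h.eq_of_fixed hz)

/-- Distinct siblings have disjoint subtrees. -/
theorem sibling_eq (hp : IsRootedTree p) (hx : IsDesc p z x) (hy : IsDesc p z y)
    (hxy : p x = p y) (hx' : p x ≠ x) (hy' : p y ≠ y) : x = y := by
  rcases hx.total hy with h | h
  · by_contra hne
    exact not_isDesc_father hp hy' (hxy ▸ h.father hne)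
  · by_contra hne
    exact not_isDesc_father hp hx' (hxy ▸ h.father (Ne.symm hne))

end Descent

/-! ### Descent after moving subtrees. -/

section Move

variable {V : Type*} {p : V → V} {S : Finset V} {a x y z : V}

theorem moveSubtrees_of_mem (hz : z ∈ S) : moveSubtrees p S y z = y := by
  simp [moveSubtrees, hz]

theorem moveSubtrees_of_notMem (hz : z ∉ S) : moveSubtrees p S y z = p z := by
  simp [moveSubtrees, hz]

theorem moveSubtrees_moveSubtrees (hS : ∀ s ∈ S, p s = a) :
    moveSubtrees (moveSubtrees p S y) S a = p := by
  funext z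
  by_cases hz : z ∈ S
  · rw [moveSubtrees_of_mem hz, hS z hz]
  · rw [moveSubtrees_of_notMem hz, moveSubtrees_of_notMem hz]

/-- `z` lies in one of the subtrees rooted at the nodes of `S`. -/
def Below (p : V → V) (S : Finset V) (z : V) : Prop := ∃ s ∈ S, IsDesc p z s

theorem Below.mono (h : Below p S x) (hz : IsDesc p z x) : Below p S z := by
  obtain ⟨s, hs, h⟩ := h
  exact ⟨s, hs, hz.trans h⟩

theorem below_of_mem (h : x ∈ S) : Below p S x := ⟨x, h, IsDesc.refl p x⟩

theorem isDesc_move_of_not_below (hp : IsRootedTree p) (hz : ¬ Below p S z) :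
    IsDesc (moveSubtrees p S y) z x ↔ IsDesc p z x := by
  induction z using hp.induction with
  | root r hr =>
    have : moveSubtrees p S y r = r := by
      rw [moveSubtrees_of_notMem (fun h => hz (below_of_mem h)), hr]
    exact ⟨fun h => (h.eq_of_fixed this) ▸ IsDesc.refl _ _,
      fun h => (h.eq_of_fixed hr) ▸ IsDesc.refl _ _⟩
  | step z _ ih =>
    have hpz : ¬ Below p S (p z) := fun h => hz (h.mono (isDesc_father p z))
    rw [isDesc_iff, moveSubtrees_of_notMem (fun h => hz (below_of_mem h)), ih hpz, ← isDesc_iff]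

/-- An upward path either never uses a cut edge, so that a moved root on it can only be its upper
end, or it leaves a moved subtree and continues from y. As y is outside the moved subtrees, this
jump happens at most once. -/
theorem isDesc_move (hp : IsRootedTree p) (hy : ¬ Below p S y) :
    IsDesc (moveSubtrees p S y) z x ↔
      (IsDesc p z x ∧ ∀ s ∈ S, IsDesc p z s → IsDesc p s x → s = x) ∨
        (Below p S z ∧ IsDesc p y x) := by
  induction z using hp.induction with
  | root r hr =>
    have hb : ¬ Below p S r := fun h => hy (h.mono (hp.isDesc_of_fixed hr y))
    rw [isDesc_move_of_not_below hp hb]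
    constructor
    · exact fun h => Or.inl ⟨h, fun s hs h1 => absurd ⟨s, hs, h1⟩ hb⟩
    · rintro (h | h)
      · exact h.1
      · exact absurd h.1 hb
  | step z hz ih =>
    rw [isDesc_iff]
    by_cases hS : z ∈ S
    · rw [moveSubtrees_of_mem hS, isDesc_move_of_not_below hp hy]
      constructor
      · rintro (rfl | h)
        · exact Or.inl ⟨IsDesc.refl p z, fun s _ h1 h2 => h2.antisymm hp h1⟩
        · exact Or.inr ⟨below_of_mem hS, h⟩
      · rintro (h | h)
        · exact Or.inl (h.2 z hS (IsDesc.refl p z) h.1)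
        · exact Or.inr h.2
    · rw [moveSubtrees_of_notMem hS, ih]
      have key : ∀ s ∈ S, IsDesc p z s ↔ IsDesc p (p z) s := fun s hs => by
        rw [isDesc_iff]
        exact or_iff_right (fun h => hS (h ▸ hs))
      have hB : Below p S (p z) ↔ Below p S z :=
        exists_congr fun s => and_congr_right fun hs => (key s hs).symm
      rw [hB]
      constructor
      · rintro (rfl | h | h)
        · exact Or.inl ⟨IsDesc.refl p z, fun s _ h1 h2 => h2.antisymm hp h1⟩
        · exact Or.inl ⟨(isDesc_father p z).trans h.1,
            fun s hs h1 => h.2 s hs ((key s hs).1 h1)⟩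
        · exact Or.inr h
      · rintro (h | h)
        · by_cases hzx : z = x
          · exact Or.inl hzx
          · exact Or.inr (Or.inl ⟨h.1.father hzx, fun s hs h1 => h.2 s hs ((key s hs).2 h1)⟩)
        · exact Or.inr (Or.inr h)

theorem IsRootedTree.move (hp : IsRootedTree p) (hy : ¬ Below p S y) :
    IsRootedTree (moveSubtrees p S y) := by
  obtain ⟨r, hr, hd⟩ := id hp
  have hb : ¬ Below p S r := fun h => hy (h.mono (hd y))
  refine ⟨r, by rw [moveSubtrees_of_notMem (fun h => hb (below_of_mem h)), hr], fun x => ?_⟩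
  refine (isDesc_move hp hy).2 ?_
  by_cases hx : Below p S x
  · exact Or.inr ⟨hx, hd y⟩
  · exact Or.inl ⟨hd x, fun s hs h1 => absurd ⟨s, hs, h1⟩ hx⟩

/-- Descent after moving subtrees whose roots are siblings, inside a moved subtree. -/
theorem isDesc_move_of_below (hp : IsRootedTree p) (hS : ∀ s ∈ S, p s = a ∧ s ≠ a)
    (hy : ¬ Below p S y) (hx : Below p S x) :
    IsDesc (moveSubtrees p S y) z x ↔ IsDesc p z x := by
  rw [isDesc_move hp hy]
  constructor
  · rintro (h | h)
    · exact h.1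
    · exact absurd (hx.mono h.2) hy
  · refine fun h => Or.inl ⟨h, fun s hs _ h2 => ?_⟩
    obtain ⟨s', hs', h3⟩ := hx
    have hne : ∀ s ∈ S, p s ≠ s := fun s hs => by
      rw [(hS s hs).1]; exact (hS s hs).2.symm
    have : s = s' := sibling_eq hp (IsDesc.refl p s) (h2.trans h3)
      (by rw [(hS s hs).1, (hS s' hs').1]) (hne s hs) (hne s' hs')
    exact h2.antisymm hp (by rw [this]; exact h3)

/-- Descent after moving the subtree rooted at `r`. -/
theorem isDesc_move_singleton {r : V} (hp : IsRootedTree p) (hy : ¬ IsDesc p y r) :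
    IsDesc (moveSubtrees p {r} y) z x ↔
      (IsDesc p z x ∧ (IsDesc p z r → IsDesc p r x → r = x)) ∨
        (IsDesc p z r ∧ IsDesc p y x) := by
  rw [isDesc_move hp (by simpa [Below] using hy)]
  simp [Below]

theorem IsRootedTree.move_singleton {r : V} (hp : IsRootedTree p) (hy : ¬ IsDesc p y r) :
    IsRootedTree (moveSubtrees p {r} y) :=
  hp.move (by simpa [Below] using hy)

end Move

/-! ### Subtree minima, children, and trees without proper edge above ⊤. -/

section Labels

variable {V : Type*} [Fintype V] {p q : V → V} {x y z : V}

theorem mem_subtree : z ∈ subtree p x ↔ IsDesc p z x := by simp [subtree]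

/-- Among pairwise comparable nodes one is an ancestor of all the others. -/
theorem exists_highest {P : V → Prop} (hc : ∀ u u', P u → P u' → IsDesc p u u' ∨ IsDesc p u' u)
    (h : ∃ u, P u) : ∃ u, P u ∧ ∀ u', P u' → IsDesc p u' u := by
  classical
  obtain ⟨u0, hu0⟩ := h
  obtain ⟨u, hu, hmax⟩ := Finset.exists_max_image (Finset.univ.filter P)
    (fun u => (subtree p u).card) ⟨u0, by simpa using hu0⟩
  simp only [Finset.mem_filter, Finset.mem_univ, true_and] at hu hmax
  refine ⟨u, hu, fun u' hu' => ?_⟩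
  rcases hc u u' hu hu' with h | h
  · have hsub : subtree p u ⊆ subtree p u' := fun z hz =>
      mem_subtree.2 ((mem_subtree.1 hz).trans h)
    have := Finset.eq_of_subset_of_card_le hsub (hmax u' hu')
    exact mem_subtree.1 (this ▸ mem_subtree.2 (IsDesc.refl p u'))
  · exact h

variable [LinearOrder V]

theorem beta_le (h : IsDesc p z x) : beta p x ≤ z := Finset.min'_le _ _ (mem_subtree.2 h)

theorem isDesc_beta (p : V → V) (x : V) : IsDesc p (beta p x) x :=
  mem_subtree.1 (Finset.min'_mem _ _)

theorem le_beta : y ≤ beta p x ↔ ∀ z, IsDesc p z x → y ≤ z :=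
  ⟨fun h _ hz => h.trans (beta_le hz), fun h => h _ (isDesc_beta p x)⟩

theorem lt_beta : y < beta p x ↔ ∀ z, IsDesc p z x → y < z :=
  ⟨fun h _ hz => h.trans_le (beta_le hz), fun h => h _ (isDesc_beta p x)⟩

theorem beta_congr (h : ∀ z, IsDesc p z x ↔ IsDesc q z x) : beta p x = beta q x :=
  le_antisymm (beta_le ((h _).2 (isDesc_beta q x))) (beta_le ((h _).1 (isDesc_beta p x)))

theorem isImproperEdge_iff :
    IsImproperEdge p y ↔ p y ≠ y ∧ ∃ z, IsDesc p z y ∧ z ≤ p y := by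
  rw [IsImproperEdge, lt_beta]
  push Not
  rfl

theorem mem_children : y ∈ children p x ↔ p y = x ∧ y ≠ x := by simp [children]

theorem father_ne_of_mem_children (h : y ∈ children p x) : p y ≠ y := by
  rw [mem_children] at h
  rw [h.1]
  exact h.2.symm

theorem isDesc_of_mem_children (h : y ∈ children p x) : IsDesc p y x :=
  (mem_children.1 h).1 ▸ isDesc_father p y

theorem not_isDesc_of_mem_children (hp : IsRootedTree p) (h : y ∈ children p x) :
    ¬ IsDesc p x y := fun h' =>
  (mem_children.1 h).2 ((isDesc_of_mem_children h).antisymm hp h')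

theorem children_eq_of_isDesc (hp : IsRootedTree p) {a b : V} (ha : a ∈ children p x)
    (hb : b ∈ children p x) (hza : IsDesc p z a) (hzb : IsDesc p z b) : a = b :=
  sibling_eq hp hza hzb (by rw [(mem_children.1 ha).1, (mem_children.1 hb).1])
    (father_ne_of_mem_children ha) (father_ne_of_mem_children hb)

/-- Siblings have disjoint subtrees. This makes "the m children with the largest β" well defined. -/
theorem beta_injOn_children (hp : IsRootedTree p) (x : V) :
    Set.InjOn (beta p) (children p x) := fun a ha b hb h =>
  children_eq_of_isDesc hp ha hb (isDesc_beta p a) (h ▸ isDesc_beta p b)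

theorem IsDesc.exists_mem_children (h : IsDesc p z x) (hne : z ≠ x) :
    ∃ c ∈ children p x, IsDesc p z c := by
  obtain ⟨c, h1, h2, h3⟩ := h.exists_child hne
  exact ⟨c, mem_children.2 ⟨h1, h2⟩, h3⟩

theorem IsDesc.of_mem_children_of_ne {c : V} (hc : c ∈ children p x)
    (h : IsDesc p z c) (hy : IsDesc p z y) : IsDesc p y c ∨ IsDesc p x y := by
  rcases hy.total h with h' | h'
  · exact Or.inl h'
  · by_cases he : c = y
    · exact Or.inl (he ▸ IsDesc.refl p _)
    · exact Or.inr ((mem_children.1 hc).1 ▸ h'.father he)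

variable [BoundedOrder V]

/-- A rooted tree without proper edge on the path from the largest node to the root. -/
def Good (p : V → V) : Prop :=
  IsRootedTree p ∧ ∀ y, IsDesc p ⊤ y → p y ≠ y → IsImproperEdge p y

theorem properOnTopPath_eq_zero :
    properOnTopPath p = 0 ↔ ∀ y, IsDesc p ⊤ y → p y ≠ y → IsImproperEdge p y := by
  classical
  rw [properOnTopPath, Finset.card_eq_zero, Finset.filter_eq_empty_iff]
  exact ⟨fun h y hy hne => ⟨hne, fun hlt => h (Finset.mem_univ y) ⟨hy, hne, hlt⟩⟩,
    fun h y _ hy => (h y hy.1 hy.2.1).2 hy.2.2⟩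

/-- An edge with father ⊥ is proper, so the path from ⊤ to the root cannot use one. -/
theorem Good.not_isDesc_top_bot (hp : Good p) (hne : (⊥ : V) ≠ ⊤) : ¬ IsDesc p ⊤ ⊥ := by
  intro h
  obtain ⟨c, hc, hd⟩ := h.exists_mem_children hne.symm
  have h2 := isImproperEdge_iff.1 (hp.2 c hd (father_ne_of_mem_children hc))
  obtain ⟨-, z, hz, hle⟩ := h2
  rw [(mem_children.1 hc).1, le_bot_iff] at hle
  exact not_isDesc_of_mem_children hp.1 hc (hle ▸ hz)

/-- If ⊤ were a leaf, it would be the only node or its own edge would be proper. So α and λ are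
meaningful for all trees considered. -/
theorem Good.children_top_nonempty (hp : Good p) (hne : (⊥ : V) ≠ ⊤) :
    (children p ⊤).Nonempty := by
  by_contra h
  rw [Finset.not_nonempty_iff_eq_empty] at h
  have hleaf : ∀ z, IsDesc p z ⊤ → z = ⊤ := fun z hz => by
    by_contra hz'
    obtain ⟨c, hc, -⟩ := hz.exists_mem_children hz'
    simp [h] at hc
  by_cases hr : p ⊤ = ⊤
  · exact hne (hleaf ⊥ (hp.1.isDesc_of_fixed hr ⊥))
  · obtain ⟨-, z, hz, hle⟩ := isImproperEdge_iff.1 (hp.2 ⊤ (IsDesc.refl p _) hr)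
    rw [hleaf z hz, top_le_iff] at hle
    exact hr hle

theorem isImproperEdge_of_father_top (h : p y = ⊤) (hne : y ≠ ⊤) : IsImproperEdge p y :=
  isImproperEdge_iff.2 ⟨by rw [h]; exact hne.symm, y, IsDesc.refl p y, h ▸ le_top⟩

theorem not_isImproperEdge_of_father_bot (hp : IsRootedTree p) (h : y ∈ children p ⊥) :
    ¬ IsImproperEdge p y := by
  rw [isImproperEdge_iff, (mem_children.1 h).1]
  rintro ⟨-, z, hz, hle⟩
  rw [le_bot_iff] at hle
  exact not_isDesc_of_mem_children hp h (hle ▸ hz)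

theorem isImproperEdge_of_bot (h : IsDesc p ⊥ y) (hne : p y ≠ y) : IsImproperEdge p y :=
  isImproperEdge_iff.2 ⟨hne, ⊥, h, bot_le⟩

theorem exists_beta_eq_alpha (h : (children p ⊤).Nonempty) :
    ∃ b ∈ children p ⊤, beta p b = alpha p := by
  obtain ⟨b, hb, h⟩ := Finset.exists_mem_eq_sup _ h (beta p)
  exact ⟨b, hb, h.symm⟩

theorem exists_beta_eq_betaStar (h : (children p ⊥).Nonempty) :
    ∃ b ∈ children p ⊥, beta p b = betaStar p := by
  obtain ⟨b, hb, h⟩ := Finset.exists_mem_eq_inf _ h (beta p)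
  exact ⟨b, hb, h.symm⟩

theorem beta_le_alpha {b : V} (h : b ∈ children p ⊤) : beta p b ≤ alpha p := Finset.le_sup h

theorem betaStar_le_beta {a : V} (h : a ∈ children p ⊥) : betaStar p ≤ beta p a := Finset.inf_le h

theorem alpha_lt_betaStar (h1 : (children p ⊤).Nonempty) (h2 : (children p ⊥).Nonempty) :
    alpha p < betaStar p ↔ ∀ b ∈ children p ⊤, ∀ a ∈ children p ⊥, beta p b < beta p a := by
  constructor
  · exact fun h b hb a ha => ((beta_le_alpha hb).trans_lt h).trans_le (betaStar_le_beta ha)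
  · intro h
    obtain ⟨b, hb, hb'⟩ := exists_beta_eq_alpha h1
    obtain ⟨a, ha, ha'⟩ := exists_beta_eq_betaStar h2
    rw [← hb', ← ha']
    exact h b hb a ha

end Labels

/-! ### Moving the subtrees of ⊥ to ⊤. -/

section Swing

variable {V : Type*} [Fintype V] [LinearOrder V] {p q : V → V} {S : Finset V} {a x y z : V}

theorem Below.le_of_beta_lt {s : V} (hs : IsDesc p z s) (h : x < beta p s) : x < z :=
  h.trans_le (beta_le hs)

/-- If both ends have, outside the moved subtrees, a descendant smaller than every moved node,
then moving the subtrees changes no `β`. -/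
theorem beta_move (hp : IsRootedTree p) (hS : S ⊆ children p a) (hy : ¬ Below p S y)
    (h1 : ∀ s ∈ S, ∃ z, IsDesc p z a ∧ ¬ Below p S z ∧ z < beta p s)
    (h2 : ∀ s ∈ S, ∃ z, IsDesc p z y ∧ ¬ Below p S z ∧ z < beta p s) (x : V) :
    beta (moveSubtrees p S y) x = beta p x := by
  by_cases hx : Below p S x
  · exact beta_congr fun z =>
      isDesc_move_of_below hp (fun s hs => mem_children.1 (hS hs)) hy hx
  · apply le_antisymm
    · refine beta_le ((isDesc_move hp hy).2 (Or.inl ⟨isDesc_beta p x, fun s hs hzs hsx => ?_⟩))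
      -- A minimum of T_x lost through the move would sit in a moved subtree; but then a lies below
      -- x, with a smaller descendant that stays.
      by_contra hne
      obtain ⟨z, hza, -, hlt⟩ := h1 s hs
      have hax : IsDesc p a x := (mem_children.1 (hS hs)).1 ▸ hsx.father hne
      exact absurd (beta_le (hza.trans hax)) (not_le.2 (Below.le_of_beta_lt hzs hlt))
    · rcases (isDesc_move hp hy).1 (isDesc_beta (moveSubtrees p S y) x) with h | ⟨hb, hyx⟩
      · exact beta_le h.1
      · obtain ⟨s, hs, hzs⟩ := hb
        obtain ⟨z, hzy, -, hlt⟩ := h2 s hs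
        exact (beta_le (hzy.trans hyx)).trans (Below.le_of_beta_lt hzs hlt).le

theorem isImproperEdge_congr (hf : p z = q z) (hb : beta p z = beta q z) :
    IsImproperEdge p z ↔ IsImproperEdge q z := by
  rw [IsImproperEdge, IsImproperEdge, hf, hb]

/-- The permutation matches the edges of the two trees: it is the identity for (a) and the exchange
of two labels for (b). -/
theorem improperCount_eq_add (e : Equiv.Perm V)
    (h : ∀ z, IsImproperEdge q z ↔ z ∈ S ∨ IsImproperEdge p (e z))
    (hS : ∀ z ∈ S, ¬ IsImproperEdge p (e z)) :
    improperCount q = improperCount p + S.card := by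
  classical
  have h1 : improperCount q = (Finset.univ.filter fun z => IsImproperEdge p (e z)).card + S.card := by
    rw [← Finset.card_union_of_disjoint, improperCount]
    · congr 1
      ext z
      simp [h z, or_comm]
    · rw [Finset.disjoint_left]
      exact fun z hz hzS => hS z hzS (Finset.mem_filter.1 hz).2
  rw [h1, improperCount]
  congr 1
  refine Finset.card_bij (fun z _ => e z) (fun z hz => ?_) (fun z _ z' _ h => e.injective h)
    (fun z hz => ⟨e.symm z, ?_, e.apply_symm_apply z⟩)
  · simpa using hz
  · simpa using hz

/-- The `m` elements of a finite set with the largest values. -/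
theorem exists_top_subset {C : Finset V} {f : V → V} (hf : Set.InjOn f C) {m : ℕ}
    (hm : m ≤ C.card) :
    ∃ U ⊆ C, U.card = m ∧ ∀ b ∈ C, b ∉ U → ∀ u ∈ U, f b < f u := by
  classical
  induction m with
  | zero => exact ⟨∅, by simp⟩
  | succ m ih =>
    obtain ⟨U, hUC, hU, hlt⟩ := ih (by omega)
    have hne : (C \ U).Nonempty := by
      rw [← Finset.card_pos, Finset.card_sdiff_of_subset hUC]
      omega
    obtain ⟨c, hc, hmax⟩ := Finset.exists_max_image _ f hne
    rw [Finset.mem_sdiff] at hc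
    refine ⟨insert c U, Finset.insert_subset hc.1 hUC, by
      rw [Finset.card_insert_of_notMem hc.2, hU], fun b hb hbU u hu => ?_⟩
    rw [Finset.mem_insert, not_or] at hbU
    rcases Finset.mem_insert.1 hu with rfl | hu
    · exact lt_of_le_of_ne (hmax b (Finset.mem_sdiff.2 ⟨hb, hbU.2⟩))
        fun h => hbU.1 (hf hb hc.1 h)
    · exact hlt b hb hbU.2 u hu

/-- Of two different sets of equal size neither contains the other, and an element of each
difference would have to beat the other. This is how the moved children are recovered. -/
theorem top_subset_unique {C U U' : Finset V} {f : V → V} (hU : U ⊆ C) (hU' : U' ⊆ C)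
    (hc : U.card = U'.card) (h : ∀ b ∈ C, b ∉ U → ∀ u ∈ U, f b < f u)
    (h' : ∀ b ∈ C, b ∉ U' → ∀ u ∈ U', f b < f u) : U = U' := by
  classical
  by_contra hne
  have h1 : ¬ U ⊆ U' := fun hs => hne (Finset.eq_of_subset_of_card_le hs hc.ge)
  have h2 : ¬ U' ⊆ U := fun hs => hne (Finset.eq_of_subset_of_card_le hs hc.le).symm
  obtain ⟨x, hx, hx'⟩ := Finset.not_subset.1 h1
  obtain ⟨y, hy, hy'⟩ := Finset.not_subset.1 h2
  exact lt_asymm (h' x (hU hx) hx' y hy) (h y (hU' hy) hy' x hx)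

variable [BoundedOrder V]

theorem not_below_children_bot_top (hp : Good p) (hne : (⊥ : V) ≠ ⊤) :
    ¬ Below p (children p ⊥) ⊤ := by
  rintro ⟨s, hs, h⟩
  exact hp.not_isDesc_top_bot hne (h.trans (isDesc_of_mem_children hs))

theorem not_below_children_self (hp : IsRootedTree p) : ¬ Below p (children p x) x := by
  rintro ⟨s, hs, h⟩
  exact not_isDesc_of_mem_children hp hs h

theorem ne_of_children_bot_nonempty (h : (children p ⊥).Nonempty) : (⊥ : V) ≠ ⊤ := by
  obtain ⟨a, ha⟩ := h
  intro he
  exact (mem_children.1 ha).2 (le_bot_iff.1 (he ▸ le_top))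

/-- The trees whose children of `⊥` may be moved to `⊤` without changing any `β`. -/
structure Swingable (p : V → V) : Prop where
  good : Good p
  nonempty : (children p ⊥).Nonempty
  lt : alpha p < betaStar p

namespace Swingable

variable (hp : Swingable p)
include hp

theorem bot_ne_top : (⊥ : V) ≠ ⊤ := ne_of_children_bot_nonempty hp.nonempty

theorem children_top : (children p ⊤).Nonempty := hp.good.children_top_nonempty hp.bot_ne_top

theorem beta_lt {b a : V} (hb : b ∈ children p ⊤) (ha : a ∈ children p ⊥) :
    beta p b < beta p a :=
  (alpha_lt_betaStar hp.children_top hp.nonempty).1 hp.lt b hb a ha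

theorem not_below_top : ¬ Below p (children p ⊥) ⊤ :=
  not_below_children_bot_top hp.good hp.bot_ne_top

/-- The witness that keeps β unchanged along the path above ⊤: the node ⊥ if it lies below ⊤, and
otherwise β(b) for any child b of ⊤, by α < β*. -/
theorem exists_lt : ∃ z, IsDesc p z ⊤ ∧ ¬ Below p (children p ⊥) z ∧
    ∀ s ∈ children p ⊥, z < beta p s := by
  by_cases hbt : IsDesc p ⊥ ⊤
  · refine ⟨⊥, hbt, not_below_children_self hp.good.1, fun s hs => ?_⟩
    rw [lt_beta]
    intro z hz
    refine bot_lt_iff_ne_bot.2 ?_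
    rintro rfl
    exact not_isDesc_of_mem_children hp.good.1 hs hz
  · obtain ⟨b, hb⟩ := hp.children_top
    refine ⟨beta p b, (isDesc_beta p b).trans (isDesc_of_mem_children hb), ?_,
      fun s hs => hp.beta_lt hb hs⟩
    rintro ⟨s, hs, hd⟩
    exact absurd (beta_le hd) (not_le.2 (hp.beta_lt hb hs))

theorem beta_mapA (x : V) : beta (mapA p) x = beta p x := by
  obtain ⟨z, hz, hzb, hlt⟩ := hp.exists_lt
  refine beta_move hp.good.1 (Finset.Subset.refl _) hp.not_below_top (fun s hs => ?_)
    (fun s hs => ⟨z, hz, hzb, hlt s hs⟩) x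
  refine ⟨⊥, IsDesc.refl p _, not_below_children_self hp.good.1, ?_⟩
  rw [lt_beta]
  intro z hz
  refine bot_lt_iff_ne_bot.2 ?_
  rintro rfl
  exact not_isDesc_of_mem_children hp.good.1 hs hz

theorem isDesc_mapA_of_not_below (hz : ¬ Below p (children p ⊥) z) :
    IsDesc (mapA p) z x ↔ IsDesc p z x := isDesc_move_of_not_below hp.good.1 hz

theorem isDesc_bot_mapA : IsDesc (mapA p) ⊥ x ↔ IsDesc p ⊥ x :=
  hp.isDesc_mapA_of_not_below (not_below_children_self hp.good.1)

theorem isDesc_top_mapA : IsDesc (mapA p) ⊤ x ↔ IsDesc p ⊤ x :=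
  hp.isDesc_mapA_of_not_below hp.not_below_top

theorem ne_top_of_mem {s : V} (hs : s ∈ children p ⊥) : s ≠ ⊤ := by
  rintro rfl
  exact hp.not_below_top (below_of_mem hs)

theorem isImproperEdge_mapA :
    IsImproperEdge (mapA p) z ↔ z ∈ children p ⊥ ∨ IsImproperEdge p z := by
  by_cases hz : z ∈ children p ⊥
  · simp only [hz, true_or, iff_true]
    exact isImproperEdge_of_father_top (moveSubtrees_of_mem hz) (hp.ne_top_of_mem hz)
  · simp only [hz, false_or]
    exact isImproperEdge_congr (moveSubtrees_of_notMem hz) (hp.beta_mapA z)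

theorem improperCount_mapA : improperCount (mapA p) = improperCount p + deg p ⊥ :=
  improperCount_eq_add (Equiv.refl V) (fun _ => hp.isImproperEdge_mapA)
    (fun _ hz => not_isImproperEdge_of_father_bot hp.good.1 hz)

theorem good_mapA : Good (mapA p) := by
  refine ⟨hp.good.1.move hp.not_below_top, fun y hy hne => ?_⟩
  rw [hp.isImproperEdge_mapA]
  by_cases hyS : y ∈ children p ⊥
  · exact Or.inl hyS
  · rw [mapA, moveSubtrees_of_notMem hyS] at hne
    exact Or.inr (hp.good.2 y (hp.isDesc_top_mapA.1 hy) hne)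

theorem mem_children_top_mapA :
    y ∈ children (mapA p) ⊤ ↔ y ∈ children p ⊤ ∨ y ∈ children p ⊥ := by
  by_cases hy : y ∈ children p ⊥
  · simp only [hy, or_true, iff_true]
    exact mem_children.2 ⟨moveSubtrees_of_mem hy, hp.ne_top_of_mem hy⟩
  · simp only [hy, or_false]
    rw [mem_children, mem_children, mapA, moveSubtrees_of_notMem hy]

theorem disjoint_children : Disjoint (children p ⊤) (children p ⊥) := by
  rw [Finset.disjoint_left]
  intro y hy hy'
  exact hp.bot_ne_top ((mem_children.1 hy').1.symm.trans (mem_children.1 hy).1)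

theorem deg_top_mapA : deg (mapA p) ⊤ = deg p ⊤ + deg p ⊥ := by
  classical
  rw [deg, deg, deg, ← Finset.card_union_of_disjoint hp.disjoint_children]
  congr 1
  ext y
  rw [hp.mem_children_top_mapA, Finset.mem_union]

theorem deg_bot_mapA : deg (mapA p) ⊥ = 0 := by
  rw [deg, Finset.card_eq_zero, Finset.eq_empty_iff_forall_notMem]
  intro y hy
  by_cases hyS : y ∈ children p ⊥
  · rw [mem_children, mapA, moveSubtrees_of_mem hyS] at hy
    exact hp.bot_ne_top hy.1.symm
  · rw [mem_children, mapA, moveSubtrees_of_notMem hyS] at hy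
    exact hyS (mem_children.2 hy)

theorem children_subset : children p ⊥ ⊆ children (mapA p) ⊤ := fun _ hy =>
  hp.mem_children_top_mapA.2 (Or.inr hy)

theorem children_bot_upper : ∀ b ∈ children (mapA p) ⊤, b ∉ children p ⊥ →
    ∀ u ∈ children p ⊥, beta (mapA p) b < beta (mapA p) u := by
  intro b hb hbS u hu
  rw [hp.beta_mapA, hp.beta_mapA]
  exact hp.beta_lt ((hp.mem_children_top_mapA.1 hb).resolve_right hbS) hu

theorem move_back : moveSubtrees (mapA p) (children p ⊥) ⊥ = p :=
  moveSubtrees_moveSubtrees fun _ hs => (mem_children.1 hs).1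

end Swingable

theorem Swingable.mapA_injective (hp : Swingable p) (hq : Swingable q)
    (hd : deg p ⊥ = deg q ⊥) (h : mapA p = mapA q) : p = q := by
  have : children p ⊥ = children q ⊥ :=
    top_subset_unique hp.children_subset (h ▸ hq.children_subset) hd hp.children_bot_upper
      (h ▸ hq.children_bot_upper)
  rw [← hp.move_back, ← hq.move_back, h, this]

/-- Take the m children of ⊤ with the largest β back to ⊥. Since ⊤ has more than m children, one of
them, b, stays; β(b) is smaller than all moved nodes and keeps every β unchanged. -/
theorem exists_swingable (hq : Good q) (hne : (⊥ : V) ≠ ⊤) (h0 : deg q ⊥ = 0) {m : ℕ}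
    (hm : 1 ≤ m) (hd : m + 1 ≤ deg q ⊤) :
    ∃ p, Swingable p ∧ deg p ⊥ = m ∧ mapA p = q := by
  classical
  obtain ⟨U, hU, hUm, hlt⟩ := exists_top_subset (beta_injOn_children hq.1 ⊤)
    (m := m) (C := children q ⊤) (by rw [deg] at hd; omega)
  obtain ⟨b, hb, hbU⟩ : ∃ b ∈ children q ⊤, b ∉ U := by
    by_contra! hcon
    have := Finset.card_le_card (show children q ⊤ ⊆ U from hcon)
    rw [deg] at hd
    omega
  have hbz : ¬ Below q U (beta q b) := by
    rintro ⟨s, hs, hd⟩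
    have := hlt b hb hbU s hs
    exact absurd (beta_le hd) (not_le.2 this)
  have hbot : ¬ Below q U ⊥ := by
    rintro ⟨s, hs, hd⟩
    have := hlt b hb hbU s hs
    rw [le_bot_iff.1 (beta_le hd)] at this
    exact not_lt_bot this
  have htop : ¬ Below q U ⊤ := by
    rintro ⟨s, hs, hd⟩
    exact not_isDesc_of_mem_children hq.1 (hU hs) hd
  set p := moveSubtrees q U ⊥ with hpdef
  have hβ : ∀ x, beta p x = beta q x := by
    refine beta_move hq.1 hU hbot (fun s hs => ?_) (fun s hs => ?_)
    · exact ⟨beta q b, (isDesc_beta q b).trans (isDesc_of_mem_children hb), hbz, hlt b hb hbU s hs⟩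
    · exact ⟨⊥, IsDesc.refl q _, hbot, bot_le.trans_lt (hlt b hb hbU s hs)⟩
  have hchb : children p ⊥ = U := by
    ext y
    by_cases hy : y ∈ U
    · simp only [hy, iff_true]
      refine mem_children.2 ⟨moveSubtrees_of_mem hy, ?_⟩
      rintro rfl
      exact hbot (below_of_mem hy)
    · simp only [hy, iff_false]
      intro h
      rw [mem_children, hpdef, moveSubtrees_of_notMem hy] at h
      rw [deg, Finset.card_eq_zero] at h0
      have : y ∈ children q ⊥ := mem_children.2 h
      simp [h0] at this
  have hcht : ∀ y ∈ children p ⊤, y ∈ children q ⊤ ∧ y ∉ U := by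
    intro y hy
    by_cases hyU : y ∈ U
    · rw [mem_children, hpdef, moveSubtrees_of_mem hyU] at hy
      exact absurd hy.1 hne
    · rw [mem_children, hpdef, moveSubtrees_of_notMem hyU] at hy
      exact ⟨mem_children.2 hy, hyU⟩
  have hgood : Good p := by
    refine ⟨hq.1.move hbot, fun y hy hyne => ?_⟩
    have hy' : IsDesc q ⊤ y := (isDesc_move_of_not_below hq.1 htop).1 hy
    have hyU : y ∉ U := fun h => not_isDesc_of_mem_children hq.1 (hU h) hy'
    rw [isImproperEdge_congr (q := q) (moveSubtrees_of_notMem hyU) (hβ y)]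
    exact hq.2 y hy' (by rwa [hpdef, moveSubtrees_of_notMem hyU] at hyne)
  have hUne : U.Nonempty := by rw [← Finset.card_pos]; omega
  refine ⟨p, ⟨hgood, by rwa [hchb], ?_⟩, by rw [deg, hchb, hUm], ?_⟩
  · rw [alpha_lt_betaStar (hgood.children_top_nonempty hne) (by rwa [hchb]), hchb]
    intro c hc u hu
    rw [hβ, hβ]
    exact hlt c (hcht c hc).1 (hcht c hc).2 u hu
  · rw [mapA, hchb]
    exact moveSubtrees_moveSubtrees fun s hs => (mem_children.1 (hU hs)).1

end Swing

/-! ### Merging at a node and critical nodes. -/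

section Attach

variable {V : Type*} [Fintype V] [LinearOrder V] [BoundedOrder V] {p p' q q' : V → V}
  {w r c c' u x y z : V}

/-- The subtree `T_r`, where `r` is a child of `w` in `T_⊤`, contains `⊥`. -/
structure Attachable (p : V → V) (w r : V) : Prop where
  good : Good p
  mem : r ∈ children p w
  bot : IsDesc p ⊥ r
  top : IsDesc p w ⊤

/-- The node `c ≠ w` of `T_w - T_r` is smaller than every node of `T_⊤ - T_r - T_c`. -/
structure AttachNode (p : V → V) (w r c : V) : Prop where
  desc : IsDesc p c w
  ne : c ≠ w
  not_desc : ¬ IsDesc p c r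
  lt : ∀ z, IsDesc p z ⊤ → ¬ IsDesc p z c → ¬ IsDesc p z r → c < z

/-- `u ∉ {w, ⊥}` lies on the path from `w` to `⊥` and is smaller than every node of
`T_⊤ - T_u`. -/
structure IsCritical (p : V → V) (w u : V) : Prop where
  bot : IsDesc p ⊥ u
  desc : IsDesc p u w
  ne : u ≠ w
  ne_bot : u ≠ ⊥
  lt : ∀ z, IsDesc p z ⊤ → ¬ IsDesc p z u → u < z

namespace Attachable

theorem not_father (h : Attachable p w r) : ¬ IsDesc p w r :=
  not_isDesc_of_mem_children h.good.1 h.mem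

theorem desc (h : Attachable p w r) : IsDesc p r w := isDesc_of_mem_children h.mem

theorem not_top (h : Attachable p w r) : ¬ IsDesc p ⊤ r := fun h' => h.not_father (h.top.trans h')

theorem ne_bot (h : Attachable p w r) : w ≠ ⊥ := by
  rintro rfl
  exact h.not_father h.bot

theorem bot_ne_top (h : Attachable p w r) : (⊥ : V) ≠ ⊤ := fun he => h.not_top (he ▸ h.bot)

theorem unique {r' : V} (h : Attachable p w r) (h' : Attachable p w r') : r = r' :=
  children_eq_of_isDesc h.good.1 h.mem h'.mem h.bot h'.bot

end Attachable

namespace AttachNode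

variable (h : Attachable p w r) (hc : AttachNode p w r c)
include h hc

theorem ne_bot : c ≠ ⊥ := by
  rintro rfl
  exact hc.not_desc h.bot

theorem ne_top : c ≠ ⊤ := by
  rintro rfl
  exact hc.ne (hc.desc.antisymm h.good.1 h.top)

theorem tree : IsRootedTree (moveSubtrees p {r} c) := h.good.1.move_singleton hc.not_desc

theorem isDesc_move : IsDesc (moveSubtrees p {r} c) z x ↔
    (IsDesc p z x ∧ (IsDesc p z r → IsDesc p r x → r = x)) ∨ (IsDesc p z r ∧ IsDesc p c x) :=
  isDesc_move_singleton h.good.1 hc.not_desc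

theorem isDesc_of_above (hx : IsDesc p w x) : IsDesc (moveSubtrees p {r} c) z x ↔ IsDesc p z x := by
  rw [hc.isDesc_move h]
  have h1 := hc.desc.trans hx
  have h2 : IsDesc p z r → IsDesc p z x := fun hz => hz.trans (h.desc.trans hx)
  tauto

theorem isDesc_of_inside (hx : IsDesc p x r) :
    IsDesc (moveSubtrees p {r} c) z x ↔ IsDesc p z x := by
  rw [hc.isDesc_move h]
  have h1 : ¬ IsDesc p c x := fun hcx => hc.not_desc (hcx.trans hx)
  have h2 : IsDesc p r x → r = x := fun hr => hr.antisymm h.good.1 hx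
  tauto

theorem isDesc_of_outside (hz : ¬ IsDesc p z r) :
    IsDesc (moveSubtrees p {r} c) z x ↔ IsDesc p z x := by
  rw [hc.isDesc_move h]
  tauto

theorem isDesc_of_inside_outside (hz : IsDesc p z r) (hx : ¬ IsDesc p x r) :
    IsDesc (moveSubtrees p {r} c) z x ↔ IsDesc p c x := by
  rw [hc.isDesc_move h]
  have h1 : r ≠ x := fun he => hx (he ▸ IsDesc.refl p r)
  have h2 : IsDesc p z x → IsDesc p r x := fun h3 => (h3.total hz).resolve_left hx
  tauto

/-- Only nodes on the path from c up to w, below w, gain T_r, and nothing at or above w loses it.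
For such a z the father is outside T_c and T_r, hence greater than c, so its edge was improper
already because of c. The edge of r is improper before and after because of ⊥. -/
theorem isImproperEdge_move :
    IsImproperEdge (moveSubtrees p {r} c) z ↔ IsImproperEdge p z := by
  by_cases hzr : z = r
  · subst hzr
    have h1 : IsImproperEdge p z := isImproperEdge_of_bot h.bot (father_ne_of_mem_children h.mem)
    have h2 : IsImproperEdge (moveSubtrees p {z} c) z := by
      refine isImproperEdge_of_bot ((hc.isDesc_of_inside h (IsDesc.refl p z)).2 h.bot) ?_
      rw [moveSubtrees_of_mem (Finset.mem_singleton_self z)]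
      rintro rfl
      exact hc.not_desc (IsDesc.refl p c)
    exact ⟨fun _ => h1, fun _ => h2⟩
  · rw [isImproperEdge_iff, isImproperEdge_iff, moveSubtrees_of_notMem (by simpa using hzr)]
    refine and_congr_right fun hne => ?_
    constructor
    · rintro ⟨x, hx, hle⟩
      by_cases hxz : IsDesc p x z
      · exact ⟨x, hxz, hle⟩
      have hxr : IsDesc p x r ∧ IsDesc p c z := by
        rw [hc.isDesc_move h] at hx
        tauto
      rcases hxr.2.total hc.desc with hzw | hwz
      · by_cases hzw' : z = w
        · exact absurd (hxr.1.trans (hzw' ▸ h.desc)) hxz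
        · have hlt := hc.lt (p z) ((hzw.father hzw').trans h.top)
            (fun hd => not_isDesc_father h.good.1 hne (hd.trans hxr.2))
            (fun hd => hc.not_desc (hxr.2.trans ((isDesc_father p z).trans hd)))
          exact ⟨c, hxr.2, hlt.le⟩
      · exact absurd (hxr.1.trans (h.desc.trans hwz)) hxz
    · rintro ⟨x, hx, hle⟩
      refine ⟨x, (hc.isDesc_move h).2 ?_, hle⟩
      by_cases hrz : IsDesc p r z
      · have hwz : IsDesc p w z := (mem_children.1 h.mem).1 ▸ hrz.father (Ne.symm hzr)
        have := hc.desc.trans hwz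
        tauto
      · tauto

theorem good_move : Good (moveSubtrees p {r} c) := by
  refine ⟨hc.tree h, fun y hy hne => ?_⟩
  rw [hc.isDesc_of_outside h h.not_top] at hy
  rw [hc.isImproperEdge_move h]
  refine h.good.2 y hy ?_
  rwa [moveSubtrees_of_notMem] at hne
  rw [Finset.mem_singleton]
  rintro rfl
  exact h.not_top hy

theorem improperCount_move : improperCount (moveSubtrees p {r} c) = improperCount p := by
  rw [improperCount, improperCount]
  congr 1
  ext z
  simp [hc.isImproperEdge_move h]

theorem attachable_move : Attachable (moveSubtrees p {r} c) c r where
  good := hc.good_move h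
  mem := mem_children.2 ⟨moveSubtrees_of_mem (Finset.mem_singleton_self r), by
    rintro rfl
    exact hc.not_desc (IsDesc.refl p r)⟩
  bot := (hc.isDesc_of_inside h (IsDesc.refl p r)).2 h.bot
  top := (hc.isDesc_of_above h h.top).2 (hc.desc.trans h.top)

omit hc in
-- Of two incomparable attach nodes each would be smaller than the other.
theorem total (hc : AttachNode p w r c) (hc' : AttachNode p w r c') :
    IsDesc p c c' ∨ IsDesc p c' c := by
  by_contra! hcon
  exact lt_asymm (hc.lt c' (hc'.desc.trans h.top) hcon.2 hc'.not_desc)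
    (hc'.lt c (hc.desc.trans h.top) hcon.1 hc.not_desc)

theorem isCritical_of_above (hc' : AttachNode p w r c') (hd : IsDesc p c c') :
    IsCritical (moveSubtrees p {r} c) w c' where
  bot := (hc.isDesc_of_inside_outside h h.bot hc'.not_desc).2 hd
  desc := (hc.isDesc_of_above h (IsDesc.refl p w)).2 hc'.desc
  ne := hc'.ne
  ne_bot := hc'.ne_bot h
  lt z hz hn := by
    rw [hc.isDesc_of_above h h.top] at hz
    rw [hc.isDesc_move h] at hn
    have h1 : IsDesc p r c' → IsDesc p c r → False := fun _ => hc.not_desc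
    refine hc'.lt z hz ?_ ?_ <;> tauto

theorem isCritical_move : IsCritical (moveSubtrees p {r} c) w c :=
  hc.isCritical_of_above h hc (IsDesc.refl p c)

theorem isCritical_of_isCritical (hu : IsCritical p w u) :
    IsDesc p u r ∧ IsCritical (moveSubtrees p {r} c) w u := by
  have hur : IsDesc p u r := by
    rcases h.bot.of_mem_children_of_ne h.mem hu.bot with h1 | h1
    · exact h1
    · exact absurd (hu.desc.antisymm h.good.1 h1) hu.ne
  refine ⟨hur, ?_, ?_, hu.ne, hu.ne_bot, fun z hz hn => hu.lt z ?_ ?_⟩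
  · exact (hc.isDesc_of_inside h hur).2 hu.bot
  · exact (hc.isDesc_of_above h (IsDesc.refl p w)).2 hu.desc
  · exact (hc.isDesc_of_above h h.top).1 hz
  · rwa [hc.isDesc_of_inside h hur] at hn

/-- Critical nodes above the father of the attached tree are unchanged. -/
theorem isCritical_top (hw : IsCritical p ⊤ w) : IsCritical (moveSubtrees p {r} c) ⊤ w := by
  refine ⟨(hc.isDesc_of_above h (IsDesc.refl p w)).2 hw.bot,
    (hc.isDesc_of_above h h.top).2 hw.desc, hw.ne, hw.ne_bot, fun z hz hn => hw.lt z ?_ ?_⟩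
  · exact (hc.isDesc_of_above h h.top).1 hz
  · rwa [hc.isDesc_of_above h (IsDesc.refl p w)] at hn

theorem mem_children_move_iff (hx : x ≠ w) (hxc : x ≠ c) :
    y ∈ children (moveSubtrees p {r} c) x ↔ y ∈ children p x := by
  rw [mem_children, mem_children]
  by_cases hy : y = r
  · subst hy
    rw [moveSubtrees_of_mem (Finset.mem_singleton_self y), (mem_children.1 h.mem).1]
    tauto
  · rw [moveSubtrees_of_notMem (by simpa using hy)]

theorem deg_move (hx : x ≠ w) (hxc : x ≠ c) : deg (moveSubtrees p {r} c) x = deg p x := by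
  rw [deg, deg]
  congr 1
  ext y
  exact hc.mem_children_move_iff h hx hxc

theorem deg_bot_move : deg (moveSubtrees p {r} c) ⊥ = deg p ⊥ :=
  hc.deg_move h h.ne_bot.symm (hc.ne_bot h).symm

theorem deg_father_move : deg (moveSubtrees p {r} c) w + 1 = deg p w := by
  classical
  rw [deg, deg, ← Finset.card_erase_add_one h.mem]
  congr 2
  ext y
  rw [Finset.mem_erase, mem_children, mem_children]
  by_cases hy : y = r
  · subst hy
    rw [moveSubtrees_of_mem (Finset.mem_singleton_self y)]
    have := hc.ne
    tauto
  · rw [moveSubtrees_of_notMem (by simpa using hy)]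
    tauto

omit hc in
theorem move_back : moveSubtrees (moveSubtrees p {r} c) {r} w = p :=
  moveSubtrees_moveSubtrees fun s hs => by
    rw [Finset.mem_singleton.1 hs]
    exact (mem_children.1 h.mem).1

end AttachNode

/-- `q` arises from `p` by moving the child of `w` above `⊥` to the highest possible node. -/
def Merge (w : V) (p q : V → V) : Prop :=
  ∃ r c, Attachable p w r ∧ AttachNode p w r c ∧ (∀ c', AttachNode p w r c' → IsDesc p c' c) ∧
    q = moveSubtrees p {r} c

/-- The old critical nodes lie in T_r and hence below c. A new one above c would have been a higher
attach node, which the maximality of c excludes. So the move adds c only, and c can be read off as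
the highest critical node. -/
theorem isCritical_move_iff (h : Attachable p w r) (hc : AttachNode p w r c)
    (hmax : ∀ c', AttachNode p w r c' → IsDesc p c' c) :
    IsCritical (moveSubtrees p {r} c) w u ↔ u = c ∨ IsCritical p w u := by
  constructor
  · intro hu
    by_cases huc : u = c
    · exact Or.inl huc
    refine Or.inr ?_
    rcases hu.bot.total (hc.isCritical_move h).bot with h1 | h1
    · have hur : IsDesc (moveSubtrees p {r} c) u r := by
        have h2 := hc.attachable_move h
        rcases h2.bot.of_mem_children_of_ne h2.mem hu.bot with h3 | h3
        · exact h3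
        · exact absurd (h1.antisymm (hc.tree h) h3) huc
      rw [hc.isDesc_of_inside h (IsDesc.refl p r)] at hur
      refine ⟨(hc.isDesc_of_inside h hur).1 hu.bot, hur.trans h.desc, hu.ne, hu.ne_bot,
        fun z hz hn => hu.lt z ((hc.isDesc_of_above h h.top).2 hz) ?_⟩
      rwa [hc.isDesc_of_inside h hur]
    · rw [hc.isDesc_of_outside h hc.not_desc] at h1
      have hur : ¬ IsDesc p u r := fun h2 => hc.not_desc (h1.trans h2)
      have huw : IsDesc p u w := (hc.isDesc_of_above h (IsDesc.refl p w)).1 hu.desc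
      have hu' : AttachNode p w r u := by
        refine ⟨huw, hu.ne, hur, fun z hz hn hzr =>
          hu.lt z ((hc.isDesc_of_above h h.top).2 hz) ?_⟩
        rwa [hc.isDesc_of_outside h hzr]
      exact absurd ((hmax u hu').antisymm h.good.1 h1) huc
  · rintro (rfl | hu)
    · exact hc.isCritical_move h
    · exact (hc.isCritical_of_isCritical h hu).2

theorem isCritical_isDesc_move (h : Attachable p w r) (hc : AttachNode p w r c)
    (hmax : ∀ c', AttachNode p w r c' → IsDesc p c' c)
    (hu : IsCritical (moveSubtrees p {r} c) w u) : IsDesc (moveSubtrees p {r} c) u c := by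
  rcases (isCritical_move_iff h hc hmax).1 hu with rfl | hu
  · exact IsDesc.refl _ _
  · have h1 := (hc.isCritical_of_isCritical h hu).1
    exact ((hc.isDesc_of_inside h (IsDesc.refl p r)).2 h1).trans (hc.attachable_move h).desc

theorem exists_highest_attachNode (h : Attachable p w r) (he : ∃ c, AttachNode p w r c) :
    ∃ c, AttachNode p w r c ∧ ∀ c', AttachNode p w r c' → IsDesc p c' c :=
  exists_highest (fun _ _ hu hu' => AttachNode.total h hu hu') he

theorem exists_merge (h : Attachable p w r) (he : ∃ c, AttachNode p w r c) : ∃ q, Merge w p q := by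
  obtain ⟨c, hc, hmax⟩ := exists_highest_attachNode h he
  exact ⟨_, r, c, h, hc, hmax, rfl⟩

/-- The minimum of T_⊤ - T_r works. It is less than w because of x, and so it lies in T_w, since the
nodes of T_⊤ outside T_w exceed w. -/
theorem exists_attachNode (h : Attachable p w r)
    (hw : ∀ z, IsDesc p z ⊤ → ¬ IsDesc p z w → w < z)
    (hx : IsDesc p x w) (hxr : ¬ IsDesc p x r) (hlt : x < w) : ∃ c, AttachNode p w r c := by
  classical
  obtain ⟨c, hc, hmin⟩ := Finset.exists_min_image
    (Finset.univ.filter fun z => IsDesc p z ⊤ ∧ ¬ IsDesc p z r) id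
    ⟨x, by simpa using ⟨hx.trans h.top, hxr⟩⟩
  simp only [Finset.mem_filter, Finset.mem_univ, true_and, id_eq] at hc hmin
  have hcw : c < w := (hmin x ⟨hx.trans h.top, hxr⟩).trans_lt hlt
  refine ⟨c, ?_, hcw.ne, hc.2, fun z hz hzc hzr => lt_of_le_of_ne (hmin z ⟨hz, hzr⟩) ?_⟩
  · by_contra hn
    exact lt_asymm hcw (hw c hc.1 hn)
  · rintro rfl
    exact hzc (IsDesc.refl p _)

/-- Moving the subtree below a critical node up to `w`. -/
theorem AttachNode.of_isCritical (hq : Good q) (hw : IsDesc q w ⊤) (hc : IsCritical q w c)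
    (hr : r ∈ children q c) (hbr : IsDesc q ⊥ r) :
    Attachable (moveSubtrees q {r} w) w r ∧ AttachNode (moveSubtrees q {r} w) w r c ∧
      moveSubtrees (moveSubtrees q {r} w) {r} c = q := by
  have hrc := isDesc_of_mem_children hr
  have hcr : ¬ IsDesc q c r := not_isDesc_of_mem_children hq.1 hr
  have hwr : ¬ IsDesc q w r := fun h => hcr (hc.desc.trans h)
  have htr : ¬ IsDesc q ⊤ r := fun h => hwr (hw.trans h)
  have e : ∀ {z x}, IsDesc (moveSubtrees q {r} w) z x ↔
      (IsDesc q z x ∧ (IsDesc q z r → IsDesc q r x → r = x)) ∨ (IsDesc q z r ∧ IsDesc q w x) :=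
    isDesc_move_singleton hq.1 hwr
  have e1 : ∀ {z x}, ¬ IsDesc q z r → (IsDesc (moveSubtrees q {r} w) z x ↔ IsDesc q z x) := by
    intro z x hz
    rw [e]
    tauto
  refine ⟨⟨⟨hq.1.move_singleton hwr, fun y hy hne => ?_⟩, ?_, ?_, ?_⟩, ⟨?_, hc.ne, ?_, ?_⟩,
    moveSubtrees_moveSubtrees fun s hs => by
      rw [Finset.mem_singleton.1 hs]
      exact (mem_children.1 hr).1⟩
  · rw [e1 htr] at hy
    have hyr : y ≠ r := by
      rintro rfl
      exact htr hy
    rw [moveSubtrees_of_notMem (by simpa using hyr)] at hne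
    rw [isImproperEdge_iff, moveSubtrees_of_notMem (by simpa using hyr)]
    obtain ⟨-, x, hx, hle⟩ := isImproperEdge_iff.1 (hq.2 y hy hne)
    refine ⟨hne, x, e.2 ?_, hle⟩
    have := hw.trans hy
    tauto
  · refine mem_children.2 ⟨moveSubtrees_of_mem (Finset.mem_singleton_self r), ?_⟩
    rintro rfl
    exact hwr (IsDesc.refl q r)
  · exact e.2 (Or.inl ⟨hbr, fun _ _ => rfl⟩)
  · exact (e1 hwr).2 hw
  · exact (e1 hcr).2 hc.desc
  · rwa [e1 hcr]
  · intro z hz hzc hzr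
    have hzr' : ¬ IsDesc q z r := fun h => hzr (e.2 (Or.inl ⟨h, fun _ _ => rfl⟩))
    rw [e1 hzr'] at hz hzc
    exact hc.lt z hz hzc

/-- Rejoin to w the piece below the highest critical node c. In the resulting tree c is the highest
attach node, because an attach node above c would be critical in q. -/
theorem exists_merge_left (hq : Good q) (hw : IsDesc q w ⊤) (he : ∃ c, IsCritical q w c) :
    ∃ p, Merge w p q := by
  obtain ⟨c, hc, hmax⟩ := exists_highest (fun _ _ hu hu' => hu.bot.total hu'.bot) he
  obtain ⟨r, hr, hbr⟩ := hc.bot.exists_mem_children hc.ne_bot.symm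
  obtain ⟨h1, h2, h3⟩ := AttachNode.of_isCritical hq hw hc hr hbr
  refine ⟨_, r, c, h1, h2, fun c' hc' => ?_, h3.symm⟩
  rcases AttachNode.total h1 h2 hc' with h4 | h4
  · have := hmax c' (h3 ▸ h2.isCritical_of_above h1 hc' h4)
    rw [← h3] at this
    exact (h2.isDesc_of_outside h1 hc'.not_desc).1 this
  · exact h4

theorem Merge.right_unique (h : Merge w p q) (h' : Merge w p q') : q = q' := by
  obtain ⟨r, c, h1, h2, h3, rfl⟩ := h
  obtain ⟨r', c', h1', h2', h3', rfl⟩ := h'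
  obtain rfl := h1.unique h1'
  rw [(h3 c' h2').antisymm h1.good.1 (h3' c h2)]

/-- In q the node c is the highest critical node below w and r is its child above ⊥, so the move can
be undone from q alone. -/
theorem Merge.left_unique (h : Merge w p q) (h' : Merge w p' q) : p = p' := by
  obtain ⟨r, c, h1, h2, h3, hq⟩ := h
  obtain ⟨r', c', h1', h2', h3', hq'⟩ := h'
  have hm : moveSubtrees p {r} c = moveSubtrees p' {r'} c' := hq ▸ hq'
  have hc : c = c' := by
    have a1 := isCritical_isDesc_move h1 h2 h3 (u := c') (hm ▸ h2'.isCritical_move h1')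
    have a2 := isCritical_isDesc_move h1' h2' h3' (u := c) (hm ▸ h2.isCritical_move h1)
    rw [← hm] at a2
    exact a2.antisymm (h2.tree h1) a1
  subst hc
  have hr : r = r' := (h2.attachable_move h1).unique (hm ▸ h2'.attachable_move h1')
  subst hr
  rw [← AttachNode.move_back h1 (c := c), ← AttachNode.move_back h1' (c := c), hm]

end Attach

/-! ### The lower critical node λ. -/

section LowerCritical

variable {V : Type*} [Fintype V] [LinearOrder V] [BoundedOrder V] {p q : V → V}
  {w r c u x y z : V}

theorem onPath_total {u u' : V} (h : OnPath p x y u) (h' : OnPath p x y u') :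
    IsDesc p u u' ∨ IsDesc p u' u := h.2.total h'.2

theorem exists_isFirstOnPath {P : V → Prop} (h : ∃ u, OnPath p x y u ∧ P u) :
    ∃ u, IsFirstOnPath p x y P u := by
  obtain ⟨u, hu, hmax⟩ := exists_highest (fun _ _ hu hu' => onPath_total hu.1 hu'.1) h
  exact ⟨u, hu.1, hu.2, fun u' h1 h2 => hmax u' ⟨h1, h2⟩⟩

theorem lowerCritical_spec (h : (children p ⊤).Nonempty) :
    IsFirstOnPath p ⊤ (beta p ⊤) (fun u => u ≠ ⊤ ∧ BelowRest p ⊤ u) (lowerCritical p) := by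
  refine Classical.epsilon_spec (exists_isFirstOnPath ?_)
  obtain ⟨b, hb⟩ := h
  refine ⟨beta p ⊤, ⟨isDesc_beta p ⊤, IsDesc.refl p _⟩, ?_, fun z hz hz' => ?_⟩
  · exact ((beta_le (isDesc_of_mem_children hb)).trans_lt
      (lt_top_iff_ne_top.2 (mem_children.1 hb).2)).ne
  · refine lt_of_le_of_ne (beta_le (mem_subtree.1 hz)) ?_
    rintro rfl
    exact hz' (mem_subtree.2 (IsDesc.refl p _))

/-- Here β(⊤) = ⊥, so ⊥ itself is always admissible as the last node of the path; λ differs from it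
exactly when an earlier node qualifies. -/
theorem bot_lt_lowerCritical (hp : IsRootedTree p) (h : (children p ⊤).Nonempty)
    (hb : IsDesc p ⊥ ⊤) : ⊥ < lowerCritical p ↔ ∃ c, IsCritical p ⊤ c := by
  have hβ : beta p ⊤ = ⊥ := le_bot_iff.1 (beta_le hb)
  obtain ⟨h1, ⟨h2, h3⟩, h4⟩ := lowerCritical_spec h
  rw [hβ] at h1 h4
  constructor
  · exact fun hlt => ⟨_, h1.2, h1.1, h2, hlt.ne', fun z hz hn =>
      h3 z (mem_subtree.2 hz) (fun h => hn (mem_subtree.1 h))⟩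
  · rintro ⟨c, hc⟩
    have hcl := h4 c ⟨hc.desc, hc.bot⟩ ⟨hc.ne, fun z hz hn =>
      hc.lt z (mem_subtree.1 hz) fun h => hn (mem_subtree.2 h)⟩
    refine bot_lt_iff_ne_bot.2 fun he => hc.ne_bot ?_
    exact IsDesc.antisymm hp (he ▸ hcl) hc.bot

theorem bot_lt_lowerCritical_of_not_isDesc (h : (children p ⊤).Nonempty) (hb : ¬ IsDesc p ⊥ ⊤) :
    ⊥ < lowerCritical p := by
  refine bot_lt_iff_ne_bot.2 fun he => hb ?_
  have := (lowerCritical_spec h).1.1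
  rwa [he] at this

end LowerCritical

/-! ### The map (c) as a merge at ⊤. -/

section JoinNode

variable {V : Type*} [Fintype V] [LinearOrder V] [BoundedOrder V] {p q : V → V}
  {w r c u x y z b : V}

theorem mem_childrenAboveBot : b ∈ childrenAboveBot p ↔ b ∈ children p ⊤ ∧ IsDesc p ⊥ b := by
  simp [childrenAboveBot]

theorem mem_childrenOffBot : b ∈ childrenOffBot p ↔ b ∈ children p ⊤ ∧ ¬ IsDesc p ⊥ b := by
  simp [childrenOffBot]

theorem argminBeta_spec {C : Finset V} (h : C.Nonempty) :
    argminBeta p C ∈ C ∧ ∀ b ∈ C, beta p (argminBeta p C) ≤ beta p b :=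
  Classical.epsilon_spec (p := fun b => b ∈ C ∧ ∀ b' ∈ C, beta p b ≤ beta p b')
    (C.exists_min_image (beta p) h)

namespace Swingable

variable (hp : Swingable p)
include hp

theorem isDesc_mapA : IsDesc (mapA p) z x ↔
    (IsDesc p z x ∧ ∀ s ∈ children p ⊥, IsDesc p z s → IsDesc p s x → s = x) ∨
      (Below p (children p ⊥) z ∧ IsDesc p ⊤ x) :=
  isDesc_move hp.good.1 hp.not_below_top

theorem isDesc_mapA_top (hz : IsDesc p z ⊤ ∨ Below p (children p ⊥) z) :
    IsDesc (mapA p) z ⊤ := by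
  by_cases hb : Below p (children p ⊥) z
  · exact hp.isDesc_mapA.2 (Or.inr ⟨hb, IsDesc.refl p _⟩)
  · exact (hp.isDesc_mapA_of_not_below hb).2 (hz.resolve_right hb)

theorem not_isDesc_mapA_of_below (hz : Below p (children p ⊥) z) (hx : x ∈ children p ⊤)
    (hbx : IsDesc p ⊥ x) : ¬ IsDesc (mapA p) z x := by
  intro h
  obtain ⟨s, hs, hzs⟩ := hz
  rcases hp.isDesc_mapA.1 h with h | h
  · have := h.2 s hs hzs ((isDesc_of_mem_children hs).trans hbx)
    exact Finset.disjoint_left.1 hp.disjoint_children hx (this ▸ hs)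
  · exact not_isDesc_of_mem_children hp.good.1 hx h.2

theorem not_below_of_mem_childrenOffBot (hb : b ∈ childrenOffBot p) (hz : IsDesc p z b) :
    ¬ Below p (children p ⊥) z := by
  rintro ⟨s, hs, hzs⟩
  rw [mem_childrenOffBot] at hb
  rcases hz.of_mem_children_of_ne hb.1 hzs with h | h
  · refine hb.2 ?_
    rw [← (mem_children.1 hs).1]
    refine h.father ?_
    rintro rfl
    exact Finset.disjoint_left.1 hp.disjoint_children hb.1 hs
  · exact hp.not_below_top ⟨s, hs, h⟩

theorem attachable_mapA {r : V} (hr : r ∈ children p ⊤) (hbr : IsDesc p ⊥ r) :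
    Attachable (mapA p) ⊤ r :=
  ⟨hp.good_mapA, hp.mem_children_top_mapA.2 (Or.inl hr), hp.isDesc_bot_mapA.2 hbr,
    IsDesc.refl _ _⟩

/-- After `mapA`, T_⊤ without T_r consists of ⊤, the rest of T_⊤ in p, and the moved subtrees. The
three inequalities bound c by the nodes of T_b outside T_c, by the moved nodes, and by the remaining
children's subtrees: together, by all nodes an attach node must precede. Thus the first such c is
the highest attach node. -/
theorem joinNode_candidate_iff {r : V} (hr : r ∈ children p ⊤) (hbr : IsDesc p ⊥ r)
    (hb : b ∈ childrenOffBot p) (hmin : ∀ b' ∈ childrenOffBot p, beta p b ≤ beta p b') :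
    (OnPath p b (beta p b) c ∧ BelowRest p b c ∧ c < betaStar p ∧
      ∀ b' ∈ childrenOffBot p, b' ≠ b → c < beta p b') ↔ AttachNode (mapA p) ⊤ r c := by
  have hbt := (mem_childrenOffBot.1 hb).1
  have hne : r ≠ b := by
    rintro rfl
    exact (mem_childrenOffBot.1 hb).2 hbr
  have hsep : ∀ {z}, IsDesc p z b → ¬ IsDesc p z r := fun h h' =>
    hne (children_eq_of_isDesc hp.good.1 hr hbt h' h)
  have hcases : ∀ {z}, IsDesc p z ⊤ → z ≠ ⊤ → ¬ IsDesc p z r →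
      ∃ b' ∈ childrenOffBot p, IsDesc p z b' := by
    intro z hz hzt hzr
    obtain ⟨b', hb', hd⟩ := hz.exists_mem_children hzt
    refine ⟨b', mem_childrenOffBot.2 ⟨hb', fun h => hzr ?_⟩, hd⟩
    rwa [children_eq_of_isDesc hp.good.1 hr hb' hbr h]
  constructor
  · rintro ⟨hpath, hrest, hstar, hoff⟩
    have hcb : ¬ Below p (children p ⊥) c := hp.not_below_of_mem_childrenOffBot hb hpath.1
    have hct : c ≠ ⊤ := by
      rintro rfl
      exact not_isDesc_of_mem_children hp.good.1 hbt hpath.1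
    refine ⟨hp.isDesc_mapA_top (Or.inl (hpath.1.trans (isDesc_of_mem_children hbt))), hct, ?_,
      fun z hz hzc hzr => ?_⟩
    · rw [hp.isDesc_mapA_of_not_below hcb]
      exact hsep hpath.1
    · by_cases hzb : Below p (children p ⊥) z
      · obtain ⟨s, hs, hzs⟩ := hzb
        exact (hstar.trans_le (betaStar_le_beta hs)).trans_le (beta_le hzs)
      · rw [hp.isDesc_mapA_of_not_below hzb] at hz hzc hzr
        by_cases hzt : z = ⊤
        · exact hzt ▸ lt_top_iff_ne_top.2 hct
        obtain ⟨b', hb', hzb'⟩ := hcases hz hzt hzr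
        by_cases hbb : b' = b
        · subst hbb
          exact hrest z (mem_subtree.2 hzb') fun h => hzc (mem_subtree.1 h)
        · exact (hoff b' hb' hbb).trans_le (beta_le hzb')
  · intro hc
    have hmb : ¬ Below p (children p ⊥) (beta p b) :=
      hp.not_below_of_mem_childrenOffBot hb (isDesc_beta p b)
    have hct : IsDesc p c ⊤ ∨ Below p (children p ⊥) c := by
      by_cases hcb : Below p (children p ⊥) c
      · exact Or.inr hcb
      · exact Or.inl ((hp.isDesc_mapA_of_not_below hcb).1 hc.desc)
    -- Otherwise c < β(b). But c lies in a moved subtree, whose nodes exceed β(b), or below a child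
    -- of ⊤ off ⊥, whose β is at least β(b).
    have hmc : IsDesc p (beta p b) c := by
      rw [← hp.isDesc_mapA_of_not_below hmb]
      by_contra hn
      have hlt := hc.lt (beta p b)
        (hp.isDesc_mapA_top (Or.inl ((isDesc_beta p b).trans (isDesc_of_mem_children hbt)))) hn (by
          rw [hp.isDesc_mapA_of_not_below hmb]
          exact hsep (isDesc_beta p b))
      have hcb : ¬ Below p (children p ⊥) c := by
        rintro ⟨s, hs, hcs⟩
        exact lt_asymm hlt ((hp.beta_lt hbt hs).trans_le (beta_le hcs))
      have hcr := hc.not_desc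
      rw [hp.isDesc_mapA_of_not_below hcb] at hcr
      obtain ⟨b', hb', hcb'⟩ := hcases (hct.resolve_right hcb) hc.ne hcr
      exact absurd ((hmin b' hb').trans (beta_le hcb')) (not_le.2 hlt)
    have hcb : ¬ Below p (children p ⊥) c := fun h => hmb (h.mono hmc)
    have hcr := hc.not_desc
    rw [hp.isDesc_mapA_of_not_below hcb] at hcr
    have hcb' : IsDesc p c b := by
      obtain ⟨b', hb', hcb'⟩ := hcases (hct.resolve_right hcb) hc.ne hcr
      rwa [children_eq_of_isDesc hp.good.1 hbt (mem_childrenOffBot.1 hb').1 (isDesc_beta p b)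
        (hmc.trans hcb')]
    have hlt : ∀ z, IsDesc p z ⊤ ∨ Below p (children p ⊥) z → ¬ IsDesc p z c →
        (¬ IsDesc p z r ∨ Below p (children p ⊥) z) → c < z := by
      intro z hz hzc hzr
      refine hc.lt z (hp.isDesc_mapA_top hz) (fun h => ?_) ?_
      · rcases hp.isDesc_mapA.1 h with h | h
        · exact hzc h.1
        · exact not_isDesc_of_mem_children hp.good.1 hbt (h.2.trans hcb')
      · by_cases hzb : Below p (children p ⊥) z
        · exact hp.not_isDesc_mapA_of_below hzb hr hbr
        · rw [hp.isDesc_mapA_of_not_below hzb]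
          exact hzr.resolve_right hzb
    refine ⟨⟨hcb', hmc⟩, fun z hz hzc => ?_, ?_, fun b' hb' hbb => ?_⟩
    · rw [mem_subtree] at hz hzc
      exact hlt z (Or.inl (hz.trans (isDesc_of_mem_children hbt))) hzc (Or.inl (hsep hz))
    · obtain ⟨s, hs, hβ⟩ := exists_beta_eq_betaStar hp.nonempty
      have hb' : Below p (children p ⊥) (betaStar p) := ⟨s, hs, hβ ▸ isDesc_beta p s⟩
      exact hlt _ (Or.inr hb') (fun h =>
        hp.not_below_of_mem_childrenOffBot hb (h.trans hcb') hb') (Or.inr hb')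
    · have hbt' := (mem_childrenOffBot.1 hb').1
      have hd := isDesc_beta p b'
      refine hlt _ (Or.inl (hd.trans (isDesc_of_mem_children hbt'))) (fun h => hbb ?_)
        (Or.inl fun h => (mem_childrenOffBot.1 hb').2 ?_)
      · exact children_eq_of_isDesc hp.good.1 hbt' hbt hd (h.trans hcb')
      · rwa [children_eq_of_isDesc hp.good.1 hbt' hr hd h]

theorem exists_above_bot (hbt : IsDesc p ⊥ ⊤) :
    ∃ r ∈ children p ⊤, IsDesc p ⊥ r ∧ childrenAboveBot p = {r} := by
  obtain ⟨r, hr, hbr⟩ := hbt.exists_mem_children hp.bot_ne_top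
  refine ⟨r, hr, hbr, ?_⟩
  ext b
  rw [mem_childrenAboveBot, Finset.mem_singleton]
  constructor
  · exact fun h => children_eq_of_isDesc hp.good.1 h.1 hr h.2 hbr
  · rintro rfl
    exact ⟨hr, hbr⟩

/-- The two moves in (c) concern disjoint sets of roots and so commute; performing `mapA` first
exposes the other one as a merge. -/
theorem merge_mapC (hbt : IsDesc p ⊥ ⊤) (hd : 2 ≤ deg p ⊤) : Merge ⊤ (mapA p) (mapC p) := by
  obtain ⟨r, hr, hbr, habove⟩ := hp.exists_above_bot hbt
  have hoff : (childrenOffBot p).Nonempty := by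
    obtain ⟨b, hb, hne⟩ := Finset.exists_mem_ne hd r
    refine ⟨b, mem_childrenOffBot.2 ⟨hb, fun h => hne ?_⟩⟩
    exact children_eq_of_isDesc hp.good.1 hb hr h hbr
  obtain ⟨hb, hmin⟩ := argminBeta_spec (p := p) hoff
  have key := fun c => hp.joinNode_candidate_iff (c := c) hr hbr hb hmin
  have h := hp.attachable_mapA hr hbr
  -- For w = ⊤ the requirement on the nodes of T_⊤ outside T_w is vacuous.
  have hlt : ∀ z, IsDesc (mapA p) z ⊤ → ¬ IsDesc (mapA p) z ⊤ → ⊤ < z := fun z h1 h2 =>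
    absurd h1 h2
  have hbt' := (mem_childrenOffBot.1 hb).1
  have hfirst : IsFirstOnPath p (secondChild p) (beta p (secondChild p)) (fun c =>
      BelowRest p (secondChild p) c ∧ c < betaStar p ∧
      ∀ b ∈ childrenOffBot p, b ≠ secondChild p → c < beta p b) (joinNode p) := by
    refine Classical.epsilon_spec (exists_isFirstOnPath ?_)
    have hnb := hp.not_below_of_mem_childrenOffBot hb (IsDesc.refl p _)
    obtain ⟨c, hc⟩ := exists_attachNode h hlt
      (hp.isDesc_mapA_top (Or.inl (isDesc_of_mem_children hbt'))) (by
        rw [hp.isDesc_mapA_of_not_below hnb]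
        intro h'
        have := children_eq_of_isDesc hp.good.1 hbt' hr (IsDesc.refl p _) h'
        exact (mem_childrenOffBot.1 hb).2 (this ▸ hbr))
      (lt_top_iff_ne_top.2 (mem_children.1 hbt').2)
    exact ⟨c, (key c).2 hc⟩
  refine ⟨r, joinNode p, h, (key _).1 ⟨hfirst.1, hfirst.2.1⟩, fun c' hc' => ?_, ?_⟩
  · obtain ⟨h1, h2⟩ := (key c').2 hc'
    rw [hp.isDesc_mapA_of_not_below (hp.not_below_of_mem_childrenOffBot hb h1.1)]
    exact hfirst.2.2 c' h1 h2
  · funext z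
    rw [mapC, habove, mapA]
    by_cases hz : z = r
    · subst hz
      rw [moveSubtrees_of_notMem (Finset.disjoint_left.1 hp.disjoint_children hr),
        moveSubtrees_of_mem (Finset.mem_singleton_self z),
        moveSubtrees_of_mem (Finset.mem_singleton_self z)]
    · rw [moveSubtrees_of_notMem (S := {r}) (by simpa using hz)]
      by_cases hzS : z ∈ children p ⊥
      · rw [moveSubtrees_of_mem hzS, moveSubtrees_of_mem hzS]
      · rw [moveSubtrees_of_notMem hzS, moveSubtrees_of_notMem hzS,
          moveSubtrees_of_notMem (by simpa using hz)]

end Swingable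

end JoinNode

/-! ### The bijections (a) and (c). -/

section BijAC

variable {n k m : ℕ} [NeZero n] {p : Fin n → Fin n}

theorem mem_RTrees : p ∈ RTrees n k 0 ↔ Good p ∧ improperCount p = k := by
  rw [RTrees, Set.mem_ofPred_eq, properOnTopPath_eq_zero, Good]
  tauto

theorem nonempty_of_deg (hm : 1 ≤ m) {x : Fin n} (h : deg p x = m) : (children p x).Nonempty := by
  rw [← Finset.card_pos, ← deg, h]
  exact hm

theorem swingable_of_mem (hm : 1 ≤ m) (h1 : p ∈ RTrees n k 0) (h2 : deg p ⊥ = m)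
    (h3 : alpha p < betaStar p) : Swingable p :=
  ⟨(mem_RTrees.1 h1).1, nonempty_of_deg hm h2, h3⟩

theorem bijOn_mapA (hm : 1 ≤ m) : Set.BijOn mapA (sourceA n k m) (targetA n k m) := by
  have hs : ∀ p ∈ sourceA n k m, Swingable p := fun p hp =>
    swingable_of_mem hm hp.1 hp.2.1 hp.2.2.2
  refine ⟨fun p hp => ?_, fun p hp p' hp' h => ?_, fun q hq => ?_⟩
  · have h := hs p hp
    refine ⟨mem_RTrees.2 ⟨h.good_mapA, ?_⟩, h.deg_bot_mapA, ?_, ?_⟩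
    · rw [h.improperCount_mapA, (mem_RTrees.1 hp.1).2, hp.2.1]
    · have : 0 < deg p ⊤ := Finset.card_pos.2 h.children_top
      rw [h.deg_top_mapA, hp.2.1]
      omega
    · rw [h.isDesc_bot_mapA]
      exact hp.2.2.1
  · exact (hs p hp).mapA_injective (hs p' hp') (hp.2.1.trans hp'.2.1.symm) h
  · obtain ⟨h1, h2, h3, h4⟩ := hq
    rw [mem_RTrees] at h1
    obtain ⟨p, hp, hpm, rfl⟩ := exists_swingable h1.1 (fun he => h4 (he ▸ IsDesc.refl _ _)) h2 hm h3
    refine ⟨p, ⟨mem_RTrees.2 ⟨hp.good, ?_⟩, hpm, ?_, hp.lt⟩, rfl⟩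
    · have := h1.2
      rw [hp.improperCount_mapA, hpm] at this
      omega
    · rwa [hp.isDesc_bot_mapA] at h4

theorem Merge.improperCount {w : Fin n} {t q : Fin n → Fin n} (h : Merge w t q) :
    improperCount q = improperCount t := by
  obtain ⟨r, c, h1, h2, -, rfl⟩ := h
  exact h2.improperCount_move h1

theorem bijOn_mapC (hm : 1 ≤ m) : Set.BijOn mapC (sourceC n k m) (targetC n k m) := by
  have hs : ∀ p ∈ sourceC n k m, Swingable p := fun p hp =>
    swingable_of_mem hm hp.1 hp.2.1 hp.2.2.2.2
  refine ⟨fun p hp => ?_, fun p hp p' hp' h => ?_, fun q hq => ?_⟩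
  · have h := hs p hp
    obtain ⟨r, c, h1, h2, h3, hq⟩ := h.merge_mapC hp.2.2.1 hp.2.2.2.1
    rw [hq]
    have hdt := h2.deg_father_move h1
    have hg := h2.good_move h1
    have hcrit := h2.isCritical_move h1
    rw [h.deg_top_mapA, hp.2.1] at hdt
    have hd := hp.2.2.2.1
    refine ⟨mem_RTrees.2 ⟨hg, ?_⟩, ?_, ?_, ?_, ?_⟩
    · rw [h2.improperCount_move h1, h.improperCount_mapA, (mem_RTrees.1 hp.1).2, hp.2.1]
    · rw [h2.deg_bot_move h1, h.deg_bot_mapA]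
    · omega
    · exact hcrit.bot.trans hcrit.desc
    · rw [bot_lt_lowerCritical hg.1 (hg.children_top_nonempty h.bot_ne_top)
        (hcrit.bot.trans hcrit.desc)]
      exact ⟨c, hcrit⟩
  · have h1 := (hs p hp).merge_mapC hp.2.2.1 hp.2.2.2.1
    have h2 := (hs p' hp').merge_mapC hp'.2.2.1 hp'.2.2.2.1
    exact (hs p hp).mapA_injective (hs p' hp') (hp.2.1.trans hp'.2.1.symm)
      (h1.left_unique (h ▸ h2))
  · obtain ⟨h1, h2, h3, h4, h5⟩ := hq
    rw [mem_RTrees] at h1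
    have hne : (children q ⊤).Nonempty := Finset.card_pos.1 (by rw [← deg]; omega)
    rw [bot_lt_lowerCritical h1.1.1 hne h4] at h5
    obtain ⟨t, ht⟩ := exists_merge_left h1.1 (IsDesc.refl q ⊤) h5
    obtain ⟨r, c, g1, g2, g3, hq⟩ := id ht
    have hdt := g2.deg_father_move g1
    rw [← hq] at hdt
    obtain ⟨p, hp, hpm, rfl⟩ := exists_swingable g1.good g1.bot_ne_top (by
      rw [← g2.deg_bot_move g1, ← hq, h2]) hm (m := m) (by omega)
    -- The merge took one child from ⊤, so t has at least m + 2 of them, and two remain in p.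
    rw [hp.deg_top_mapA, hpm] at hdt
    have hbt : IsDesc p ⊥ ⊤ := hp.isDesc_bot_mapA.1 (g1.bot.trans g1.desc)
    have hd : 2 ≤ deg p ⊤ := by omega
    refine ⟨p, ⟨mem_RTrees.2 ⟨hp.good, ?_⟩, hpm, hbt, hd, hp.lt⟩,
      (hp.merge_mapC hbt hd).right_unique ht⟩
    have := ht.improperCount
    rw [h1.2, hp.improperCount_mapA, hpm] at this
    omega

end BijAC

/-! ### Chains of merges at a fixed node. -/

section Cut

variable {V : Type*} [Fintype V] [LinearOrder V] [BoundedOrder V] {p q t : V → V}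
  {w r c u x y z : V} {k d : ℕ}

open Classical in
/-- Cut the path from `w` to `⊥` below each critical node, and join the pieces to `w`. -/
noncomputable def cutCritical (w : V) (p : V → V) : V → V :=
  moveSubtrees p (Finset.univ.filter fun z => IsDesc p ⊥ z ∧ IsCritical p w (p z)) w

theorem cutCritical_of (h : IsDesc p ⊥ z ∧ IsCritical p w (p z)) : cutCritical w p z = w :=
  moveSubtrees_of_mem (by simpa using h)

theorem cutCritical_of_not (h : ¬ (IsDesc p ⊥ z ∧ IsCritical p w (p z))) :
    cutCritical w p z = p z :=
  moveSubtrees_of_notMem (by simpa using h)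

theorem cutCritical_eq_self (h : ∀ u, ¬ IsCritical p w u) : cutCritical w p = p :=
  funext fun _ => cutCritical_of_not fun h' => h _ h'.2

/-- The only new cut is the one below c, and it sends r back to w; all other cuts are the same in p
and q. Hence `cutCritical` is constant along a chain of merges. -/
theorem Merge.cutCritical_eq (h : Merge w p q) : cutCritical w q = cutCritical w p := by
  obtain ⟨r, c, h1, h2, h3, rfl⟩ := h
  have hatt := h2.attachable_move h1
  have hpr : p r = w := (mem_children.1 h1.mem).1
  have hqr : moveSubtrees p {r} c r = c := moveSubtrees_of_mem (Finset.mem_singleton_self r)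
  funext z
  by_cases hzr : z = r
  · subst hzr
    rw [cutCritical_of ⟨hatt.bot, hqr.symm ▸ h2.isCritical_move h1⟩]
    by_cases h : IsDesc p ⊥ z ∧ IsCritical p w (p z)
    · rw [cutCritical_of h]
    · rw [cutCritical_of_not h, hpr]
  · have hqz : moveSubtrees p {r} c z = p z := moveSubtrees_of_notMem (by simpa using hzr)
    have key : (IsDesc (moveSubtrees p {r} c) ⊥ z ∧
        IsCritical (moveSubtrees p {r} c) w (moveSubtrees p {r} c z)) ↔
        (IsDesc p ⊥ z ∧ IsCritical p w (p z)) := by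
      have hin : IsCritical p w (p z) →
          (IsDesc (moveSubtrees p {r} c) ⊥ z ↔ IsDesc p ⊥ z) := fun hu =>
        h2.isDesc_of_inside h1
          ((isDesc_father p z).trans (h2.isCritical_of_isCritical h1 hu).1)
      rw [hqz, isCritical_move_iff h1 h2 h3]
      constructor
      · rintro ⟨hb, hc | hc⟩
        · refine absurd (children_eq_of_isDesc (h2.tree h1) (x := c)
            (mem_children.2 ⟨hqz.trans hc, ?_⟩) hatt.mem hb hatt.bot) hzr
          rintro rfl
          exact h2.ne (h2.desc.eq_of_fixed hc)
        · exact ⟨(hin hc).1 hb, hc⟩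
      · exact fun ⟨hb, hc⟩ => ⟨(hin hc).2 hb, Or.inr hc⟩
    by_cases h : IsDesc p ⊥ z ∧ IsCritical p w (p z)
    · rw [cutCritical_of h, cutCritical_of (key.2 h)]
    · rw [cutCritical_of_not h, cutCritical_of_not (fun h' => h (key.1 h')), hqz]

open Classical in
/-- The number of critical nodes below `w`. -/
noncomputable def criticalCount (w : V) (p : V → V) : ℕ :=
  (Finset.univ.filter fun u => IsCritical p w u).card

/-- The measure that makes chains of merges finite in both directions. -/
theorem Merge.criticalCount_eq (h : Merge w p q) : criticalCount w q = criticalCount w p + 1 := by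
  classical
  obtain ⟨r, c, h1, h2, h3, rfl⟩ := h
  have hc : c ∉ Finset.univ.filter fun u => IsCritical p w u := by
    simp only [Finset.mem_filter, Finset.mem_univ, true_and]
    exact fun hc => h2.not_desc (h2.isCritical_of_isCritical h1 hc).1
  rw [criticalCount, criticalCount, ← Finset.card_insert_of_notMem hc]
  congr 1
  ext u
  simp [isCritical_move_iff h1 h2 h3]

/-- The properties of trees that are unchanged by merging below the critical node `w`. -/
structure CriticalState (w : V) (k d : ℕ) (p : V → V) : Prop where
  good : Good p
  critical : IsCritical p ⊤ w
  count : improperCount p = k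
  deg_top : deg p ⊤ = d
  deg_bot : deg p ⊥ = 0

/-- The move takes place inside T_w, so neither T_w nor T_⊤ changes as a set of nodes. -/
theorem AttachNode.isCritical_top_iff (h : Attachable p w r) (hc : AttachNode p w r c) :
    IsCritical (moveSubtrees p {r} c) ⊤ w ↔ IsCritical p ⊤ w := by
  refine ⟨fun hw => ?_, hc.isCritical_top h⟩
  refine ⟨(hc.isDesc_of_above h (IsDesc.refl p w)).1 hw.bot, h.top, hw.ne, hw.ne_bot,
    fun z hz hn => hw.lt z ((hc.isDesc_of_above h h.top).2 hz) ?_⟩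
  rwa [hc.isDesc_of_above h (IsDesc.refl p w)]

theorem Merge.criticalState_iff (h : Merge w p q) :
    CriticalState w k d p ↔ CriticalState w k d q := by
  obtain ⟨r, c, h1, h2, h3, rfl⟩ := h
  have e1 := h2.improperCount_move h1
  have e2 := h2.isCritical_top_iff h1
  have e3 := h2.deg_bot_move h1
  have e4 : IsCritical p ⊤ w → deg (moveSubtrees p {r} c) ⊤ = deg p ⊤ := fun hw =>
    h2.deg_move h1 hw.ne.symm (h2.ne_top h1).symm
  constructor
  · rintro ⟨_, a2, a3, a4, a5⟩
    exact ⟨h2.good_move h1, e2.2 a2, e1.trans a3, (e4 a2).trans a4, e3.trans a5⟩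
  · rintro ⟨_, a2, a3, a4, a5⟩
    have a2 := e2.1 a2
    exact ⟨h1.good, a2, e1.symm.trans a3, (e4 a2).symm.trans a4, e3.symm.trans a5⟩

theorem criticalState_iff_of_chain (h : Relation.ReflTransGen (Merge w) q t) :
    CriticalState w k d q ↔ CriticalState w k d t := by
  induction h with
  | refl => exact Iff.rfl
  | tail _ h ih => exact ih.trans h.criticalState_iff

theorem cutCritical_eq_of_chain (h : Relation.ReflTransGen (Merge w) q t) :
    cutCritical w t = cutCritical w q := by
  induction h with
  | refl => rfl
  | tail _ h ih => exact h.cutCritical_eq.trans ih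

theorem exists_chain_to (ht : CriticalState w k d t) :
    ∃ q, Relation.ReflTransGen (Merge w) q t ∧ ∀ u, ¬ IsCritical q w u := by
  classical
  induction hn : criticalCount w t generalizing t with
  | zero =>
    refine ⟨t, Relation.ReflTransGen.refl, fun u hu => ?_⟩
    rw [criticalCount, Finset.card_eq_zero] at hn
    exact Finset.notMem_empty u (hn ▸ Finset.mem_filter.2 ⟨Finset.mem_univ u, hu⟩)
  | succ n ih =>
    obtain ⟨u, hu⟩ : ∃ u, IsCritical t w u := by
      by_contra! hcon
      simp [criticalCount, hcon] at hn
    obtain ⟨s, hs⟩ := exists_merge_left ht.good ht.critical.desc ⟨u, hu⟩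
    obtain ⟨q, hq, hq'⟩ := ih (hs.criticalState_iff.2 ht) (by
      have := hs.criticalCount_eq
      omega)
    exact ⟨q, hq.tail hs, hq'⟩

theorem exists_chain_from (q : V → V) :
    ∃ t, Relation.ReflTransGen (Merge w) q t ∧ ∀ s, ¬ Merge w t s := by
  classical
  induction hn : Fintype.card V - criticalCount w q generalizing q with
  | zero =>
    refine ⟨q, Relation.ReflTransGen.refl, fun s hs => ?_⟩
    have h1 := hs.criticalCount_eq
    have h2 : criticalCount w s ≤ Fintype.card V := Finset.card_le_univ _
    omega
  | succ n ih =>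
    by_cases h : ∃ s, Merge w q s
    · obtain ⟨s, hs⟩ := h
      obtain ⟨t, ht, ht'⟩ := ih s (by
        have := hs.criticalCount_eq
        omega)
      exact ⟨t, ht.head hs, ht'⟩
    · exact ⟨q, Relation.ReflTransGen.refl, not_exists.1 h⟩

/-- Merging is deterministic, so of two chains from q one continues the other, and neither end can
be continued. -/
theorem chain_unique {t' : V → V} (h : Relation.ReflTransGen (Merge w) q t)
    (h' : Relation.ReflTransGen (Merge w) q t') (ht : ∀ s, ¬ Merge w t s)
    (ht' : ∀ s, ¬ Merge w t' s) : t = t' := by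
  have hu : Relator.RightUnique (Merge w) := fun _ _ _ h1 h2 => h1.right_unique h2
  rcases Relation.ReflTransGen.total_of_right_unique hu h h' with h | h
  · rcases h.cases_head with h | ⟨s, hs, -⟩
    · exact h
    · exact absurd hs (ht s)
  · rcases h.cases_head with h | ⟨s, hs, -⟩
    · exact h.symm
    · exact absurd hs (ht' s)

theorem IsCritical.below {w' : V} (h : IsCritical q ⊤ w) (hd : IsDesc q w w') (hne : w ≠ w') :
    IsCritical q w' w := ⟨h.bot, hd, hne, h.ne_bot, h.lt⟩

theorem IsCritical.trans (hq : IsRootedTree q) (h : IsCritical q w u) (hw : IsDesc q w ⊤) :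
    IsCritical q ⊤ u :=
  ⟨h.bot, h.desc.trans hw, fun he => h.ne (h.desc.antisymm hq (he ▸ hw)), h.ne_bot, h.lt⟩

/-- Critical labels decrease down the path to ⊥, so the critical node with the least label is the
lowest. -/
theorem exists_lowest_critical (hq : IsRootedTree q) (h : ∃ w, IsCritical q ⊤ w) :
    ∃ w, IsCritical q ⊤ w ∧ ∀ u, ¬ IsCritical q w u := by
  classical
  obtain ⟨w0, hw0⟩ := h
  obtain ⟨w, hw, hmin⟩ := Finset.exists_min_image (Finset.univ.filter fun u => IsCritical q ⊤ u) id
    ⟨w0, by simpa using hw0⟩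
  simp only [Finset.mem_filter, Finset.mem_univ, true_and, id_eq] at hw hmin
  refine ⟨w, hw, fun u hu => ?_⟩
  have h1 := hmin u (hu.trans hq hw.desc)
  exact absurd (hu.lt w hw.desc fun h => hu.ne (hu.desc.antisymm hq h)) (not_lt.2 h1)

end Cut

/-! ### The map (d) as the undoing of all merges at β*. -/

section Regraft

variable {V : Type*} [Fintype V] [LinearOrder V] [BoundedOrder V] {p q t : V → V}
  {w r c u x y z : V}

theorem betaStar_ne_bot (hp : IsRootedTree p) (h : (children p ⊥).Nonempty) : betaStar p ≠ ⊥ := by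
  obtain ⟨a, ha, hβ⟩ := exists_beta_eq_betaStar h
  intro he
  exact not_isDesc_of_mem_children hp ha (he ▸ hβ ▸ isDesc_beta p a)

namespace Swingable

variable (hp : Swingable p) (hr : children p ⊤ = {r}) (hbt : IsDesc p ⊥ ⊤)
include hp hr hbt

theorem only_mem : r ∈ children p ⊤ := hr ▸ Finset.mem_singleton_self r

theorem only_bot : IsDesc p ⊥ r := by
  obtain ⟨c, hc, hd⟩ := hbt.exists_mem_children hp.bot_ne_top
  rw [hr, Finset.mem_singleton] at hc
  exact hc ▸ hd

theorem only_attachable : Attachable (mapA p) ⊤ r :=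
  hp.attachable_mapA (hp.only_mem hr hbt) (hp.only_bot hr hbt)

omit hr hbt in
theorem below_betaStar : Below p (children p ⊥) (betaStar p) := by
  obtain ⟨s, hs, hβ⟩ := exists_beta_eq_betaStar hp.nonempty
  exact ⟨s, hs, hβ ▸ isDesc_beta p s⟩

omit hr hbt in
theorem betaStar_le_of_below (hz : Below p (children p ⊥) z) : betaStar p ≤ z := by
  obtain ⟨s, hs, hd⟩ := hz
  exact (betaStar_le_beta hs).trans (beta_le hd)

omit hr hbt in
theorem betaStar_le (hz : IsDesc (mapA p) z (betaStar p)) : betaStar p ≤ z := by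
  rcases hp.isDesc_mapA.1 hz with h | h
  · exact hp.betaStar_le_of_below (hp.below_betaStar.mono h.1)
  · exact absurd (hp.below_betaStar.mono h.2) hp.not_below_top

/-- When r was the only child of ⊤, the rest of T_⊤ after `mapA` is ⊤ together with the moved
subtrees, whose minimum is β*. This attach node need not be the highest one, so the move is not in
general a merge at ⊤. -/
theorem only_attachNode : AttachNode (mapA p) ⊤ r (betaStar p) where
  desc := hp.isDesc_mapA_top (Or.inr hp.below_betaStar)
  ne h := hp.not_below_top (h ▸ hp.below_betaStar)
  not_desc := hp.not_isDesc_mapA_of_below hp.below_betaStar (hp.only_mem hr hbt)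
    (hp.only_bot hr hbt)
  lt z hz hn hzr := by
    by_cases hb : Below p (children p ⊥) z
    · refine lt_of_le_of_ne (hp.betaStar_le_of_below hb) ?_
      rintro rfl
      exact hn (IsDesc.refl _ _)
    · rw [hp.isDesc_mapA_of_not_below hb] at hz hzr
      by_cases hzt : z = ⊤
      · rw [hzt]
        exact lt_top_iff_ne_top.2 fun h => hp.not_below_top (h ▸ hp.below_betaStar)
      · obtain ⟨c, hc, hd⟩ := hz.exists_mem_children hzt
        rw [hr, Finset.mem_singleton] at hc
        exact absurd (hc ▸ hd) hzr

/-- An attach node below β* and outside T_r would have to be smaller than β*, which is the least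
node there. -/
theorem attach_terminal (s : V → V) :
    ¬ Merge (betaStar p) (moveSubtrees (mapA p) {r} (betaStar p)) s := by
  have h1 := hp.only_attachable hr hbt
  have h2 := hp.only_attachNode hr hbt
  have h3 := h2.attachable_move h1
  rintro ⟨r', c, g1, g2, -, -⟩
  obtain rfl := h3.unique g1
  have hcr := g2.not_desc
  rw [h2.isDesc_of_inside h1 (IsDesc.refl _ r)] at hcr
  have hcw := g2.desc
  rw [h2.isDesc_of_outside h1 hcr] at hcw
  have hlt := g2.lt _ h3.top
    (fun h => g2.ne (g2.desc.antisymm (h2.tree h1) h)) h3.not_father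
  exact absurd (hp.betaStar_le hcw) (not_le.2 hlt)

omit hr hbt in
theorem firstChildOfBot_spec :
    firstChildOfBot p ∈ children p ⊥ ∧ beta p (firstChildOfBot p) = betaStar p := by
  obtain ⟨h1, h2⟩ := argminBeta_spec (p := p) hp.nonempty
  obtain ⟨s, hs, hβ⟩ := exists_beta_eq_betaStar hp.nonempty
  exact ⟨h1, le_antisymm (hβ ▸ h2 s hs) (betaStar_le_beta h1)⟩

omit hr hbt in
theorem not_below_erase (hz : ¬ Below p (children p ⊥) z) :
    ¬ Below p ((children p ⊥).erase (firstChildOfBot p)) z := by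
  rintro ⟨s, hs, h⟩
  exact hz ⟨s, Finset.mem_of_mem_erase hs, h⟩

omit hr hbt in
theorem isDesc_keepFirst_of_not_below (hz : ¬ Below p (children p ⊥) z) :
    IsDesc (keepFirst p) z x ↔ IsDesc p z x :=
  isDesc_move_of_not_below hp.good.1 (hp.not_below_erase hz)

omit hr hbt in
theorem keepFirst_of_mem (hz : z ∈ children p ⊥) (hne : z ≠ firstChildOfBot p) :
    keepFirst p z = ⊤ :=
  moveSubtrees_of_mem (Finset.mem_erase.2 ⟨hne, hz⟩)

omit hp hr hbt in
theorem keepFirst_of_notMem (hz : z ∉ children p ⊥) : keepFirst p z = p z :=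
  moveSubtrees_of_notMem fun h => hz (Finset.mem_of_mem_erase h)

omit hr hbt in
theorem betaStar_keepFirst : betaStar (keepFirst p) = betaStar p := by
  obtain ⟨h1, h2⟩ := hp.firstChildOfBot_spec
  have hch : children (keepFirst p) ⊥ = {firstChildOfBot p} := by
    ext y
    rw [Finset.mem_singleton, mem_children]
    by_cases hy : y ∈ children p ⊥
    · by_cases hya : y = firstChildOfBot p
      · simp only [hya, iff_true]
        rw [mem_children] at h1
        refine ⟨?_, h1.2⟩
        rw [keepFirst, moveSubtrees_of_notMem (Finset.notMem_erase _ _), h1.1]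
      · rw [hp.keepFirst_of_mem hy hya]
        simp [hya, hp.bot_ne_top.symm]
    · rw [keepFirst_of_notMem hy]
      constructor
      · exact fun h => absurd (mem_children.2 h) hy
      · rintro rfl
        exact absurd h1 hy
  rw [betaStar, hch, Finset.inf_singleton, ← h2]
  refine beta_congr fun z => ?_
  rw [keepFirst, isDesc_move hp.good.1 (hp.not_below_erase hp.not_below_top)]
  constructor
  · rintro (h | h)
    · exact h.1
    · exact absurd ⟨_, h1, h.2⟩ hp.not_below_top
  · exact fun h => Or.inl ⟨h, fun s hs _ h' => children_eq_of_isDesc hp.good.1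
      (Finset.mem_of_mem_erase hs) h1 (IsDesc.refl p s) h'⟩

theorem onlyChildOfTop_eq : onlyChildOfTop p = r := by
  have h : onlyChildOfTop p ∈ children p ⊤ :=
    Classical.epsilon_spec (p := fun b => b ∈ children p ⊤) ⟨r, hp.only_mem hr hbt⟩
  rwa [hr, Finset.mem_singleton] at h

/-- Outside T_r every node of T_⊤ in the attached tree is at least β*. So u < β*, together with
minimality against T_r - T_u, already makes u smaller than all of T_⊤ - T_u: cut nodes with a
continuation are exactly critical nodes below β*. -/
theorem cut_iff (hzr : z ≠ r) (hzS : z ∉ children p ⊥) :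
    (OnPath (keepFirst p) r ⊥ z ∧ IsCutNode (keepFirst p) r (betaStar p) (p z)) ↔
      (IsDesc (moveSubtrees (mapA p) {r} (betaStar p)) ⊥ z ∧
        IsCritical (moveSubtrees (mapA p) {r} (betaStar p)) (betaStar p) (p z)) := by
  have h1 := hp.only_attachable hr hbt
  have h2 := hp.only_attachNode hr hbt
  have h3 := h2.attachable_move h1
  have hrm := hp.only_mem hr hbt
  have hrb := hp.only_bot hr hbt
  have hbb : ¬ Below p (children p ⊥) ⊥ := not_below_children_self hp.good.1
  have hnb : ∀ {x}, IsDesc p ⊥ x → ¬ Below p (children p ⊥) x := fun h h' => hbb (h'.mono h)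
  have htz : moveSubtrees (mapA p) {r} (betaStar p) z = p z := by
    rw [moveSubtrees_of_notMem (by simpa using hzr), mapA, moveSubtrees_of_notMem hzS]
  have htr : ∀ {z}, IsDesc (moveSubtrees (mapA p) {r} (betaStar p)) z r ↔ IsDesc (mapA p) z r :=
    h2.isDesc_of_inside h1 (IsDesc.refl _ r)
  have hnbr : ∀ {z}, IsDesc (mapA p) z r → ¬ Below p (children p ⊥) z := fun h h' =>
    hp.not_isDesc_mapA_of_below h' hrm hrb h
  constructor
  · rintro ⟨hz, hu, hrest, hlt⟩
    have hbz : IsDesc p ⊥ z := (hp.isDesc_keepFirst_of_not_below hbb).1 hz.2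
    have hbu : IsDesc p ⊥ (p z) := hbz.trans (isDesc_father p z)
    have hzr' : IsDesc (mapA p) z r := (hp.isDesc_mapA_of_not_below (hnb hbz)).2
      ((hp.isDesc_keepFirst_of_not_below (hnb hbz)).1 hz.1)
    have hur : IsDesc (mapA p) (p z) r := (hp.isDesc_mapA_of_not_below (hnb hbu)).2
      ((hp.isDesc_keepFirst_of_not_below (hnb hbu)).1 hu.1)
    refine ⟨(h2.isDesc_of_inside h1 hzr').2 (hp.isDesc_bot_mapA.2 hbz),
      (h2.isDesc_of_inside h1 hur).2 (hp.isDesc_bot_mapA.2 hbu), (htr.2 hur).trans h3.desc, ?_, ?_,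
      fun x hx hn => ?_⟩
    · intro he
      exact h2.not_desc (he ▸ hur)
    · intro he
      by_cases hzb : z = ⊥
      · exact hp.good.not_isDesc_top_bot hp.bot_ne_top
          (hp.good.1.isDesc_of_fixed (hzb ▸ he) ⊤)
      · exact hzS (mem_children.2 ⟨he, hzb⟩)
    · rw [h2.isDesc_of_above h1 h1.top] at hx
      rw [h2.isDesc_of_inside h1 hur] at hn
      by_cases hxr : IsDesc (mapA p) x r
      · have hxb := hnbr hxr
        rw [hp.isDesc_mapA_of_not_below hxb] at hxr hn
        refine hrest x (mem_subtree.2 ((hp.isDesc_keepFirst_of_not_below hxb).2 hxr)) fun h => hn ?_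
        exact (hp.isDesc_keepFirst_of_not_below hxb).1 (mem_subtree.1 h)
      · by_cases hxw : IsDesc (mapA p) x (betaStar p)
        · exact hlt.trans_le (hp.betaStar_le hxw)
        · exact hlt.trans (h2.lt x hx hxw hxr)
  · rintro ⟨hbz, hu⟩
    have hur : IsDesc (mapA p) (p z) r := by
      rw [← htr]
      rcases h3.bot.of_mem_children_of_ne h3.mem hu.bot with h | h
      · exact h
      · exact absurd (hu.desc.antisymm (h2.tree h1) h) hu.ne
    have hzr' : IsDesc (mapA p) z r := by
      refine IsDesc.trans ?_ hur
      have := isDesc_father (mapA p) z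
      rwa [mapA, moveSubtrees_of_notMem hzS] at this
    have hzb := hnbr hzr'
    have hub := hnbr hur
    have hlt : p z < betaStar p := hu.lt _ h3.top
      fun h => hu.ne (hu.desc.antisymm (h2.tree h1) h)
    rw [h2.isDesc_of_inside h1 hzr', hp.isDesc_bot_mapA] at hbz
    refine ⟨⟨?_, ?_⟩, ⟨?_, ?_⟩, fun x hx hn => ?_, hlt⟩
    · rwa [hp.isDesc_keepFirst_of_not_below hzb, ← hp.isDesc_mapA_of_not_below hzb]
    · rwa [hp.isDesc_keepFirst_of_not_below hbb]
    · rwa [hp.isDesc_keepFirst_of_not_below hub, ← hp.isDesc_mapA_of_not_below hub]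
    · rw [hp.isDesc_keepFirst_of_not_below hbb]
      exact hbz.trans (isDesc_father p z)
    · rw [mem_subtree] at hx hn
      by_cases hxb : Below p (children p ⊥) x
      · exact hlt.trans_le (hp.betaStar_le_of_below hxb)
      · rw [hp.isDesc_keepFirst_of_not_below hxb, ← hp.isDesc_mapA_of_not_below hxb] at hx hn
        refine hu.lt x ((htr.2 hx).trans (h3.desc.trans h3.top)) ?_
        rwa [h2.isDesc_of_inside h1 hur]

/-- The root of T_{a₁} ends up below ⊤ on both sides: `regraft` puts it in the place of r, while
`mapA` moves it along with its siblings. The root r joins β*, and the remaining edges are settled by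
`cut_iff`. -/
theorem mapD_eq :
    mapD p = cutCritical (betaStar p) (moveSubtrees (mapA p) {r} (betaStar p)) := by
  obtain ⟨ha, -⟩ := hp.firstChildOfBot_spec
  have hrm := hp.only_mem hr hbt
  have hrb := hp.only_bot hr hbt
  have hrS := Finset.disjoint_left.1 hp.disjoint_children hrm
  have hra : r ≠ firstChildOfBot p := fun h => hrS (h ▸ ha)
  have h1 := hp.only_attachable hr hbt
  have h2 := hp.only_attachNode hr hbt
  have hbb : ¬ Below p (children p ⊥) ⊥ := not_below_children_self hp.good.1
  have hkr : keepFirst p r = ⊤ := by rw [keepFirst_of_notMem hrS, (mem_children.1 hrm).1]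
  have htop : ∀ {z}, z ∈ children p ⊥ →
      cutCritical (betaStar p) (moveSubtrees (mapA p) {r} (betaStar p)) z = ⊤ := by
    intro z hz
    have hzr : z ≠ r := fun h => hrS (h ▸ hz)
    have htz : moveSubtrees (mapA p) {r} (betaStar p) z = ⊤ := by
      rw [moveSubtrees_of_notMem (by simpa using hzr), mapA, moveSubtrees_of_mem hz]
    rw [cutCritical_of_not, htz]
    rw [htz]
    rintro ⟨-, hu⟩
    exact hu.ne (hu.desc.antisymm (h2.tree h1) (h2.attachable_move h1).top)
  funext z
  rw [mapD, hp.onlyChildOfTop_eq hr hbt, hp.betaStar_keepFirst, regraft]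
  by_cases hza : z = firstChildOfBot p
  · rw [if_pos hza, hkr, if_neg (mem_children.1 hrm).2.symm, htop (hza ▸ ha)]
  rw [if_neg hza]
  by_cases hzS : z ∈ children p ⊥
  · rw [htop hzS, hp.keepFirst_of_mem hzS hza, if_neg]
    rintro ⟨hz, -⟩
    have hzr : z ≠ r := fun h => hrS (h ▸ hzS)
    have := hz.1.father hzr
    rw [hp.keepFirst_of_mem hzS hza, hp.isDesc_keepFirst_of_not_below hp.not_below_top] at this
    exact not_isDesc_of_mem_children hp.good.1 hrm this
  by_cases hzr : z = r
  · subst hzr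
    have htz : moveSubtrees (mapA p) {z} (betaStar p) z = betaStar p :=
      moveSubtrees_of_mem (Finset.mem_singleton_self z)
    rw [if_pos ⟨⟨IsDesc.refl _ _, (hp.isDesc_keepFirst_of_not_below hbb).2 hrb⟩, Or.inl rfl⟩]
    by_cases h : IsDesc (moveSubtrees (mapA p) {z} (betaStar p)) ⊥ z ∧
        IsCritical (moveSubtrees (mapA p) {z} (betaStar p)) (betaStar p)
          (moveSubtrees (mapA p) {z} (betaStar p) z)
    · rw [cutCritical_of h]
    · rw [cutCritical_of_not h, htz]
  · have htz : moveSubtrees (mapA p) {r} (betaStar p) z = p z := by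
      rw [moveSubtrees_of_notMem (by simpa using hzr), mapA, moveSubtrees_of_notMem hzS]
    have key := hp.cut_iff hr hbt hzr hzS
    rw [keepFirst_of_notMem hzS]
    by_cases h : OnPath (keepFirst p) r ⊥ z ∧ IsCutNode (keepFirst p) r (betaStar p) (p z)
    · rw [if_pos ⟨h.1, Or.inr h.2⟩, cutCritical_of (by rw [htz]; exact key.1 h)]
    · rw [if_neg fun h' => h ⟨h'.1, h'.2.resolve_left hzr⟩,
        cutCritical_of_not (by rw [htz]; exact fun h' => h (key.2 h')), htz]

theorem criticalState_attach :
    CriticalState (betaStar p) (improperCount p + deg p ⊥) (deg p ⊥)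
      (moveSubtrees (mapA p) {r} (betaStar p)) := by
  have h1 := hp.only_attachable hr hbt
  have h2 := hp.only_attachNode hr hbt
  refine ⟨h2.good_move h1, h2.isCritical_move h1, ?_, ?_, ?_⟩
  · rw [h2.improperCount_move h1, hp.improperCount_mapA]
  · have := h2.deg_father_move h1
    have hd : deg p ⊤ = 1 := by rw [deg, hr, Finset.card_singleton]
    rw [hp.deg_top_mapA] at this
    omega
  · rw [h2.deg_bot_move h1, hp.deg_bot_mapA]

/-- Undoing merges at β* from the attached tree ends in a tree without critical nodes below β*; such
a tree is its own `cutCritical`, and cutting is invariant along the chain. -/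
theorem chain_mapD :
    Relation.ReflTransGen (Merge (betaStar p)) (mapD p)
      (moveSubtrees (mapA p) {r} (betaStar p)) ∧ ∀ u, ¬ IsCritical (mapD p) (betaStar p) u := by
  obtain ⟨q, hq, hq'⟩ := exists_chain_to (hp.criticalState_attach hr hbt)
  have : mapD p = q := by
    rw [hp.mapD_eq hr hbt, cutCritical_eq_of_chain hq, cutCritical_eq_self hq']
  rw [this]
  exact ⟨hq, hq'⟩

theorem criticalState_mapD :
    CriticalState (betaStar p) (improperCount p + deg p ⊥) (deg p ⊥) (mapD p) :=
  (criticalState_iff_of_chain (hp.chain_mapD hr hbt).1).2 (hp.criticalState_attach hr hbt)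

end Swingable

theorem swingable_of_deg_top_eq_one (hp : Good p) (hne : (children p ⊥).Nonempty)
    (hbt : IsDesc p ⊥ ⊤) (hr : children p ⊤ = {r}) : Swingable p := by
  have hbr : IsDesc p ⊥ r := by
    obtain ⟨c, hc, hd⟩ := hbt.exists_mem_children (ne_of_children_bot_nonempty hne)
    rw [hr, Finset.mem_singleton] at hc
    exact hc ▸ hd
  refine ⟨hp, hne, ?_⟩
  rw [alpha, hr, Finset.sup_singleton, le_bot_iff.1 (beta_le hbr)]
  exact bot_lt_iff_ne_bot.2 (betaStar_ne_bot hp.1 hne)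

end Regraft

/-! ### The bijection (d). -/

section BijD

variable {n k m : ℕ} [NeZero n] {p q : Fin n → Fin n}

theorem bijOn_mapD (hm : 1 ≤ m) : Set.BijOn mapD (sourceD n k m) (targetD n k m) := by
  have hs : ∀ p ∈ sourceD n k m, ∃ r, children p ⊤ = {r} ∧ Swingable p := fun p hp => by
    obtain ⟨r, hr⟩ := Finset.card_eq_one.1 hp.2.2.2
    exact ⟨r, hr, swingable_of_deg_top_eq_one (mem_RTrees.1 hp.1).1 (nonempty_of_deg hm hp.2.1)
      hp.2.2.1 hr⟩
  refine ⟨fun p hp => ?_, fun p hp p' hp' h => ?_, fun q hq => ?_⟩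
  · obtain ⟨r, hr, h⟩ := hs p hp
    obtain ⟨h1, h2, h3, h4, h5⟩ := h.criticalState_mapD hr hp.2.2.1
    have hbt := h2.bot.trans h2.desc
    refine ⟨mem_RTrees.2 ⟨h1, ?_⟩, h5, h4.trans hp.2.1, hbt, ?_⟩
    · rw [h3, (mem_RTrees.1 hp.1).2, hp.2.1]
    · rw [bot_lt_lowerCritical h1.1 (h1.children_top_nonempty h.bot_ne_top) hbt]
      exact ⟨_, h2⟩
  · obtain ⟨r, hr, h1⟩ := hs p hp
    obtain ⟨r', hr', h2⟩ := hs p' hp'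
    obtain ⟨a1, a2⟩ := h1.chain_mapD hr hp.2.2.1
    obtain ⟨b1, b2⟩ := h2.chain_mapD hr' hp'.2.2.1
    have a3 := (h1.criticalState_mapD hr hp.2.2.1).critical
    have b3 := (h2.criticalState_mapD hr' hp'.2.2.1).critical
    rw [← h] at b1 b2 b3
    -- Both nodes are critical in the common image and neither has a critical node below it; as both
    -- lie above ⊥, they are comparable.
    have hw : betaStar p = betaStar p' := by
      by_contra hne
      rcases a3.bot.total b3.bot with hd | hd
      · exact b2 _ (a3.below hd hne)
      · exact a2 _ (b3.below hd (Ne.symm hne))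
    have a4 := h1.attach_terminal hr hp.2.2.1
    have b4 := h2.attach_terminal hr' hp'.2.2.1
    have a5 := h1.only_attachable hr hp.2.2.1
    have b5 := h2.only_attachable hr' hp'.2.2.1
    have a6 := h1.only_attachNode hr hp.2.2.1
    have b6 := h2.only_attachNode hr' hp'.2.2.1
    rw [← hw] at b1 b4 b6
    have ht := chain_unique a1 b1 a4 b4
    have hrr : r = r' := (a6.attachable_move a5).unique (ht ▸ b6.attachable_move b5)
    subst hrr
    refine h1.mapA_injective h2 (hp.2.1.trans hp'.2.1.symm) ?_
    rw [← AttachNode.move_back a5 (c := betaStar p), ht, AttachNode.move_back b5]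
  · obtain ⟨h1, h2, h3, h4, h5⟩ := hq
    rw [mem_RTrees] at h1
    have hne : (children q ⊤).Nonempty := nonempty_of_deg hm h3
    rw [bot_lt_lowerCritical h1.1.1 hne h4] at h5
    obtain ⟨w, hw, hlow⟩ := exists_lowest_critical h1.1.1 h5
    have hst : CriticalState w (k + m) m q := ⟨h1.1, hw, h1.2, h3, h2⟩
    obtain ⟨t, hqt, hterm⟩ := exists_chain_from (w := w) q
    have hst' := (criticalState_iff_of_chain hqt).1 hst
    have hcut : cutCritical w t = q :=
      (cutCritical_eq_of_chain hqt).trans (cutCritical_eq_self hlow)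
    have hwt := hst'.critical
    obtain ⟨r, hr, hbr⟩ := hwt.bot.exists_mem_children hwt.ne_bot.symm
    obtain ⟨g1, g2, g3⟩ := AttachNode.of_isCritical hst'.good (IsDesc.refl t ⊤) hwt hr hbr
    have hatt := g2.attachable_move g1
    rw [g3] at hatt
    set t0 := moveSubtrees t {r} ⊤ with ht0
    have hd0 := g2.deg_father_move g1
    rw [g3, hst'.deg_top] at hd0
    obtain ⟨p, hp, hpm, hpt⟩ := exists_swingable g1.good g1.bot_ne_top (by
      rw [← g2.deg_bot_move g1, g3, hst'.deg_bot]) hm (m := m) (by omega)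
    have hd1 : deg p ⊤ = 1 := by
      have := hp.deg_top_mapA
      rw [hpt, hpm] at this
      omega
    have hbt : IsDesc p ⊥ ⊤ := by
      rw [← hp.isDesc_bot_mapA, hpt]
      exact g1.bot.trans g1.desc
    obtain ⟨b, hb⟩ := Finset.card_eq_one.1 hd1
    have hbr : b = r := (hp.only_attachable hb hbt).unique (hpt ▸ g1)
    subst hbr
    -- On one side, w lies below ⊤ outside T_b, hence in a moved subtree, since b is the only other
    -- child of ⊤. On the other side, either β* lies outside T_w, where w is smaller as an attach
    -- node, or β* < w inside T_w would allow one more merge.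
    have hβ : betaStar p = w := by
      have hB := hp.below_betaStar
      apply le_antisymm
      · refine hp.betaStar_le_of_below ?_
        by_contra hnb
        have hwd := g2.desc
        have hwr := g2.not_desc
        rw [← hpt, hp.isDesc_mapA_of_not_below hnb] at hwd hwr
        obtain ⟨c, hc, hd⟩ := hwd.exists_mem_children hwt.ne
        rw [hb, Finset.mem_singleton] at hc
        exact hwr (hc ▸ hd)
      · have hnr : ¬ IsDesc t0 (betaStar p) b := by
          rw [← hpt]
          exact hp.not_isDesc_mapA_of_below hB (hp.only_mem hb hbt) (hp.only_bot hb hbt)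
        have htop : IsDesc t0 (betaStar p) ⊤ := hpt ▸ hp.isDesc_mapA_top (Or.inr hB)
        by_cases hd : IsDesc t0 (betaStar p) w
        · by_contra! hlt
          have hd' : IsDesc t (betaStar p) w := by rwa [← g3, g2.isDesc_of_outside g1 hnr]
          have hnr' : ¬ IsDesc t (betaStar p) b := by
            rwa [← g3, g2.isDesc_of_inside g1 (IsDesc.refl _ _)]
          obtain ⟨s, hs⟩ := exists_merge hatt
            (exists_attachNode hatt hwt.lt hd' hnr' hlt)
          exact hterm s hs
        · exact (g2.lt _ htop hd hnr).le
    refine ⟨p, ⟨mem_RTrees.2 ⟨hp.good, ?_⟩, hpm, hbt, hd1⟩, ?_⟩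
    · have h := g2.improperCount_move g1
      rw [g3, hst'.count, ← hpt, hp.improperCount_mapA, hpm] at h
      omega
    · rw [hp.mapD_eq hb hbt, hβ, hpt, g3, hcut]

end BijD

/-! ### Exchanging two labels. -/

section Exchange

variable {V : Type*} {p g : V → V} {a x y z : V}

open Classical in
/-- The permutation of the labels that exchanges `x` and `y`. -/
noncomputable def labelSwap (x y : V) : Equiv.Perm V := Equiv.swap x y

open Classical in
theorem labelSwap_left (x y : V) : labelSwap x y x = y := Equiv.swap_apply_left x y

open Classical in
theorem labelSwap_right (x y : V) : labelSwap x y y = x := Equiv.swap_apply_right x y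

open Classical in
theorem labelSwap_of_ne (hx : z ≠ x) (hy : z ≠ y) : labelSwap x y z = z :=
  Equiv.swap_apply_of_ne_of_ne hx hy

open Classical in
theorem labelSwap_self (x y z : V) : labelSwap x y (labelSwap x y z) = z :=
  Equiv.swap_apply_self x y z

theorem exchangeLabels_apply :
    exchangeLabels p x y z = labelSwap x y (p (labelSwap x y z)) := rfl

theorem exchangeLabels_exchangeLabels : exchangeLabels (exchangeLabels p x y) x y = p := by
  funext z
  simp only [exchangeLabels_apply, labelSwap_self]

theorem isDesc_exchangeLabels {u v : V} :
    IsDesc (exchangeLabels p x y) u v ↔ IsDesc p (labelSwap x y u) (labelSwap x y v) := by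
  have h : ∀ j, (exchangeLabels p x y)^[j] u = labelSwap x y (p^[j] (labelSwap x y u)) := by
    intro j
    induction j with
    | zero => exact (labelSwap_self x y u).symm
    | succ j ih =>
      rw [Function.iterate_succ_apply', Function.iterate_succ_apply', ih, exchangeLabels_apply,
        labelSwap_self]
  refine exists_congr fun j => ?_
  rw [h]
  constructor
  · intro h
    rw [← h, labelSwap_self]
  · intro h
    rw [h, labelSwap_self]

theorem IsRootedTree.exchangeLabels (hp : IsRootedTree p) (x y : V) :
    IsRootedTree (exchangeLabels p x y) := by
  obtain ⟨r, hr, hd⟩ := hp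
  refine ⟨labelSwap x y r, ?_, fun z => ?_⟩
  · rw [exchangeLabels_apply, labelSwap_self, hr]
  · refine isDesc_exchangeLabels.2 ?_
    rw [labelSwap_self]
    exact hd _

/-- Exchanging two labels of a subtree. -/
theorem isDesc_labelSwap {u v : V} (hx : IsDesc p x v) (hy : IsDesc p y v) (hu : IsDesc p u v) :
    IsDesc p (labelSwap x y u) v := by
  by_cases h1 : u = x
  · rwa [h1, labelSwap_left]
  by_cases h2 : u = y
  · rwa [h2, labelSwap_right]
  rwa [labelSwap_of_ne h1 h2]

end Exchange

/-! ### The tree after the exchange of ⊤ and α. -/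

section ExchangeTop

variable {V : Type*} [Fintype V] [LinearOrder V] [BoundedOrder V] {p q g : V → V}
  {a b c s x y z : V}

theorem mem_children_exchangeLabels {x y u v : V} :
    u ∈ children (exchangeLabels p x y) v ↔ labelSwap x y u ∈ children p (labelSwap x y v) := by
  rw [mem_children, mem_children, exchangeLabels_apply]
  refine and_congr ?_ (not_congr (labelSwap x y).injective.eq_iff.symm)
  rw [← (labelSwap x y).injective.eq_iff, labelSwap_self]

theorem children_bot_exchangeLabels (hbt : (⊥ : V) ≠ ⊤) (ha : a ≠ ⊥) (h1 : ⊤ ∉ children p ⊥)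
    (h2 : a ∉ children p ⊥) : children (exchangeLabels p ⊤ a) ⊥ = children p ⊥ := by
  ext z
  rw [mem_children_exchangeLabels, labelSwap_of_ne hbt ha.symm]
  by_cases hz1 : z = ⊤
  · rw [hz1, labelSwap_left]
    exact iff_of_false h2 h1
  by_cases hz2 : z = a
  · rw [hz2, labelSwap_right]
    exact iff_of_false h1 h2
  rw [labelSwap_of_ne hz1 hz2]

/-- The trees obtained by exchanging the labels `⊤` and `a` in a tree with `α = a > β*` without
proper edge on the path from `⊤` to the root; `b` is the child of `a` above `⊤`. -/
structure ExchangedTree (g : V → V) (a b : V) : Prop where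
  tree : IsRootedTree g
  path : ∀ y, IsDesc g a y → g y ≠ y → IsImproperEdge g y
  mem : b ∈ children g a
  desc : IsDesc g ⊤ b
  lt : ∀ z, IsDesc g z b → a < z
  off : ∀ c ∈ children g a, ¬ IsDesc g ⊤ c → beta g c < a
  star : ∃ s ∈ children g ⊥, beta g s < a

/-- As α is the least label of T_b, after the exchange all labels below its father are larger. On
the path above ⊤, the subtrees contain both exchanged labels and the fathers are neither of them, so
improper edges persist. The other children of ⊤ have smaller β by the maximality of α. -/
theorem exchangedTree_of_source (hp : Good p) (hne : (children p ⊥).Nonempty)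
    (hlt : betaStar p < alpha p) :
    ⊤ ∉ children p ⊥ ∧ alpha p ∉ children p ⊥ ∧
      ∃ b, ExchangedTree (exchangeLabels p ⊤ (alpha p)) (alpha p) b := by
  have hbt := ne_of_children_bot_nonempty hne
  obtain ⟨b, hb, hβ⟩ := exists_beta_eq_alpha (hp.children_top_nonempty hbt)
  have hab : IsDesc p (alpha p) b := hβ ▸ isDesc_beta p b
  have hat : IsDesc p (alpha p) ⊤ := hab.trans (isDesc_of_mem_children hb)
  have ha0 : alpha p ≠ ⊥ := (bot_le.trans_lt hlt).ne'
  have hmin : ∀ z, IsDesc p z b → alpha p ≤ z := fun z hz => hβ ▸ beta_le hz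
  have hta : ¬ IsDesc p ⊤ (alpha p) := fun h => not_isDesc_of_mem_children hp.1 hb (h.trans hab)
  have hat' : alpha p < ⊤ := lt_top_iff_ne_top.2 fun h => hta (h ▸ IsDesc.refl p _)
  have h1 : ⊤ ∉ children p ⊥ := fun h =>
    hp.not_isDesc_top_bot hbt (isDesc_of_mem_children h)
  have h2 : alpha p ∉ children p ⊥ := by
    intro h
    by_cases he : alpha p = b
    · rw [he] at h
      exact hbt ((mem_children.1 h).1.symm.trans (mem_children.1 hb).1)
    · have := hab.father he
      rw [(mem_children.1 h).1] at this
      exact ha0 (le_bot_iff.1 (hmin _ this))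
  refine ⟨h1, h2, labelSwap ⊤ (alpha p) b, hp.1.exchangeLabels _ _, fun y hy hyne => ?_, ?_, ?_,
    fun z hz => ?_, fun c hc hcn => ?_, ?_⟩
  · rw [isDesc_exchangeLabels, labelSwap_right] at hy
    have hne' : p (labelSwap ⊤ (alpha p) y) ≠ labelSwap ⊤ (alpha p) y := by
      intro h
      rw [exchangeLabels_apply, h, labelSwap_self] at hyne
      exact hyne rfl
    obtain ⟨-, x, hx, hle⟩ := isImproperEdge_iff.1 (hp.2 _ hy hne')
    have hup := hy.trans (isDesc_father p (labelSwap ⊤ (alpha p) y))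
    have hf : exchangeLabels p ⊤ (alpha p) y = p (labelSwap ⊤ (alpha p) y) := by
      rw [exchangeLabels_apply, labelSwap_of_ne]
      · intro h
        exact not_isDesc_father hp.1 hne' (h.symm ▸ hy)
      · exact fun h => hta (h ▸ hup)
    refine isImproperEdge_iff.2 ⟨hyne, x, ?_, hf ▸ hle⟩
    rw [isDesc_exchangeLabels]
    exact isDesc_labelSwap hy (hat.trans hy) hx
  · rw [mem_children_exchangeLabels, labelSwap_self, labelSwap_right]
    exact hb
  · rwa [isDesc_exchangeLabels, labelSwap_self, labelSwap_left]
  · rw [isDesc_exchangeLabels, labelSwap_self] at hz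
    by_cases hzt : z = ⊤
    · exact hzt ▸ hat'
    by_cases hza : z = alpha p
    · rw [hza, labelSwap_right] at hz
      exact absurd hz (not_isDesc_of_mem_children hp.1 hb)
    rw [labelSwap_of_ne hzt hza] at hz
    exact lt_of_le_of_ne (hmin z hz) (Ne.symm hza)
  · rw [mem_children_exchangeLabels, labelSwap_right] at hc
    rw [isDesc_exchangeLabels, labelSwap_left] at hcn
    have hm : beta p (labelSwap ⊤ (alpha p) c) < alpha p := by
      refine lt_of_le_of_ne (beta_le_alpha hc) fun h => hcn ?_
      have hd := isDesc_beta p (labelSwap ⊤ (alpha p) c)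
      rwa [h] at hd
    refine lt_of_le_of_lt (beta_le ?_) hm
    rw [isDesc_exchangeLabels, labelSwap_of_ne (hm.trans hat').ne hm.ne]
    exact isDesc_beta p _
  · obtain ⟨s, hs, hsβ⟩ := exists_beta_eq_betaStar hne
    rw [children_bot_exchangeLabels hbt ha0 h1 h2]
    refine ⟨s, hs, lt_of_le_of_lt (beta_le ?_) hlt⟩
    rw [isDesc_exchangeLabels, labelSwap_of_ne (hlt.trans hat').ne hlt.ne, labelSwap_of_ne, ← hsβ]
    · exact isDesc_beta p s
    · rintro rfl
      exact h1 hs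
    · rintro rfl
      exact h2 hs

namespace ExchangedTree

variable (h : ExchangedTree g a b)
include h

theorem lt_top : a < ⊤ := h.lt _ h.desc

theorem top_desc : IsDesc g ⊤ a := h.desc.trans (isDesc_of_mem_children h.mem)

theorem not_desc_top : ¬ IsDesc g a ⊤ := fun h' =>
  not_isDesc_of_mem_children h.tree h.mem (h'.trans h.desc)

theorem ne_bot : a ≠ ⊥ := by
  obtain ⟨s, -, hs⟩ := h.star
  exact (bot_le.trans_lt hs).ne'

theorem bot_ne_top : (⊥ : V) ≠ ⊤ := (bot_le.trans_lt h.lt_top).ne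

theorem not_desc_bot : ¬ IsDesc g a ⊥ := by
  intro h'
  obtain ⟨c, hc, hd⟩ := h'.exists_mem_children h.ne_bot
  exact not_isImproperEdge_of_father_bot h.tree hc (h.path c hd (father_ne_of_mem_children hc))

theorem bot_not_desc : ¬ IsDesc g ⊥ b := fun h' => not_lt_bot (h.lt _ h')

theorem not_top_desc_bot : ¬ IsDesc g ⊤ ⊥ := fun h' =>
  (h.desc.of_mem_children_of_ne h.mem h').elim h.bot_not_desc h.not_desc_bot

theorem top_notMem : ⊤ ∉ children g ⊥ := fun h' =>
  h.not_top_desc_bot (isDesc_of_mem_children h')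

theorem notMem : a ∉ children g ⊥ := fun h' => h.not_desc_bot (isDesc_of_mem_children h')

theorem father_ne (hy : IsDesc g a y) (hne : g y ≠ y) : g y ≠ ⊤ ∧ g y ≠ a :=
  ⟨fun he => h.not_desc_top (he ▸ hy.trans (isDesc_father g y)),
    fun he => not_isDesc_father h.tree hne (he.symm ▸ hy)⟩

theorem good_exchangeLabels : Good (exchangeLabels g ⊤ a) := by
  refine ⟨h.tree.exchangeLabels _ _, fun y hy hyne => ?_⟩
  rw [isDesc_exchangeLabels, labelSwap_left] at hy
  have hne' : g (labelSwap ⊤ a y) ≠ labelSwap ⊤ a y := by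
    intro h
    rw [exchangeLabels_apply, h, labelSwap_self] at hyne
    exact hyne rfl
  obtain ⟨-, x, hx, hle⟩ := isImproperEdge_iff.1 (h.path _ hy hne')
  obtain ⟨f1, f2⟩ := h.father_ne hy hne'
  refine isImproperEdge_iff.2 ⟨hyne, x, ?_, ?_⟩
  · rw [isDesc_exchangeLabels]
    exact isDesc_labelSwap (h.top_desc.trans hy) hy hx
  · rwa [exchangeLabels_apply, labelSwap_of_ne f1 f2]

theorem alpha_exchangeLabels : alpha (exchangeLabels g ⊤ a) = a := by
  have hβ : beta (exchangeLabels g ⊤ a) (labelSwap ⊤ a b) = a := by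
    apply le_antisymm
    · refine beta_le (isDesc_exchangeLabels.2 ?_)
      rw [labelSwap_right, labelSwap_self]
      exact h.desc
    · refine le_beta.2 fun z hz => ?_
      rw [isDesc_exchangeLabels, labelSwap_self] at hz
      have hlt := h.lt _ hz
      by_cases hz1 : z = ⊤
      · exact hz1 ▸ le_top
      by_cases hz2 : z = a
      · exact hz2.ge
      rw [labelSwap_of_ne hz1 hz2] at hlt
      exact hlt.le
  apply le_antisymm
  · refine Finset.sup_le fun c hc => ?_
    rw [mem_children_exchangeLabels, labelSwap_left] at hc
    by_cases hd : IsDesc g ⊤ (labelSwap ⊤ a c)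
    · have hbc := children_eq_of_isDesc h.tree h.mem hc h.desc hd
      rw [hbc, labelSwap_self] at hβ
      exact hβ.le
    · have hm := h.off _ hc hd
      refine le_trans (beta_le ?_) hm.le
      rw [isDesc_exchangeLabels, labelSwap_of_ne (hm.trans h.lt_top).ne hm.ne]
      exact isDesc_beta g _
  · rw [← hβ]
    conv_rhs => rw [hβ]
    refine beta_le_alpha ?_
    rw [mem_children_exchangeLabels, labelSwap_self, labelSwap_left]
    exact h.mem

theorem children_bot_eq : children (exchangeLabels g ⊤ a) ⊥ = children g ⊥ :=
  children_bot_exchangeLabels h.bot_ne_top h.ne_bot h.top_notMem h.notMem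

theorem betaStar_lt : betaStar (exchangeLabels g ⊤ a) < a := by
  obtain ⟨s, hs, hlt⟩ := h.star
  refine ((betaStar_le_beta (h.children_bot_eq.symm ▸ hs)).trans (beta_le ?_)).trans_lt hlt
  rw [isDesc_exchangeLabels, labelSwap_of_ne (hlt.trans h.lt_top).ne hlt.ne, labelSwap_of_ne]
  · exact isDesc_beta g s
  · rintro rfl
    exact h.top_notMem hs
  · rintro rfl
    exact h.notMem hs

theorem not_below_top : ¬ Below g (children g ⊤) a := by
  rintro ⟨s, hs, hd⟩
  exact not_isDesc_of_mem_children h.tree hs (h.top_desc.trans hd)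

theorem tree_move : IsRootedTree (moveSubtrees g (children g ⊤) a) := h.tree.move h.not_below_top

theorem isDesc_move : IsDesc (moveSubtrees g (children g ⊤) a) z x ↔
    (IsDesc g z x ∧ ∀ s ∈ children g ⊤, IsDesc g z s → IsDesc g s x → s = x) ∨
      (Below g (children g ⊤) z ∧ IsDesc g a x) := _root_.isDesc_move h.tree h.not_below_top

theorem below_top (hb : Below g (children g ⊤) z) : IsDesc g z ⊤ ∧ z ≠ ⊤ := by
  obtain ⟨s, hs, hd⟩ := hb
  refine ⟨hd.trans (isDesc_of_mem_children hs), ?_⟩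
  rintro rfl
  exact not_isDesc_of_mem_children h.tree hs hd

theorem isDesc_of_isDesc_move (hd : IsDesc (moveSubtrees g (children g ⊤) a) z x) :
    IsDesc g z x := by
  rcases h.isDesc_move.1 hd with h1 | h1
  · exact h1.1
  · exact ((h.below_top h1.1).1.trans h.top_desc).trans h1.2

theorem isDesc_move_of_above (hx : IsDesc g a x) :
    IsDesc (moveSubtrees g (children g ⊤) a) z x ↔ IsDesc g z x := by
  refine ⟨h.isDesc_of_isDesc_move, fun hd => h.isDesc_move.2 ?_⟩
  by_cases hb : Below g (children g ⊤) z
  · exact Or.inr ⟨hb, hx⟩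
  · exact Or.inl ⟨hd, fun s hs h1 => absurd ⟨s, hs, h1⟩ hb⟩

theorem isDesc_move_of_not (hz : ¬ (IsDesc g z ⊤ ∧ z ≠ ⊤)) :
    IsDesc (moveSubtrees g (children g ⊤) a) z x ↔ IsDesc g z x :=
  isDesc_move_of_not_below h.tree fun hb => hz (h.below_top hb)

theorem isDesc_move_top :
    IsDesc (moveSubtrees g (children g ⊤) a) ⊤ x ↔ IsDesc g ⊤ x :=
  h.isDesc_move_of_not fun h' => h'.2 rfl

theorem isDesc_move_inside (hx : Below g (children g ⊤) x) :
    IsDesc (moveSubtrees g (children g ⊤) a) z x ↔ IsDesc g z x :=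
  isDesc_move_of_below h.tree (fun _ hs => mem_children.1 hs) h.not_below_top hx

theorem move_of_notMem (hz : z ∉ children g ⊤) : moveSubtrees g (children g ⊤) a z = g z :=
  moveSubtrees_of_notMem hz

theorem child_notMem : b ∉ children g ⊤ := fun h' =>
  h.lt_top.ne ((mem_children.1 h.mem).1.symm.trans (mem_children.1 h').1)

theorem notMem_of_above (hy : IsDesc g a y) : y ∉ children g ⊤ := fun hs =>
  h.not_below_top ⟨y, hs, hy⟩

/-- The node `a` is the father of the topmost proper edge on the path from `⊤`. -/
theorem topmost_proper :
    moveSubtrees g (children g ⊤) a b = a ∧ b ≠ a ∧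
      IsDesc (moveSubtrees g (children g ⊤) a) ⊤ b ∧
      (∀ z, IsDesc (moveSubtrees g (children g ⊤) a) z b → a < z) ∧
      ∀ y, IsDesc (moveSubtrees g (children g ⊤) a) a y → moveSubtrees g (children g ⊤) a y ≠ y →
        IsImproperEdge (moveSubtrees g (children g ⊤) a) y := by
  refine ⟨by rw [h.move_of_notMem h.child_notMem, (mem_children.1 h.mem).1], (mem_children.1 h.mem).2,
    h.isDesc_move_top.2 h.desc, fun z hz => h.lt z (h.isDesc_of_isDesc_move hz), fun y hy hne => ?_⟩
  have hy' := h.isDesc_of_isDesc_move hy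
  have hyC := h.notMem_of_above hy'
  rw [h.move_of_notMem hyC] at hne
  obtain ⟨-, x, hx, hle⟩ := isImproperEdge_iff.1 (h.path y hy' hne)
  rw [isImproperEdge_iff, h.move_of_notMem hyC]
  exact ⟨hne, x, (h.isDesc_move_of_above hy').2 hx, hle⟩

/-- The subtrees returned to a come from T_b, whose labels exceed a, while each other child of a off
the path has a label below a in its subtree. -/
theorem mem_children_top_iff : z ∈ children g ⊤ ↔
    z ∈ children (moveSubtrees g (children g ⊤) a) a ∧
      ¬ IsDesc (moveSubtrees g (children g ⊤) a) ⊤ z ∧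
      ∀ x, IsDesc (moveSubtrees g (children g ⊤) a) x z → a < x := by
  constructor
  · intro hz
    refine ⟨mem_children.2 ⟨moveSubtrees_of_mem hz, ?_⟩, ?_, fun x hx => h.lt x ?_⟩
    · rintro rfl
      exact h.notMem_of_above (IsDesc.refl g _) hz
    · rw [h.isDesc_move_top]
      exact not_isDesc_of_mem_children h.tree hz
    · exact ((h.isDesc_of_isDesc_move hx).trans (isDesc_of_mem_children hz)).trans h.desc
  · rintro ⟨h1, h2, h3⟩
    by_contra hz
    rw [mem_children, h.move_of_notMem hz] at h1
    rw [h.isDesc_move_top] at h2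
    have hza := mem_children.2 h1
    have hlt := h.off z hza h2
    refine lt_asymm hlt (h3 _ ((h.isDesc_move_of_not fun h4 => h2 ?_).2 (isDesc_beta g z)))
    rw [← children_eq_of_isDesc h.tree h.mem hza (h4.1.trans h.desc) (isDesc_beta g z)]
    exact h.desc

theorem children_bot_move :
    children (moveSubtrees g (children g ⊤) a) ⊥ = children g ⊥ := by
  ext y
  by_cases hy : y ∈ children g ⊤
  · rw [mem_children, mem_children, moveSubtrees_of_mem hy, (mem_children.1 hy).1]
    simp [h.ne_bot, h.bot_ne_top.symm]
  · rw [mem_children, mem_children, h.move_of_notMem hy]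

end ExchangedTree

/-- The node above `⊤` at the top of the topmost proper edge is unique. -/
theorem topmost_proper_unique {a' b' : V} (hp : IsRootedTree p)
    (h1 : p b = a ∧ b ≠ a ∧ IsDesc p ⊤ b ∧ (∀ z, IsDesc p z b → a < z) ∧
      ∀ y, IsDesc p a y → p y ≠ y → IsImproperEdge p y)
    (h2 : p b' = a' ∧ b' ≠ a' ∧ IsDesc p ⊤ b' ∧ (∀ z, IsDesc p z b' → a' < z) ∧
      ∀ y, IsDesc p a' y → p y ≠ y → IsImproperEdge p y) : a = a' := by
  have key : ∀ {a b a' b' : V}, (p b = a ∧ b ≠ a ∧ IsDesc p ⊤ b ∧ (∀ z, IsDesc p z b → a < z) ∧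
      ∀ y, IsDesc p a y → p y ≠ y → IsImproperEdge p y) → (p b' = a' ∧ b' ≠ a' ∧ IsDesc p ⊤ b' ∧
      (∀ z, IsDesc p z b' → a' < z) ∧ ∀ y, IsDesc p a' y → p y ≠ y → IsImproperEdge p y) →
      IsDesc p a a' → a = a' := by
    rintro a b a' b' ⟨e1, e2, e3, -, e5⟩ ⟨f1, f2, f3, f4, -⟩ hd
    by_contra hne
    have hta : IsDesc p ⊤ a := e3.trans (e1 ▸ isDesc_father p b)
    have hb' : b' ∈ children p a' := mem_children.2 ⟨f1, f2⟩
    rcases f3.of_mem_children_of_ne hb' hta with h | h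
    · obtain ⟨-, x, hx, hle⟩ := isImproperEdge_iff.1 (e5 b' h (f1.symm ▸ f2.symm))
      exact absurd (f4 x hx) (not_lt.2 (f1 ▸ hle))
    · exact hne (hd.antisymm hp h)
  rcases (h1.2.2.1.trans (h1.1 ▸ isDesc_father p b)).total
    (h2.2.2.1.trans (h2.1 ▸ isDesc_father p b')) with h | h
  · exact key h1 h2 h
  · exact (key h2 h1 h).symm

end ExchangeTop

/-! ### Improper edges under (b), and the inverse construction. -/

section ExchangeTop

variable {V : Type*} [Fintype V] [LinearOrder V] [BoundedOrder V] {p q g : V → V}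
  {a b c s x y z : V}

namespace ExchangedTree

variable (h : ExchangedTree g a b)
include h

theorem not_desc_top_of_below (hz : Below g (children g ⊥) z) :
    ¬ IsDesc g z ⊤ ∧ ¬ IsDesc g ⊤ z := by
  obtain ⟨s, hs, hd⟩ := hz
  have hs' := isDesc_of_mem_children hs
  constructor
  · intro h1
    rcases hd.total h1 with h2 | h2
    · have hne : s ≠ ⊤ := fun he => h.top_notMem (he ▸ hs)
      exact h.bot_not_desc (((mem_children.1 hs).1 ▸ h2.father hne).trans h.desc)
    · exact h.not_top_desc_bot (h2.trans hs')
  · exact fun h1 => h.not_top_desc_bot ((h1.trans hd).trans hs')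

theorem below_move_iff : Below (moveSubtrees g (children g ⊤) a) (children g ⊥) z ↔
    Below g (children g ⊥) z := by
  constructor
  · rintro ⟨s, hs, hd⟩
    exact ⟨s, hs, h.isDesc_of_isDesc_move hd⟩
  · intro hz
    obtain ⟨s, hs, hd⟩ := id hz
    exact ⟨s, hs, (h.isDesc_move_of_not fun h' => (h.not_desc_top_of_below hz).1 h'.1).2 hd⟩

theorem not_below_move_top :
    ¬ Below (moveSubtrees g (children g ⊤) a) (children g ⊥) ⊤ := by
  rw [h.below_move_iff]
  exact fun hb => (h.not_desc_top_of_below hb).1 (IsDesc.refl g ⊤)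

theorem not_below_move_bot :
    ¬ Below (moveSubtrees g (children g ⊤) a) (children g ⊥) ⊥ := by
  rw [h.below_move_iff]
  rintro ⟨s, hs, hd⟩
  exact not_isDesc_of_mem_children h.tree hs hd

/-- The image of the tree before the exchange of labels. -/
theorem mapA_move_eq : mapA (moveSubtrees g (children g ⊤) a) =
    moveSubtrees (moveSubtrees g (children g ⊤) a) (children g ⊥) ⊤ := by
  rw [mapA, h.children_bot_move]

theorem tree_mapA : IsRootedTree (mapA (moveSubtrees g (children g ⊤) a)) := by
  rw [h.mapA_move_eq]
  exact h.tree_move.move h.not_below_move_top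

theorem isDesc_mapA : IsDesc (mapA (moveSubtrees g (children g ⊤) a)) z x ↔
    (IsDesc (moveSubtrees g (children g ⊤) a) z x ∧
      ∀ s ∈ children g ⊥, IsDesc (moveSubtrees g (children g ⊤) a) z s →
        IsDesc (moveSubtrees g (children g ⊤) a) s x → s = x) ∨
      (Below g (children g ⊥) z ∧ IsDesc g ⊤ x) := by
  rw [h.mapA_move_eq, _root_.isDesc_move h.tree_move h.not_below_move_top, h.below_move_iff,
    h.isDesc_move_top]

theorem isDesc_mapA_of_not_below (hz : ¬ Below g (children g ⊥) z) :
    IsDesc (mapA (moveSubtrees g (children g ⊤) a)) z x ↔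
      IsDesc (moveSubtrees g (children g ⊤) a) z x := by
  rw [h.mapA_move_eq]
  exact isDesc_move_of_not_below h.tree_move (by rwa [h.below_move_iff])

theorem not_below_top_bot : ¬ Below g (children g ⊥) ⊤ := fun hb =>
  (h.not_desc_top_of_below hb).1 (IsDesc.refl g ⊤)

theorem not_below_bot_bot : ¬ Below g (children g ⊥) ⊥ := by
  rw [← h.below_move_iff]
  exact h.not_below_move_bot

theorem isDesc_top_mapA :
    IsDesc (mapA (moveSubtrees g (children g ⊤) a)) ⊤ x ↔ IsDesc g ⊤ x := by
  rw [h.isDesc_mapA_of_not_below h.not_below_top_bot, h.isDesc_move_top]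

theorem not_bot_desc_top : ¬ IsDesc g ⊥ ⊤ := fun h' => h.bot_not_desc (h'.trans h.desc)

theorem isDesc_bot_mapA :
    IsDesc (mapA (moveSubtrees g (children g ⊤) a)) ⊥ x ↔ IsDesc g ⊥ x := by
  rw [h.isDesc_mapA_of_not_below h.not_below_bot_bot,
    h.isDesc_move_of_not fun h' => h.not_bot_desc_top h'.1]

theorem isDesc_of_isDesc_mapA (hx : ¬ IsDesc g ⊤ x)
    (hd : IsDesc (mapA (moveSubtrees g (children g ⊤) a)) z x) : IsDesc g z x := by
  rcases h.isDesc_mapA.1 hd with h1 | h1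
  · exact h.isDesc_of_isDesc_move h1.1
  · exact absurd h1.2 hx

theorem mapA_of_mem (hz : z ∈ children g ⊥) : mapA (moveSubtrees g (children g ⊤) a) z = ⊤ := by
  rw [h.mapA_move_eq]
  exact moveSubtrees_of_mem hz

theorem mapA_of_notMem (hz : z ∉ children g ⊥) :
    mapA (moveSubtrees g (children g ⊤) a) z = moveSubtrees g (children g ⊤) a z := by
  rw [h.mapA_move_eq]
  exact moveSubtrees_of_notMem hz

/-- Improper edges before the exchange of labels. -/
theorem isImproperEdge_exchangeLabels_iff :
    IsImproperEdge (exchangeLabels g ⊤ a) (labelSwap ⊤ a z) ↔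
      g z ≠ z ∧ ∃ x, IsDesc g x z ∧ labelSwap ⊤ a x ≤ labelSwap ⊤ a (g z) := by
  rw [isImproperEdge_iff, exchangeLabels_apply, labelSwap_self]
  refine and_congr (not_congr (labelSwap ⊤ a).injective.eq_iff) ?_
  constructor
  · rintro ⟨x, hx, hle⟩
    rw [isDesc_exchangeLabels, labelSwap_self] at hx
    exact ⟨_, hx, by rwa [labelSwap_self]⟩
  · rintro ⟨x, hx, hle⟩
    refine ⟨_, ?_, hle⟩
    rwa [isDesc_exchangeLabels, labelSwap_self, labelSwap_self]

theorem isImproperEdge_of_above (hz : IsDesc g a z) (hne : g z ≠ z) :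
    IsImproperEdge (mapA (moveSubtrees g (children g ⊤) a)) z ∧
      IsImproperEdge (exchangeLabels g ⊤ a) (labelSwap ⊤ a z) := by
  have hzS : z ∉ children g ⊥ := fun hs => h.not_desc_bot (hz.trans (isDesc_of_mem_children hs))
  obtain ⟨-, x, hx, hle⟩ := isImproperEdge_iff.1 (h.path z hz hne)
  obtain ⟨f1, f2⟩ := h.father_ne hz hne
  constructor
  · rw [isImproperEdge_iff, h.mapA_of_notMem hzS, h.move_of_notMem (h.notMem_of_above hz)]
    refine ⟨hne, x, h.isDesc_mapA.2 ?_, hle⟩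
    by_cases hb : Below g (children g ⊥) x
    · exact Or.inr ⟨hb, h.top_desc.trans hz⟩
    · refine Or.inl ⟨(h.isDesc_move_of_above hz).2 hx, fun s hs hd => ?_⟩
      exact absurd ⟨s, hs, h.isDesc_of_isDesc_move hd⟩ hb
  · rw [h.isImproperEdge_exchangeLabels_iff]
    refine ⟨hne, labelSwap ⊤ a x, isDesc_labelSwap (h.top_desc.trans hz) hz hx, ?_⟩
    rwa [labelSwap_self, labelSwap_of_ne f1 f2]

/-- These edges may be proper in g. In the image the moved subtrees bring a label below a; in the
source α itself sits at the place of ⊤. Either label is at most the father's. -/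
theorem isImproperEdge_of_between (hz : IsDesc g ⊤ z) (hzb : IsDesc g z b) :
    IsImproperEdge (mapA (moveSubtrees g (children g ⊤) a)) z ∧
      IsImproperEdge (exchangeLabels g ⊤ a) (labelSwap ⊤ a z) := by
  have hza : z ≠ a := by
    rintro rfl
    exact not_isDesc_of_mem_children h.tree h.mem hzb
  have hne : g z ≠ z := (hzb.trans (isDesc_of_mem_children h.mem)).ne_fixed hza
  have hzS : z ∉ children g ⊥ := fun hs =>
    h.not_top_desc_bot (hz.trans (isDesc_of_mem_children hs))
  have hzC : z ∉ children g ⊤ := fun hs => not_isDesc_of_mem_children h.tree hs hz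
  have hle : a ≤ g z := by
    by_cases he : z = b
    · rw [he, (mem_children.1 h.mem).1]
    · exact (h.lt _ (hzb.father he)).le
  constructor
  · obtain ⟨s, hs, hlt⟩ := h.star
    rw [isImproperEdge_iff, h.mapA_of_notMem hzS, h.move_of_notMem hzC]
    exact ⟨hne, beta g s, h.isDesc_mapA.2 (Or.inr ⟨⟨s, hs, isDesc_beta g s⟩, hz⟩), hlt.le.trans hle⟩
  · rw [h.isImproperEdge_exchangeLabels_iff]
    refine ⟨hne, ⊤, hz, ?_⟩
    rw [labelSwap_left]
    by_cases he : g z = a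
    · rw [he, labelSwap_right]
      exact le_top
    · have ht : g z ≠ ⊤ := fun ht => hzC (mem_children.2 ⟨ht, fun h' => hne (ht.trans h'.symm)⟩)
      rwa [labelSwap_of_ne ht he]

theorem isImproperEdge_of_top_desc (hz : IsDesc g ⊤ z) (hne : g z ≠ z) :
    IsImproperEdge (mapA (moveSubtrees g (children g ⊤) a)) z ∧
      IsImproperEdge (exchangeLabels g ⊤ a) (labelSwap ⊤ a z) := by
  rcases h.desc.of_mem_children_of_ne h.mem hz with h1 | h1
  · exact h.isImproperEdge_of_between hz h1
  · exact h.isImproperEdge_of_above h1 hne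

/-- All labels here exceed a and are fixed by the exchange; a child of ⊤ in g has father a in both
trees, so its edge is proper in both. -/
theorem isImproperEdge_inside_iff (hz : IsDesc g z ⊤) (hzt : z ≠ ⊤) :
    IsImproperEdge (mapA (moveSubtrees g (children g ⊤) a)) z ↔
      IsImproperEdge (exchangeLabels g ⊤ a) (labelSwap ⊤ a z) := by
  have hnt : ¬ IsDesc g ⊤ z := fun h' => hzt (hz.antisymm h.tree h')
  have hzS : z ∉ children g ⊥ := fun hs => (h.not_desc_top_of_below (below_of_mem hs)).1 hz
  have hzC : Below g (children g ⊤) z := hz.exists_mem_children hzt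
  have hdesc : ∀ x, IsDesc (mapA (moveSubtrees g (children g ⊤) a)) x z ↔ IsDesc g x z := by
    intro x
    refine ⟨h.isDesc_of_isDesc_mapA hnt, fun hx => ?_⟩
    rw [h.isDesc_mapA_of_not_below fun hb => (h.not_desc_top_of_below hb).1 (hx.trans hz),
      h.isDesc_move_inside hzC]
    exact hx
  have hsw : ∀ x, IsDesc g x z → labelSwap ⊤ a x = x ∧ a < x := by
    intro x hx
    refine ⟨labelSwap_of_ne ?_ ?_, h.lt x ((hx.trans hz).trans h.desc)⟩
    · rintro rfl
      exact hnt hx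
    · rintro rfl
      exact hnt (h.top_desc.trans hx)
  rw [h.isImproperEdge_exchangeLabels_iff, isImproperEdge_iff, h.mapA_of_notMem hzS]
  by_cases hz1 : z ∈ children g ⊤
  · rw [moveSubtrees_of_mem hz1, (mem_children.1 hz1).1, labelSwap_left]
    refine iff_of_false ?_ ?_
    · rintro ⟨-, x, hx, hle⟩
      exact absurd (hsw x ((hdesc x).1 hx)).2 (not_lt.2 hle)
    · rintro ⟨-, x, hx, hle⟩
      rw [(hsw x hx).1] at hle
      exact absurd (hsw x hx).2 (not_lt.2 hle)
  · have hgz : IsDesc g (g z) ⊤ := hz.father hzt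
    have f1 : g z ≠ ⊤ := fun he => hz1 (mem_children.2 ⟨he, hzt⟩)
    have f2 : g z ≠ a := fun he => h.not_desc_top (he ▸ hgz)
    rw [h.move_of_notMem hz1, labelSwap_of_ne f1 f2]
    refine and_congr_right fun _ => exists_congr fun x => ?_
    rw [hdesc x]
    refine and_congr_right fun hx => ?_
    rw [(hsw x hx).1]

/-- A subtree that loses nodes to the move contains ⊥, so its edge is improper anyway. If the father
is a, it is ⊤ in the source, and in the image the edge is improper by `off` or by ⊥. -/
theorem isImproperEdge_outside_iff (hz : ¬ IsDesc g z ⊤) (hzt : ¬ IsDesc g ⊤ z)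
    (hzS : z ∉ children g ⊥) :
    IsImproperEdge (mapA (moveSubtrees g (children g ⊤) a)) z ↔
      IsImproperEdge (exchangeLabels g ⊤ a) (labelSwap ⊤ a z) := by
  have hzC : z ∉ children g ⊤ := fun hs => hz (isDesc_of_mem_children hs)
  have hxt : ∀ x, IsDesc g x z → ¬ IsDesc g x ⊤ := fun x hx hx' =>
    (hx.total hx').elim hz hzt
  have hkeep : ∀ x, IsDesc g x z →
      IsDesc (mapA (moveSubtrees g (children g ⊤) a)) x z ∨
        IsDesc (mapA (moveSubtrees g (children g ⊤) a)) ⊥ z := by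
    intro x hx
    have hx1 : IsDesc (moveSubtrees g (children g ⊤) a) x z :=
      (h.isDesc_move_of_not fun h' => hxt x hx h'.1).2 hx
    by_cases hb : Below g (children g ⊥) x
    · obtain ⟨s, hs, hxs⟩ := id hb
      rcases hx.total hxs with hzs | hsz
      · refine Or.inl (h.isDesc_mapA.2 (Or.inl ⟨hx1, fun s' hs' _ hs'z => ?_⟩))
        have h1 := h.isDesc_of_isDesc_move hs'z
        have h2 := children_eq_of_isDesc h.tree hs' hs (IsDesc.refl g s') (h1.trans hzs)
        exact h1.antisymm h.tree (h2 ▸ hzs)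
      · refine Or.inr (h.isDesc_bot_mapA.2 ?_)
        rw [← (mem_children.1 hs).1]
        refine hsz.father ?_
        rintro rfl
        exact hzS hs
    · exact Or.inl ((h.isDesc_mapA_of_not_below hb).2 hx1)
  have hsw : ∀ x, IsDesc g x z → labelSwap ⊤ a x = x := by
    intro x hx
    refine labelSwap_of_ne ?_ ?_
    · rintro rfl
      exact hzt hx
    · rintro rfl
      exact hzt (h.top_desc.trans hx)
  rw [h.isImproperEdge_exchangeLabels_iff, isImproperEdge_iff, h.mapA_of_notMem hzS,
    h.move_of_notMem hzC]
  refine and_congr_right fun hne => ?_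
  by_cases hza : g z = a
  · rw [hza, labelSwap_right]
    refine iff_of_true ?_ ⟨z, IsDesc.refl g z, le_top⟩
    have hlt := h.off z (mem_children.2 ⟨hza, fun he => hne (hza.trans he.symm)⟩) hzt
    rcases hkeep _ (isDesc_beta g z) with h1 | h1
    · exact ⟨_, h1, hlt.le⟩
    · exact ⟨_, h1, bot_le⟩
  · have f1 : g z ≠ ⊤ := fun he => hz (he ▸ isDesc_father g z)
    rw [labelSwap_of_ne f1 hza]
    constructor
    · rintro ⟨x, hx, hle⟩
      have hx' := h.isDesc_of_isDesc_mapA hzt hx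
      exact ⟨x, hx', by rwa [hsw x hx']⟩
    · rintro ⟨x, hx, hle⟩
      rw [hsw x hx] at hle
      rcases hkeep x hx with h1 | h1
      · exact ⟨x, h1, hle⟩
      · exact ⟨_, h1, bot_le⟩

theorem isImproperEdge_mapA_iff :
    IsImproperEdge (mapA (moveSubtrees g (children g ⊤) a)) z ↔
      z ∈ children g ⊥ ∨ IsImproperEdge (exchangeLabels g ⊤ a) (labelSwap ⊤ a z) := by
  by_cases hzS : z ∈ children g ⊥
  · simp only [hzS, true_or, iff_true]
    refine isImproperEdge_of_father_top (h.mapA_of_mem hzS) ?_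
    rintro rfl
    exact h.top_notMem hzS
  simp only [hzS, false_or]
  by_cases h1 : IsDesc g ⊤ z
  · by_cases hne : g z = z
    · have hzC : z ∉ children g ⊤ := fun hs => father_ne_of_mem_children hs hne
      rw [isImproperEdge_iff, h.mapA_of_notMem hzS, h.move_of_notMem hzC,
        h.isImproperEdge_exchangeLabels_iff]
      simp [hne]
    · exact iff_of_true (h.isImproperEdge_of_top_desc h1 hne).1
        (h.isImproperEdge_of_top_desc h1 hne).2
  by_cases h2 : IsDesc g z ⊤
  · refine h.isImproperEdge_inside_iff h2 ?_
    rintro rfl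
    exact h1 h2
  · exact h.isImproperEdge_outside_iff h2 h1 hzS

theorem labelSwap_of_mem (hz : z ∈ children g ⊥) : labelSwap ⊤ a z = z := by
  refine labelSwap_of_ne ?_ ?_
  · rintro rfl
    exact h.top_notMem hz
  · rintro rfl
    exact h.notMem hz

theorem improperCount_mapA : improperCount (mapA (moveSubtrees g (children g ⊤) a)) =
    improperCount (exchangeLabels g ⊤ a) + deg g ⊥ := by
  refine improperCount_eq_add (labelSwap ⊤ a) (fun z => h.isImproperEdge_mapA_iff) fun z hz => ?_
  rw [h.labelSwap_of_mem hz]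
  exact not_isImproperEdge_of_father_bot (h.tree.exchangeLabels _ _) (h.children_bot_eq ▸ hz)

theorem good_mapA : Good (mapA (moveSubtrees g (children g ⊤) a)) := by
  refine ⟨h.tree_mapA, fun y hy hne => ?_⟩
  rw [h.isDesc_top_mapA] at hy
  have hyS : y ∉ children g ⊥ := fun hs =>
    h.not_top_desc_bot (hy.trans (isDesc_of_mem_children hs))
  have hyC : y ∉ children g ⊤ := fun hs => not_isDesc_of_mem_children h.tree hs hy
  rw [h.mapA_of_notMem hyS, h.move_of_notMem hyC] at hne
  exact (h.isImproperEdge_of_top_desc hy hne).1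

theorem children_top_mapA :
    children (mapA (moveSubtrees g (children g ⊤) a)) ⊤ = children g ⊥ := by
  ext y
  by_cases hyS : y ∈ children g ⊥
  · simp only [hyS, iff_true]
    refine mem_children.2 ⟨h.mapA_of_mem hyS, ?_⟩
    rintro rfl
    exact h.top_notMem hyS
  · simp only [hyS, iff_false, mem_children, h.mapA_of_notMem hyS]
    by_cases hyC : y ∈ children g ⊤
    · rw [moveSubtrees_of_mem hyC]
      exact fun h' => h.lt_top.ne h'.1
    · rw [h.move_of_notMem hyC]
      exact fun h' => hyC (mem_children.2 h')

theorem deg_bot_mapA : deg (mapA (moveSubtrees g (children g ⊤) a)) ⊥ = 0 := by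
  rw [deg, Finset.card_eq_zero, Finset.eq_empty_iff_forall_notMem]
  intro y hy
  by_cases hyS : y ∈ children g ⊥
  · rw [mem_children, h.mapA_of_mem hyS] at hy
    exact h.bot_ne_top hy.1.symm
  · rw [mem_children, h.mapA_of_notMem hyS, ← mem_children, h.children_bot_move] at hy
    exact hyS hy

end ExchangedTree

/-- The exchanged tree is determined by the image. -/
theorem ExchangedTree.eq_of_mapA_eq {g' : V → V} {a' b' : V} (h : ExchangedTree g a b)
    (h' : ExchangedTree g' a' b')
    (he : mapA (moveSubtrees g (children g ⊤) a) = mapA (moveSubtrees g' (children g' ⊤) a')) :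
    a = a' ∧ g = g' := by
  have hS : children g ⊥ = children g' ⊥ := by
    rw [← h.children_top_mapA, he, h'.children_top_mapA]
  have hback : ∀ {g : V → V} {a b : V}, ExchangedTree g a b →
      moveSubtrees (mapA (moveSubtrees g (children g ⊤) a)) (children g ⊥) ⊥ =
        moveSubtrees g (children g ⊤) a := by
    intro g a b h
    rw [h.mapA_move_eq]
    refine moveSubtrees_moveSubtrees fun s hs => ?_
    rw [← h.children_bot_move] at hs
    exact (mem_children.1 hs).1
  have hP : moveSubtrees g (children g ⊤) a = moveSubtrees g' (children g' ⊤) a' := by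
    rw [← hback h, ← hback h', he, hS]
  have ha : a = a' :=
    topmost_proper_unique h.tree_move h.topmost_proper (hP ▸ h'.topmost_proper)
  subst ha
  have hC : children g ⊤ = children g' ⊤ := by
    ext z
    rw [h.mem_children_top_iff, h'.mem_children_top_iff, hP]
  refine ⟨rfl, ?_⟩
  have e1 : moveSubtrees (moveSubtrees g (children g ⊤) a) (children g ⊤) ⊤ = g :=
    moveSubtrees_moveSubtrees fun s hs => (mem_children.1 hs).1
  have e2 : moveSubtrees (moveSubtrees g' (children g' ⊤) a) (children g' ⊤) ⊤ = g' :=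
    moveSubtrees_moveSubtrees fun s hs => (mem_children.1 hs).1
  rw [← e1, ← e2, hP, hC]

/-- Move the subtrees of ⊤ to ⊥, find the topmost proper edge above ⊤ and let a be its father, then
give ⊤ the children of a off the path whose nodes all exceed a. -/
theorem exists_exchangedTree (hq : Good q) (h0 : deg q ⊥ = 0)
    (hbt : ¬ IsDesc q ⊥ ⊤) :
    ∃ g a b, ExchangedTree g a b ∧ mapA (moveSubtrees g (children g ⊤) a) = q := by
  classical
  have hbot : ¬ Below q (children q ⊤) ⊥ := by
    rintro ⟨d, hd, h⟩
    exact hbt (h.trans (isDesc_of_mem_children hd))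
  have htop : ¬ Below q (children q ⊤) ⊤ := not_below_children_self hq.1
  have h0' : ∀ y, y ∉ children q ⊥ := by
    rw [deg, Finset.card_eq_zero] at h0
    simp [h0]
  obtain ⟨t, ht⟩ : ∃ t, t = moveSubtrees q (children q ⊤) ⊥ := ⟨_, rfl⟩
  have htree : IsRootedTree t := ht ▸ hq.1.move hbot
  have ht1 : ∀ {z}, z ∈ children q ⊤ → t z = ⊥ := fun h => ht ▸ moveSubtrees_of_mem h
  have ht2 : ∀ {z}, z ∉ children q ⊤ → t z = q z := fun h => ht ▸ moveSubtrees_of_notMem h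
  have htd : ∀ {x}, IsDesc t ⊤ x ↔ IsDesc q ⊤ x := ht ▸ isDesc_move_of_not_below hq.1 htop
  have htd' : ∀ {z x}, ¬ Below q (children q ⊤) z → (IsDesc t z x ↔ IsDesc q z x) :=
    fun h => ht ▸ isDesc_move_of_not_below hq.1 h
  have htD : ∀ {z x}, Below q (children q ⊤) x → (IsDesc t z x ↔ IsDesc q z x) :=
    fun h => ht ▸ isDesc_move_of_below hq.1 (fun _ hs => mem_children.1 hs) hbot h
  have hleaf : ∀ {z}, IsDesc t z ⊤ → z = ⊤ := by
    intro z hz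
    by_contra hzt
    rw [ht, isDesc_move hq.1 hbot] at hz
    rcases hz with hz | hz
    · obtain ⟨d, hd, hzd⟩ := hz.1.exists_mem_children hzt
      exact (mem_children.1 hd).2 (hz.2 d hd hzd (isDesc_of_mem_children hd))
    · exact hbt hz.2
  have hDtop : ∀ {z}, IsDesc q ⊤ z → z ∉ children q ⊤ := fun hz h =>
    not_isDesc_of_mem_children hq.1 h hz
  obtain ⟨b, ⟨hb1, hb2, hb3⟩, hbmax⟩ := exists_highest (p := t)
    (P := fun y => IsDesc t ⊤ y ∧ t y ≠ y ∧ ¬ IsImproperEdge t y)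
    (fun _ _ hu hu' => hu.1.total hu'.1) (by
      -- A proper edge exists on the path: ⊤ is now a leaf and not the root, so its own edge is
      -- proper.
      have hr : q ⊤ ≠ ⊤ := fun h => hbt (hq.1.isDesc_of_fixed h ⊥)
      have hr' : t ⊤ = q ⊤ := ht2 (hDtop (IsDesc.refl q ⊤))
      refine ⟨⊤, IsDesc.refl t ⊤, hr' ▸ hr, fun himp => ?_⟩
      obtain ⟨-, x, hx, hle⟩ := isImproperEdge_iff.1 himp
      rw [hleaf hx, top_le_iff, hr'] at hle
      exact hr hle)
  obtain ⟨a, ha⟩ : ∃ a, a = t b := ⟨_, rfl⟩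
  rw [← ha] at hb2
  have hbm : b ∈ children t a := mem_children.2 ⟨ha.symm, hb2.symm⟩
  have hlt : ∀ z, IsDesc t z b → a < z := fun z hz => by
    by_contra hn
    exact hb3 (isImproperEdge_iff.2 ⟨ha ▸ hb2, z, hz, ha ▸ not_lt.1 hn⟩)
  have hta : IsDesc t ⊤ a := hb1.trans (isDesc_of_mem_children hbm)
  obtain ⟨C, hC⟩ : ∃ C : Finset V, ∀ z, z ∈ C ↔ z ∈ children t a ∧ ¬ IsDesc t ⊤ z ∧
      ∀ x, IsDesc t x z → a < x :=
    ⟨Finset.univ.filter fun z => z ∈ children t a ∧ ¬ IsDesc t ⊤ z ∧ ∀ x, IsDesc t x z → a < x,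
      by simp⟩
  have hCtop : ¬ Below t C ⊤ := by
    rintro ⟨c, hc, hd⟩
    exact ((hC c).1 hc).2.1 hd
  have hCa : ¬ Below t C a := fun h => hCtop (h.mono hta)
  obtain ⟨g, hg⟩ : ∃ g, g = moveSubtrees t C ⊤ := ⟨_, rfl⟩
  have hg1 : ∀ {z}, z ∈ C → g z = ⊤ := fun h => hg ▸ moveSubtrees_of_mem h
  have hg2 : ∀ {z}, z ∉ C → g z = t z := fun h => hg ▸ moveSubtrees_of_notMem h
  have hgn : ∀ {z x}, ¬ Below t C z → (IsDesc g z x ↔ IsDesc t z x) :=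
    fun h => hg ▸ isDesc_move_of_not_below htree h
  have hgd : ∀ {z x}, IsDesc g z x →
      IsDesc t z x ∨ (Below t C z ∧ IsDesc t ⊤ x) := by
    intro z x hd
    rw [hg, isDesc_move htree hCtop] at hd
    exact hd.imp And.left id
  have hat : a ≠ ⊤ := (hlt ⊤ hb1).ne_top
  have hbC : b ∉ C := fun h => hCtop ⟨b, h, hb1⟩
  have hab : a ≠ ⊥ := by
    intro h
    have hne : (⊥ : V) ≠ ⊤ := h ▸ hat
    exact hq.not_isDesc_top_bot hne (htd.1 (h ▸ hta))
  have hnD : ∀ {d}, d ∈ children q ⊤ → ¬ IsDesc t ⊤ d := fun hd h => hDtop (htd.1 h) hd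
  have hchD : ∀ {d}, d ∈ children q ⊤ → d ∈ children t ⊥ := fun hd =>
    mem_children.2 ⟨ht1 hd, fun h => hbot (h ▸ below_of_mem hd)⟩
  have hDC : ∀ {d}, d ∈ children q ⊤ → d ∉ C := fun hd h =>
    hab ((mem_children.1 ((hC _).1 h).1).1.symm.trans (ht1 hd))
  have hex : ExchangedTree g a b := by
    refine ⟨hg ▸ htree.move hCtop, fun y hy hne => ?_, ?_, ?_, fun z hz => ?_, fun c hc hcn => ?_, ?_⟩
    · rw [hgn hCa] at hy
      have hyC : y ∉ C := fun h => hCa ⟨y, h, hy⟩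
      rw [hg2 hyC] at hne
      have himp : IsImproperEdge t y := by
        by_contra hn
        have := hbmax y ⟨hta.trans hy, hne, hn⟩
        exact not_isDesc_of_mem_children htree hbm (hy.trans this)
      obtain ⟨-, x, hx, hle⟩ := isImproperEdge_iff.1 himp
      rw [isImproperEdge_iff, hg2 hyC]
      refine ⟨hne, x, ?_, hle⟩
      rw [hg, isDesc_move htree hCtop]
      by_cases hb : Below t C x
      · exact Or.inr ⟨hb, hta.trans hy⟩
      · exact Or.inl ⟨hx, fun s hs h => absurd ⟨s, hs, h⟩ hb⟩
    · exact mem_children.2 ⟨(hg2 hbC).trans ha.symm, hb2.symm⟩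
    · exact (hgn hCtop).2 hb1
    · rcases hgd hz with h | ⟨⟨c, hc, hd⟩, -⟩
      · exact hlt z h
      · exact ((hC c).1 hc).2.2 z hd
    · have hcC : c ∉ C := fun h => hat ((mem_children.1 hc).1.symm.trans (hg1 h))
      rw [mem_children, hg2 hcC, ← mem_children] at hc
      rw [hgn hCtop] at hcn
      have hx : ∃ x, IsDesc t x c ∧ x ≤ a := by
        by_contra! hcon
        exact hcC ((hC c).2 ⟨hc, hcn, hcon⟩)
      obtain ⟨x, hx, hle⟩ := hx
      have hxa : x ≠ a := by
        rintro rfl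
        exact not_isDesc_of_mem_children htree hc hx
      refine (beta_le ((hgn ?_).2 hx)).trans_lt (lt_of_le_of_ne hle hxa)
      rintro ⟨c', hc', hxc'⟩
      exact hcC (children_eq_of_isDesc htree hc ((hC c').1 hc').1 hx hxc' ▸ hc')
    · have hbD := hDtop (htd.1 hb1)
      have hqb : q b = a := by rw [← ht2 hbD, ha]
      obtain ⟨-, x, hx, hle⟩ := isImproperEdge_iff.1
        (hq.2 b (htd.1 hb1) (by rw [hqb]; exact hb2))
      rw [hqb] at hle
      have hxD : Below q (children q ⊤) x := by
        by_contra hn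
        exact absurd (hlt x ((htd' hn).2 hx)) (not_lt.2 hle)
      obtain ⟨d, hd, hxd⟩ := hxD
      have hxd' : IsDesc t x d := (htD (below_of_mem hd)).2 hxd
      refine ⟨d, ?_, (beta_le ((hgn ?_).2 hxd')).trans_lt (lt_of_le_of_ne hle ?_)⟩
      · rw [mem_children, hg2 (hDC hd), ← mem_children]
        exact hchD hd
      · rintro ⟨c, hc, hxc⟩
        have hca := (hC c).1 hc
        rcases hxc.total hxd' with h | h
        · have hcd : c ≠ d := fun h => hDC hd (h ▸ hc)
          exact hnD hd (hta.trans ((mem_children.1 hca.1).1 ▸ h.father hcd))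
        · have hcd : d ≠ c := fun h => hDC hd (h ▸ hc)
          have := h.father hcd
          rw [ht1 hd] at this
          exact not_lt_bot (hca.2.2 ⊥ this)
      · rintro rfl
        exact hnD hd (hta.trans hxd')
  refine ⟨g, a, b, hex, ?_⟩
  have hgC : children g ⊤ = C := by
    ext y
    by_cases hy : y ∈ C
    · simp only [hy, iff_true]
      refine mem_children.2 ⟨hg1 hy, ?_⟩
      rintro rfl
      exact hCtop (below_of_mem hy)
    · simp only [hy, iff_false, mem_children, hg2 hy]
      exact fun h => h.2 (hleaf (h.1 ▸ isDesc_father t y))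
  have hgt : moveSubtrees g (children g ⊤) a = t := by
    rw [hgC, hg]
    exact moveSubtrees_moveSubtrees fun s hs => (mem_children.1 ((hC s).1 hs).1).1
  have htb : children t ⊥ = children q ⊤ := by
    ext y
    refine ⟨fun hy => ?_, hchD⟩
    by_contra hn
    rw [mem_children, ht2 hn, ← mem_children] at hy
    exact h0' y hy
  rw [hgt, mapA, htb, ht]
  exact moveSubtrees_moveSubtrees fun s hs => (mem_children.1 hs).1

end ExchangeTop

/-! ### The bijection (b). -/

section BijB

variable {n k m : ℕ} [NeZero n] {p q : Fin n → Fin n}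

theorem bijOn_mapB (hm : 1 ≤ m) : Set.BijOn mapB (sourceB n k m) (targetB n k m) := by
  have hs : ∀ p ∈ sourceB n k m, children (exchangeLabels p ⊤ (alpha p)) ⊥ = children p ⊥ ∧
      ∃ b, ExchangedTree (exchangeLabels p ⊤ (alpha p)) (alpha p) b := fun p hp => by
    have hne := nonempty_of_deg hm hp.2.1
    obtain ⟨h1, h2, b, h3⟩ := exchangedTree_of_source (mem_RTrees.1 hp.1).1 hne hp.2.2
    exact ⟨children_bot_exchangeLabels h3.bot_ne_top h3.ne_bot h1 h2, b, h3⟩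
  refine ⟨fun p hp => ?_, fun p hp p' hp' he => ?_, fun q hq => ?_⟩
  · obtain ⟨h1, b, h⟩ := hs p hp
    have hd : deg (exchangeLabels p ⊤ (alpha p)) ⊥ = m := by rw [deg, h1, ← deg, hp.2.1]
    refine ⟨mem_RTrees.2 ⟨h.good_mapA, ?_⟩, h.deg_bot_mapA, ?_, ?_⟩
    · refine h.improperCount_mapA.trans ?_
      rw [exchangeLabels_exchangeLabels, (mem_RTrees.1 hp.1).2, hd]
    · exact (congrArg Finset.card h.children_top_mapA).trans hd
    · exact fun h' => h.not_bot_desc_top (h.isDesc_bot_mapA.1 h')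
  · obtain ⟨-, b, h⟩ := hs p hp
    obtain ⟨-, b', h'⟩ := hs p' hp'
    obtain ⟨ha, hg⟩ := h.eq_of_mapA_eq h' he
    rw [← exchangeLabels_exchangeLabels (p := p) (x := ⊤) (y := alpha p), hg, ha,
      exchangeLabels_exchangeLabels]
  · obtain ⟨h1, h2, h3, h4⟩ := hq
    rw [mem_RTrees] at h1
    obtain ⟨g, a, b, h, rfl⟩ := exists_exchangedTree h1.1 h2 h4
    have hd : deg g ⊥ = m := by rw [← h3, deg, deg, h.children_top_mapA]
    refine ⟨exchangeLabels g ⊤ a, ⟨mem_RTrees.2 ⟨h.good_exchangeLabels, ?_⟩, ?_, ?_⟩, ?_⟩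
    · have := h1.2
      rw [h.improperCount_mapA, hd] at this
      omega
    · rw [deg, h.children_bot_eq, ← deg, hd]
    · rw [h.alpha_exchangeLabels]
      exact h.betaStar_lt
    · change mapA (exchangeTop _) = _
      rw [exchangeTop, h.alpha_exchangeLabels, exchangeLabels_exchangeLabels]

end BijB

/-! ### The partitions of both sides. -/

section Partition

variable {n k m : ℕ} [NeZero n] {p q : Fin n → Fin n}

/-- A common value would lie below a child b of ⊤ and a child a of ⊥. Then either a is below b, so ⊥
is too and the value is ⊥, which β* never is; or ⊤ lies below ⊥. -/
theorem alpha_ne_betaStar {V : Type*} [Fintype V] [LinearOrder V] [BoundedOrder V] {p : V → V}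
    (hp : Good p) (hne : (children p ⊥).Nonempty) : alpha p ≠ betaStar p := by
  have hbt := ne_of_children_bot_nonempty hne
  obtain ⟨b, hb, hβ⟩ := exists_beta_eq_alpha (hp.children_top_nonempty hbt)
  obtain ⟨a, ha, hα⟩ := exists_beta_eq_betaStar hne
  intro he
  have h1 := isDesc_beta p b
  have h2 := isDesc_beta p a
  rw [hβ, he] at h1
  rw [hα] at h2
  have hab : a ≠ b := by
    rintro rfl
    exact hbt ((mem_children.1 ha).1.symm.trans (mem_children.1 hb).1)
  rcases h1.of_mem_children_of_ne hb h2 with h | h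
  · have h3 := h.father hab
    rw [(mem_children.1 ha).1] at h3
    rw [le_bot_iff.1 (beta_le h3)] at hβ
    exact betaStar_ne_bot hp.1 hne (he.symm.trans hβ.symm)
  · exact not_below_children_bot_top hp hbt ⟨a, ha, h⟩

theorem sources_union (hm : 1 ≤ m) :
    sourceA n k m ∪ sourceB n k m ∪ sourceC n k m ∪ sourceD n k m =
      {p | p ∈ RTrees n k 0 ∧ deg p ⊥ = m} := by
  ext p
  constructor
  · rintro (((h | h) | h) | h) <;> exact ⟨h.1, h.2.1⟩
  · rintro ⟨h1, h2⟩
    have hg := (mem_RTrees.1 h1).1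
    have hne := nonempty_of_deg hm h2
    have hd : 0 < deg p ⊤ :=
      Finset.card_pos.2 (hg.children_top_nonempty (ne_of_children_bot_nonempty hne))
    rcases lt_or_gt_of_ne (alpha_ne_betaStar hg hne) with h | h
    · by_cases hb : IsDesc p ⊥ ⊤
      · by_cases hd1 : deg p ⊤ = 1
        · exact Or.inr ⟨h1, h2, hb, hd1⟩
        · exact Or.inl (Or.inr ⟨h1, h2, hb, by omega, h⟩)
      · exact Or.inl (Or.inl (Or.inl ⟨h1, h2, hb, h⟩))
    · exact Or.inl (Or.inl (Or.inr ⟨h1, h2, h⟩))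

theorem sources_disjoint (hm : 1 ≤ m) :
    [sourceA n k m, sourceB n k m, sourceC n k m, sourceD n k m].Pairwise Disjoint := by
  -- In (d) the inequality is automatic: the only child of ⊤ has ⊥ below it, so α = ⊥.
  have hD : ∀ p ∈ sourceD n k m, alpha p < betaStar p := fun p hp => by
    obtain ⟨r, hr⟩ := Finset.card_eq_one.1 hp.2.2.2
    exact (swingable_of_deg_top_eq_one (mem_RTrees.1 hp.1).1 (nonempty_of_deg hm hp.2.1)
      hp.2.2.1 hr).lt
  simp only [List.pairwise_cons, List.mem_cons, List.not_mem_nil, or_false, forall_eq_or_imp,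
    forall_eq, Set.disjoint_left, false_imp_iff, implies_true, List.Pairwise.nil, and_true]
  refine ⟨⟨fun p h h' => lt_asymm h.2.2.2 h'.2.2, fun p h h' => h.2.2.1 h'.2.2.1,
    fun p h h' => h.2.2.1 h'.2.2.1⟩, ⟨fun p h h' => lt_asymm h.2.2 h'.2.2.2.2,
    fun p h h' => lt_asymm h.2.2 (hD p h')⟩, fun p h h' => ?_⟩
  have h1 := h.2.2.2.1
  have h2 := h'.2.2.2
  omega

theorem targets_union (hm : 1 ≤ m) :
    targetA n k m ∪ targetB n k m ∪ targetC n k m ∪ targetD n k m =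
      {p | p ∈ RTrees n (k + m) 0 ∧ deg p ⊥ = 0 ∧ m ≤ deg p ⊤ ∧ ⊥ < lowerCritical p} := by
  ext p
  constructor
  · rintro (((h | h) | h) | h)
    · exact ⟨h.1, h.2.1, by have := h.2.2.1; omega, bot_lt_lowerCritical_of_not_isDesc
        (Finset.card_pos.1 (Nat.zero_lt_of_lt h.2.2.1)) h.2.2.2⟩
    · exact ⟨h.1, h.2.1, h.2.2.1.ge, bot_lt_lowerCritical_of_not_isDesc
        (nonempty_of_deg hm h.2.2.1) h.2.2.2⟩
    · exact ⟨h.1, h.2.1, by have := h.2.2.1; omega, h.2.2.2.2⟩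
    · exact ⟨h.1, h.2.1, h.2.2.1.ge, h.2.2.2.2⟩
  · rintro ⟨h1, h2, h3, h4⟩
    by_cases hb : IsDesc p ⊥ ⊤ <;> by_cases hd : deg p ⊤ = m
    · exact Or.inr ⟨h1, h2, hd, hb, h4⟩
    · exact Or.inl (Or.inr ⟨h1, h2, by omega, hb, h4⟩)
    · exact Or.inl (Or.inl (Or.inr ⟨h1, h2, hd, hb⟩))
    · exact Or.inl (Or.inl (Or.inl ⟨h1, h2, by omega, hb⟩))

theorem targets_disjoint :
    [targetA n k m, targetB n k m, targetC n k m, targetD n k m].Pairwise Disjoint := by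
  simp only [List.pairwise_cons, List.mem_cons, List.not_mem_nil, or_false, forall_eq_or_imp,
    forall_eq, Set.disjoint_left, false_imp_iff, implies_true, List.Pairwise.nil, and_true]
  refine ⟨⟨fun p h h' => ?_, fun p h h' => h.2.2.2 h'.2.2.2.1, fun p h h' => h.2.2.2 h'.2.2.2.1⟩,
    ⟨fun p h h' => h.2.2.2 h'.2.2.2.1, fun p h h' => h.2.2.2 h'.2.2.2.1⟩, fun p h h' => ?_⟩
  all_goals
    have h1 := h.2.2.1
    have h2 := h'.2.2.1
    omega

end Partition

theorem mainTheorem7 (n k m : ℕ) [NeZero n] (hm : 1 ≤ m) :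
    Set.BijOn mapA (sourceA n k m) (targetA n k m) ∧
    Set.BijOn mapB (sourceB n k m) (targetB n k m) ∧
    Set.BijOn mapC (sourceC n k m) (targetC n k m) ∧
    Set.BijOn mapD (sourceD n k m) (targetD n k m) ∧
    -- the four sources partition the left side of the bijection that is being refined
    (sourceA n k m ∪ sourceB n k m ∪ sourceC n k m ∪ sourceD n k m =
        {p | p ∈ RTrees n k 0 ∧ deg p ⊥ = m} ∧
      [sourceA n k m, sourceB n k m, sourceC n k m, sourceD n k m].Pairwise Disjoint) ∧
    -- the four targets partition its right side
    (targetA n k m ∪ targetB n k m ∪ targetC n k m ∪ targetD n k m =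
        {p | p ∈ RTrees n (k + m) 0 ∧ deg p ⊥ = 0 ∧ m ≤ deg p ⊤ ∧ ⊥ < lowerCritical p} ∧
      [targetA n k m, targetB n k m, targetC n k m, targetD n k m].Pairwise Disjoint) :=
  ⟨bijOn_mapA hm, bijOn_mapB hm, bijOn_mapC hm, bijOn_mapD hm,
    ⟨sources_union hm, sources_disjoint hm⟩, targets_union hm, targets_disjoint⟩
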